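/- **Setting.** Let $(X,d)$ be a metric space with bounded geometry (for every $R\ge 0$ one has $\sup_{x\in X}\sharp B(x,R)<\infty$, where $B(x,R)$ is the closed ball), let $E$ be a complex Banach space and let $p\in\{0\}\cup[1,\infty]$. Put $\ell^p_E(X)=\ell^p(X;E)$ for $p\in[1,\infty]$ and $\ell^0_E(X)=c_0(X;E)$ with the supremum norm. Bounded continuous functions $f\in C_b(X)$ (complex valued) act on $\ell^p_E(X)$ by pointwise multiplication, and $[b,f]=bf-fb$. All supports are closed supports, $d(S,T)=\inf\{d(x,y):x\in S,\,y\in T\}$ and $\inf\emptyset=\infty$. Let $B\subseteq\mathfrak B(\ell^p_E(X))$ be a Banach subalgebra (a norm-closed subalgebra, not necessarily unital) such that $C_b(X)BC_b(X)=B$ and such that $B$ is closed under block cutdowns: for every $a\in B$ and every family $(e_j)_{j\in J}$ of positive contractions in $C_b(X)$ with pairwise disjoint supports, $\sum_{j\in J}e_jae_j\in B$, where the sum converges strongly if $p\neq\infty$, and in the sense that $\sum_j (e_jae_jv)(x)$ converges in $E$ for all $v\in\ell^\infty_E(X)$ and $x\in X$ if $p=\infty$. **Notions.** * For a Banach algebra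 $A$ let $A_\infty=\ell^\infty(\mathbb N,A)/\{(a_n):\lim_n\|a_n\|=0\}$, and regard $A$ as a subalgebra of $A_\infty$ through constant sequences. A bounded sequence $(f_n)$ in $C_b(X)$ is very Lipschitz if for every $L>0$ there is $n_0$ such that $f_n$ is $L$-Lipschitz for all $n\ge n_0$. $\mathrm{VL}_\infty(X)$ is the quotient of the algebra of very Lipschitz sequences by those with $\|f_n\|\to0$; through the multiplication action it is regarded as contained in $\mathfrak B(\ell^p_E(X))_\infty$. * An operator $a\in\mathfrak B(\ell^p_E(X))$ has finite propagation if there is $R\ge0$ such that $faf'=0$ for all $f,f'\in C_b(X)$ with $d(\mathrm{supp} f,\mathrm{supp} f')>R$. It is quasi-local if for every $\varepsilon>0$ there is $R\ge 0$ such that $\|faf'\|<\varepsilon$ for all $f,f'\in C_b(X)$ with $\|f\|,\|f'\|\le1$ and $d(\mathrm{supp} f,\mathrm{supp} f')>R$. * $\mathrm{Roe}(X,B)$ is the norm closure of the set of finite propagation operators in $B$, and $\mathcal K(X,B)$ is the norm closure of $C_0(X)BC_0(X)$. * $g\in C_b(X)$ is a Higson function if for all $R,\varepsilon>0$ there is a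 compact $K\subseteq X$ such that $|g(x)-g(y)|<\varepsilon$ for all $x,y\in X\setminus K$ with $d(x,y)<R$. * For $q\in[1,\infty)$, a metric $q$-partition of unity is a family $(\phi_i\colon X\to[0,1])_{i\in I}$ whose supports have uniformly bounded diameters and finite multiplicity (some $M$ bounds the number of supports containing any given point) and with $\sum_i\phi_i(x)^q=1$ for all $x\in X$. It has $(r,\varepsilon)$-variation if $\sum_i|\phi_i(x)-\phi_i(y)|^q<\varepsilon^q$ whenever $d(x,y)\le r$. $X$ has Property A if, for some $q\in[1,\infty)$ (equivalently, for all of them), for all $r,\varepsilon>0$ there is a metric $q$-partition of unity with $(r,\varepsilon)$-variation. **Theorem.** For $b\in B$, consider the following conditions: 1. [(i)] $[b,f]=0$ in $\mathfrak B(\ell^p_E(X))_\infty$ for all $f\in\mathrm{VL}_\infty(X)$; 2. [(ii)] $b$ is quasi-local; 3. [(iii)] $[b,g]\in\mathcal K(X,B)$ for every Higson function $g$ on $X$; 4. [(iv)] $b\in\mathrm{Roe}(X,B)$. Then: 1. if $p\in\{0,1,\infty\}$, then (i), (ii), (iii) and (iv) are equivalent; 2. if $p\in(1,\infty)$, then (i),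 (ii) and (iii) are equivalent, and if moreover $X$ has Property A, then (i), (ii), (iii) and (iv) are equivalent. -/

import Mathlib

open scoped BoundedContinuousFunction ZeroAtInfty ENNReal NNReal Topology

universe u v w

namespace RoeLike

noncomputable section

/-- A metric space has bounded geometry if, for every `R`, the cardinalities of the closed balls of
radius `R` are uniformly bounded. -/
def BoundedGeometry (X : Type u) [MetricSpace X] : Prop :=
  ∀ R : ℝ, ∃ N : ℕ, ∀ x : X, (Metric.closedBall x R).encard ≤ N

/-- The index set `{0} ∪ [1, ∞]` of the scale of spaces `ℓ^p_E(X)`. -/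
inductive LpIndex : Type
  | zero : LpIndex
  | ofOneLE (p : ℝ≥0∞) (hp : 1 ≤ p) : LpIndex

namespace LpIndex

/-- The index `p = 1`. -/
abbrev one : LpIndex := ofOneLE 1 le_rfl

/-- The index `p = ∞`. -/
abbrev infty : LpIndex := ofOneLE ∞ le_top

/-- The exponent of the norm: `ℓ^0 = c_0` carries the supremum norm, `ℓ^p` the `p`-norm. -/
def exponent : LpIndex → ℝ≥0∞
  | zero => ∞
  | ofOneLE p _ => p

theorem one_le_exponent : ∀ p : LpIndex, 1 ≤ p.exponent
  | zero => le_top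
  | ofOneLE _ hp => hp

instance instFactOneLE (p : LpIndex) : Fact (1 ≤ p.exponent) := ⟨p.one_le_exponent⟩

end LpIndex

section Space

variable (X : Type u) [MetricSpace X] (E : Type v) [NormedAddCommGroup E] [NormedSpace ℂ E]

/-- The space `ℓ^p_E(X)`, as a subspace of Mathlib's `lp`. For `p ∈ [1, ∞]` it is all of
`ℓ^p(X; E)`; for `p = 0` it is the space `c_0(X; E)` of continuous functions vanishing at infinity,
inside `ℓ^∞(X; E)`. -/
def ellPSubmodule (p : LpIndex) : Submodule ℂ (lp (fun _ : X => E) p.exponent) where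
  carrier := {ξ | p = .zero →
    Continuous (ξ : X → E) ∧ Filter.Tendsto (ξ : X → E) (Filter.cocompact X) (𝓝 0)}
  zero_mem' := fun _ => by
    rw [lp.coeFn_zero]
    exact ⟨continuous_zero, tendsto_const_nhds⟩
  add_mem' := fun {ξ η} hξ hη h => by
    rw [lp.coeFn_add]
    exact ⟨(hξ h).1.add (hη h).1, by rw [← add_zero (0 : E)]; exact (hξ h).2.add (hη h).2⟩
  smul_mem' := fun c ξ hξ h => by
    rw [lp.coeFn_smul]
    exact ⟨(hξ h).1.const_smul c, by rw [← smul_zero c]; exact (hξ h).2.const_smul c⟩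

/-- The normed space `ℓ^p_E(X)`. -/
def ellP (p : LpIndex) : Type (max u v) := ellPSubmodule X E p

instance instNormedAddCommGroupEllP (p : LpIndex) : NormedAddCommGroup (ellP X E p) :=
  inferInstanceAs (NormedAddCommGroup (ellPSubmodule X E p))

instance instNormedSpaceEllP (p : LpIndex) : NormedSpace ℂ (ellP X E p) :=
  inferInstanceAs (NormedSpace ℂ (ellPSubmodule X E p))

/-- The algebra `𝔅(ℓ^p_E(X))` of bounded linear operators. -/
abbrev Op (p : LpIndex) : Type (max u v) := ellP X E p →L[ℂ] ellP X E p

end Space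

section Mul

variable {X : Type u} [MetricSpace X] {E : Type v} [NormedAddCommGroup E] [NormedSpace ℂ E]
  {p : LpIndex}

/-- A vector of `ℓ^p_E(X)` as an element of Mathlib's `lp`. -/
def ellP.toLp (ξ : ellP X E p) : lp (fun _ : X => E) p.exponent := ξ.1

/-- The value `ξ(x)` of a vector `ξ ∈ ℓ^p_E(X)` at a point `x`. -/
def value (ξ : ellP X E p) (x : X) : E := ξ.toLp x

theorem norm_bcf_smul_le (f : X →ᵇ ℂ) (ξ : ellP X E p) (x : X) :
    ‖f x • value ξ x‖ ≤ ‖((‖f‖ : ℂ) • ξ.toLp) x‖ := by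
  rw [lp.coeFn_smul, Pi.smul_apply, norm_smul, norm_smul, Complex.norm_real, norm_norm]
  exact mul_le_mul_of_nonneg_right (f.norm_coe_le_norm x) (norm_nonneg _)

/-- The pointwise product `f ξ` of `f ∈ C_b(X)` and `ξ ∈ ℓ^p_E(X)`. -/
def mulVec (f : X →ᵇ ℂ) (ξ : ellP X E p) : ellP X E p :=
  ⟨⟨fun x => f x • value ξ x, (lp.memℓp _).mono' (norm_bcf_smul_le f ξ)⟩, fun h => by
    refine ⟨f.continuous.smul (ξ.2 h).1, ?_⟩
    have h0 := ((ξ.2 h).2.norm.const_mul ‖f‖)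
    rw [norm_zero, mul_zero] at h0
    refine squeeze_zero_norm (fun x => ?_) h0
    change ‖f x • value ξ x‖ ≤ ‖f‖ * ‖value ξ x‖
    rw [norm_smul]
    exact mul_le_mul_of_nonneg_right (f.norm_coe_le_norm x) (norm_nonneg _)⟩

theorem value_mulVec (f : X →ᵇ ℂ) (ξ : ellP X E p) (x : X) :
    value (mulVec f ξ) x = f x • value ξ x := rfl

theorem ellP_ext {ξ η : ellP X E p} (h : ∀ x, value ξ x = value η x) : ξ = η :=
  Subtype.ext (lp.ext (funext h))

theorem norm_mulVec_le (f : X →ᵇ ℂ) (ξ : ellP X E p) : ‖mulVec f ξ‖ ≤ ‖f‖ * ‖ξ‖ := by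
  have h0 : p.exponent ≠ 0 := (zero_lt_one.trans_le p.one_le_exponent).ne'
  have h := lp.norm_mono h0 (x := (mulVec f ξ).toLp) (y := (‖f‖ : ℂ) • ξ.toLp)
    (norm_bcf_smul_le f ξ)
  rw [norm_smul, Complex.norm_real, norm_norm] at h
  exact h

variable (E p) in
/-- The multiplication representation `ρ : C_b(X) → 𝔅(ℓ^p_E(X))`, `(ρ(f) ξ)(x) = f(x) ξ(x)`. -/
def mulOp (f : X →ᵇ ℂ) : Op X E p :=
  LinearMap.mkContinuous
    { toFun := mulVec f
      map_add' := fun ξ η => ellP_ext fun x => smul_add (f x) (value ξ x) (value η x)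
      map_smul' := fun c ξ => ellP_ext fun x => smul_comm (f x) c (value ξ x) }
    ‖f‖ (norm_mulVec_le f)

theorem value_mulOp (f : X →ᵇ ℂ) (ξ : ellP X E p) (x : X) :
    value (mulOp E p f ξ) x = f x • value ξ x := rfl

theorem norm_mulOp_le (f : X →ᵇ ℂ) : ‖mulOp E p f‖ ≤ ‖f‖ :=
  LinearMap.mkContinuous_norm_le _ (norm_nonneg f) _

end Mul

section Algebras

variable {X : Type u} [MetricSpace X] {E : Type v} [NormedAddCommGroup E] [NormedSpace ℂ E]
  {p : LpIndex}

open scoped ComplexOrder in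
/-- A family of positive contractions in `C_b(X)` with pairwise disjoint supports. -/
def IsBlockFamily {J : Type u} (e : J → X →ᵇ ℂ) : Prop :=
  (∀ j x, 0 ≤ e j x) ∧ (∀ j, ‖e j‖ ≤ 1) ∧
    Pairwise fun i j => Disjoint (tsupport (e i)) (tsupport (e j))

/-- `T` is the sum `∑ j, e_j a e_j`, which is taken in the strong operator topology when `p ≠ ∞` and
in the topology of pointwise strong convergence when `p = ∞`. -/
def IsBlockCutdown {J : Type u} (e : J → X →ᵇ ℂ) (a T : Op X E p) : Prop :=
  (p ≠ .infty → ∀ ξ : ellP X E p,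
    HasSum (fun j => (mulOp E p (e j) * a * mulOp E p (e j)) ξ) (T ξ)) ∧
  (p = .infty → ∀ (ξ : ellP X E p) (x : X),
    HasSum (fun j => value ((mulOp E p (e j) * a * mulOp E p (e j)) ξ) x) (value (T ξ) x))

/-- Every block cutdown of an element of `B` belongs to `B`. Index types in the universe of `X`
suffice, since at most `|X|` members of a block family are nonzero. -/
def ClosedUnderBlockCutdowns (B : NonUnitalSubalgebra ℂ (Op X E p)) : Prop :=
  ∀ (J : Type u) (e : J → X →ᵇ ℂ), IsBlockFamily e →
    ∀ a ∈ B, ∀ T : Op X E p, IsBlockCutdown e a T → T ∈ B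

/-- The set `C_b(X) B C_b(X)` of products `f b g`. -/
def cbMulCb (B : NonUnitalSubalgebra ℂ (Op X E p)) : Set (Op X E p) :=
  {T | ∃ (f g : X →ᵇ ℂ), ∃ b ∈ B, T = mulOp E p f * b * mulOp E p g}

/-- The distance `inf {d(x, y) : x ∈ S, y ∈ T}` of two subsets, with `inf ∅ = ∞`. -/
def setDist (S T : Set X) : ℝ≥0∞ := ⨅ x ∈ S, ⨅ y ∈ T, edist x y

/-- `a` has propagation at most `R`. -/
def PropagationLE (a : Op X E p) (R : ℝ) : Prop :=
  ∀ f f' : X →ᵇ ℂ, ENNReal.ofReal R < setDist (tsupport f) (tsupport f') →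
    mulOp E p f * a * mulOp E p f' = 0

/-- `a` has finite propagation. -/
def FinitePropagation (a : Op X E p) : Prop :=
  ∃ R : ℝ, 0 ≤ R ∧ PropagationLE a R

/-- `a` has `ε`-propagation at most `R`. -/
def EpsPropagationLE (a : Op X E p) (ε R : ℝ) : Prop :=
  ∀ f f' : X →ᵇ ℂ, ‖f‖ ≤ 1 → ‖f'‖ ≤ 1 →
    ENNReal.ofReal R < setDist (tsupport f) (tsupport f') →
    ‖mulOp E p f * a * mulOp E p f'‖ < ε

/-- `a` is quasi-local: it has finite `ε`-propagation for every `ε > 0`. -/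
def QuasiLocal (a : Op X E p) : Prop :=
  ∀ ε : ℝ, 0 < ε → ∃ R : ℝ, 0 ≤ R ∧ EpsPropagationLE a ε R

/-- The Roe-like algebra `Roe(X, B)`: the norm closure of the finite propagation operators
in `B`. -/
def Roe (B : NonUnitalSubalgebra ℂ (Op X E p)) : Set (Op X E p) :=
  closure {a | a ∈ B ∧ FinitePropagation a}

/-- `𝒦(X, B)`: the norm closure of `C_0(X) B C_0(X)`. -/
def kIdeal (B : NonUnitalSubalgebra ℂ (Op X E p)) : Set (Op X E p) :=
  closure {T | ∃ (f g : C₀(X, ℂ)), ∃ b ∈ B, T = mulOp E p f.toBCF * b * mulOp E p g.toBCF}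

end Algebras

section Sequences

variable (A : Type w) [NonUnitalNormedRing A]

/-- The algebra `ℓ^∞(ℕ, A)` of bounded sequences in `A`. -/
abbrev BddSeq : Type w := lp (fun _ : ℕ => A) ∞

/-- The two-sided ideal of sequences converging to `0` in the algebra `ℓ^∞(ℕ, A)`. -/
def nullIdeal : TwoSidedIdeal (BddSeq A) :=
  TwoSidedIdeal.mk' {a | Filter.Tendsto (fun n => ‖a n‖) Filter.atTop (𝓝 0)}
    (by simp)
    (fun {a b} ha hb => by
      refine squeeze_zero (fun n => norm_nonneg _) (fun n => ?_) (by simpa using ha.add hb)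
      rw [lp.coeFn_add]
      exact norm_add_le _ _)
    (fun {a} ha => by
      simpa [lp.coeFn_neg] using ha)
    (fun {a b} hb => by
      refine squeeze_zero (fun n => norm_nonneg _) (fun n => ?_)
        (by simpa using hb.const_mul ‖a‖)
      rw [lp.infty_coeFn_mul]
      exact (norm_mul_le _ _).trans (mul_le_mul_of_nonneg_right
        (lp.norm_apply_le_norm ENNReal.top_ne_zero a n) (norm_nonneg _)))
    (fun {a b} ha => by
      refine squeeze_zero (fun n => norm_nonneg _) (fun n => ?_)
        (by simpa using ha.mul_const ‖b‖)
      rw [lp.infty_coeFn_mul]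
      exact (norm_mul_le _ _).trans (mul_le_mul_of_nonneg_left
        (lp.norm_apply_le_norm ENNReal.top_ne_zero b n) (norm_nonneg _)))

/-- The sequence algebra `A_∞ = ℓ^∞(ℕ, A) / {null sequences}`. -/
abbrev SeqAlg : Type w := (nullIdeal A).ringCon.Quotient

variable {A}

/-- The class in `A_∞` of a bounded sequence in `A`. -/
def seqClass (a : BddSeq A) : SeqAlg A := (a : (nullIdeal A).ringCon.Quotient)

/-- The class in `A_∞` of the constant sequence with value `a`. -/
def constClass (a : A) : SeqAlg A :=
  seqClass ⟨fun _ => a, memℓp_infty ⟨‖a‖, by rintro _ ⟨_, rfl⟩; exact le_rfl⟩⟩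

end Sequences

section Functions

variable {X : Type u} [MetricSpace X]

/-- A bounded sequence in `C_b(X)` is very Lipschitz if for every `L > 0` all but finitely many of
its members are `L`-Lipschitz. -/
def VeryLipschitz (f : ℕ → X →ᵇ ℂ) : Prop :=
  (∃ C : ℝ, ∀ n, ‖f n‖ ≤ C) ∧
    ∀ L : ℝ≥0, 0 < L → ∃ n₀ : ℕ, ∀ n, n₀ ≤ n → LipschitzWith L (f n)

/-- `g` is a Higson function (a slowly oscillating function). -/
def IsHigson (g : X →ᵇ ℂ) : Prop :=
  ∀ R ε : ℝ, 0 < R → 0 < ε → ∃ K : Set X, IsCompact K ∧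
    ∀ x ∉ K, ∀ y ∉ K, dist x y < R → ‖g x - g y‖ < ε

/-- `φ` is a metric `q`-partition of unity on `X`. -/
def IsMetricPartition (q : ℝ) {I : Type u} (φ : I → X → ℝ) : Prop :=
  (∀ i x, φ i x ∈ Set.Icc (0 : ℝ) 1) ∧
  (∃ D : ℝ, ∀ i, ∀ x ∈ tsupport (φ i), ∀ y ∈ tsupport (φ i), dist x y ≤ D) ∧
  (∃ M : ℕ, ∀ x, {i | x ∈ tsupport (φ i)}.encard ≤ M) ∧
  ∀ x, HasSum (fun i => φ i x ^ q) 1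

/-- The `q`-partition of unity `φ` has `(r, ε)`-variation. The sum has only finitely many nonzero
terms when `φ` is a metric `q`-partition of unity. -/
def HasVariation (q : ℝ) {I : Type u} (φ : I → X → ℝ) (r ε : ℝ) : Prop :=
  ∀ x y : X, dist x y ≤ r → ∑' i, |φ i x - φ i y| ^ q < ε ^ q

variable (X) in
/-- Property A: for some `q ∈ [1, ∞)` there are metric `q`-partitions of unity of arbitrarily small
variation. (The condition does not depend on `q`.) -/
def PropertyA : Prop :=
  ∃ q : ℝ, 1 ≤ q ∧ ∀ r ε : ℝ, 0 < r → 0 < ε →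
    ∃ (I : Type u) (φ : I → X → ℝ), IsMetricPartition q φ ∧ HasVariation q φ r ε

end Functions

section Commutant

variable (X : Type u) [MetricSpace X] (E : Type v) [NormedAddCommGroup E] [NormedSpace ℂ E]
  (p : LpIndex)

/-- The bounded sequence `(ρ(f_n))` in `𝔅(ℓ^p_E(X))` of a very Lipschitz sequence `(f_n)`. -/
def mulSeq (f : ℕ → X →ᵇ ℂ) (hf : VeryLipschitz f) : BddSeq (Op X E p) :=
  ⟨fun n => mulOp E p (f n), memℓp_infty (by
    obtain ⟨C, hC⟩ := hf.1
    refine ⟨C, ?_⟩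
    rintro _ ⟨n, rfl⟩
    exact (norm_mulOp_le (f n)).trans (hC n))⟩

/-- `VL_∞(X)`, regarded as a subset of `𝔅(ℓ^p_E(X))_∞` by means of the multiplication
representation. -/
def VLInfty : Set (SeqAlg (Op X E p)) :=
  {F | ∃ (f : ℕ → X →ᵇ ℂ) (hf : VeryLipschitz f), F = seqClass (mulSeq X E p f hf)}

variable {X E p}

/-- `[b, f] = 0` in `𝔅(ℓ^p_E(X))_∞` for all `f ∈ VL_∞(X)`, where `b` is identified with the class of
the constant sequence `b`. -/
def CommutesWithVL (b : Op X E p) : Prop :=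
  ∀ F ∈ VLInfty X E p, constClass b * F - F * constClass b = 0

/-- `[b, g] ∈ 𝒦(X, B)` for every Higson function `g`. -/
def HigsonCommutatorsIn (B : NonUnitalSubalgebra ℂ (Op X E p)) (b : Op X E p) : Prop :=
  ∀ g : X →ᵇ ℂ, IsHigson g → b * mulOp E p g - mulOp E p g * b ∈ kIdeal B

end Commutant

end

end RoeLike

/-!
# Quasi-local operators, commutators and Roe-like algebras

A space of bounded geometry is discrete with finite balls. So every bounded function is continuous,
the compact sets are the finite ones, and each subset `S` gives an idempotent `cut S` on
`ℓ^p_E(X)`. An operator `b` is quasi-local if and only if its corners `cut A * b * cut C` tend to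
`0` as the distance of `A` and `C` grows (`quasiLocal_iff_farCornersLE`), and all conditions are
compared with this one.

*Quasi-local operators almost commute with slowly varying functions* (`exists_norm_cut_comm_le`).
Up to a small error a slowly varying function is a multiple of an integer-valued function whose
level sets are far apart unless the levels are equal or adjacent. Corners between distant levels
are small. Adjacent levels contribute two block operators, and such operators are bounded by `‖b‖`
for every `p`, because pinching is an average of the maps `T ↦ (1 - 2 P) T (1 - 2 Q)` with
`‖1 - 2 P‖, ‖1 - 2 Q‖ ≤ 1` (`norm_sub_pinch_le`). Applied on all of `X` this gives the commutation with
very Lipschitz sequences; applied off a finite set it shows that commutators with Higson functions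
are limits of finitely supported operators (`higsonCommutatorsIn_of_quasiLocal`).

*Converses.* A large corner between sets `A`, `C` at distance more than `n` yields a
`1 / n`-Lipschitz function with a large commutator, since the corner of `[b, f]` is minus that of `b`
when `f = 1` on `A` and `f = 0` on `C`. For Higson functions a gliding hump is used: commutators
with indicators of finite sets show that the large corners can be taken between finite sets, far
away from all sets chosen before (`exists_finite_large_corner`), and a single Higson function
separates all pairs at once (`exists_isHigson_separating`).

*Approximation by operators of finite propagation.* A family of sets of bounded diameter and finite
multiplicity splits into finitely many disjoint families, so closure under block cutdowns puts all
operators `∑ i, u i b (v i)`, with `u i` and `v i` supported in the `i`-th set, into `B`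
(`exists_sum_mul_mul_mem`). For the supremum norm, respectively the `ℓ¹`-norm, the norm of an
operator is determined by its rows, respectively its columns, and truncating these gives the
approximation. For `1 < p < ∞`, the averages `∑ i, ψ i ^ (1 / p') b ψ i ^ (1 / p)` over a partition
of unity `ψ` are used. By Hölder's inequality they have no larger far corners than `b`, and they
are close to `b` on vectors of support small compared to the scale of `ψ` (`exists_average`).
Closeness on such vectors is enough by norm localisation: under Property A at least half of the
mass of a vector sits on sets of bounded diameter that are far apart
(`PropertyA.exists_hasSparsification`), and for operators with small far corners these sets hardly
interact (`norm_le_of_hasSparsification`).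
-/

namespace RoeLike

noncomputable section

variable {X : Type u} [MetricSpace X] {E : Type v} [NormedAddCommGroup E] [NormedSpace ℂ E]
  {p : LpIndex}

section

/-! ### Vectors, multiplication operators and cut-downs -/

theorem value_zero (x : X) : value (0 : ellP X E p) x = 0 := rfl

theorem value_add (ξ η : ellP X E p) (x : X) : value (ξ + η) x = value ξ x + value η x := rfl

theorem value_sub (ξ η : ellP X E p) (x : X) : value (ξ - η) x = value ξ x - value η x := rfl

theorem value_smul (c : ℂ) (ξ : ellP X E p) (x : X) : value (c • ξ) x = c • value ξ x := rfl

theorem value_sum {ι : Type*} (F : Finset ι) (ξ : ι → ellP X E p) (x : X) :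
    value (∑ i ∈ F, ξ i) x = ∑ i ∈ F, value (ξ i) x := by
  classical
  induction F using Finset.induction_on with
  | empty => simp [value_zero]
  | insert i F hi ih => rw [Finset.sum_insert hi, Finset.sum_insert hi, value_add, ih]

theorem exponent_ne_zero (p : LpIndex) : p.exponent ≠ 0 :=
  (zero_lt_one.trans_le p.one_le_exponent).ne'

theorem norm_value_le (ξ : ellP X E p) (x : X) : ‖value ξ x‖ ≤ ‖ξ‖ :=
  lp.norm_apply_le_norm (exponent_ne_zero p) ξ.toLp x

theorem op_ext {S T : Op X E p} (h : ∀ ξ x, value (S ξ) x = value (T ξ) x) : S = T :=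
  ContinuousLinearMap.ext fun ξ => ellP_ext (h ξ)

theorem mulOp_mul (f g : X →ᵇ ℂ) : mulOp E p (f * g) = mulOp E p f * mulOp E p g :=
  op_ext fun _ _ => mul_smul _ _ _

theorem mulOp_add (f g : X →ᵇ ℂ) : mulOp E p (f + g) = mulOp E p f + mulOp E p g :=
  op_ext fun _ _ => add_smul _ _ _

theorem mulOp_sub (f g : X →ᵇ ℂ) : mulOp E p (f - g) = mulOp E p f - mulOp E p g :=
  op_ext fun _ _ => sub_smul _ _ _

theorem mulOp_smul (c : ℂ) (f : X →ᵇ ℂ) : mulOp E p (c • f) = c • mulOp E p f :=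
  op_ext fun _ _ => smul_assoc c _ _

theorem mulOp_one : mulOp E p (1 : X →ᵇ ℂ) = 1 :=
  op_ext fun _ _ => one_smul _ _

theorem mulOp_zero : mulOp E p (0 : X →ᵇ ℂ) = 0 :=
  op_ext fun _ _ => zero_smul _ _

theorem norm_mul_le_right_of_le_one {S T : Op X E p} (hT : ‖T‖ ≤ 1) : ‖S * T‖ ≤ ‖S‖ :=
  (norm_mul_le _ _).trans (mul_le_of_le_one_right (norm_nonneg _) hT)

theorem norm_mul_le_left_of_le_one {S T : Op X E p} (hT : ‖T‖ ≤ 1) : ‖T * S‖ ≤ ‖S‖ :=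
  (norm_mul_le _ _).trans (mul_le_of_le_one_left (norm_nonneg _) hT)

theorem norm_mulOp_le_of_forall {f : X →ᵇ ℂ} {C : ℝ} (hC : 0 ≤ C) (h : ∀ x, ‖f x‖ ≤ C) :
    ‖mulOp E p f‖ ≤ C :=
  (norm_mulOp_le f).trans ((BoundedContinuousFunction.norm_le hC).2 h)

/-- Bounded geometry forces the topology to be discrete: a ball containing finitely many points
shrinks to its centre. -/
theorem BoundedGeometry.discreteTopology (hX : BoundedGeometry X) : DiscreteTopology X := by
  refine discreteTopology_iff_isOpen_singleton.2 fun x => ?_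
  obtain ⟨N, hN⟩ := hX 1
  have hfin : (Metric.closedBall x 1).Finite := Set.finite_of_encard_le_coe (hN x)
  have h1 : IsClosed (Metric.closedBall x 1 \ {x}) := (hfin.subset Set.sdiff_subset).isClosed
  have h2 : ({x} : Set X) = Metric.ball x 1 ∩ (Metric.closedBall x 1 \ {x})ᶜ := by
    ext y
    simp only [Set.mem_singleton_iff, Set.mem_inter_iff, Metric.mem_ball, Set.mem_compl_iff,
      Set.mem_sdiff, Metric.mem_closedBall, not_and, not_not]
    constructor
    · rintro rfl
      simp
    · exact fun h => h.2 h.1.le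
  rw [h2]
  exact Metric.isOpen_ball.inter h1.isOpen_compl

theorem BoundedGeometry.finite_closedBall (hX : BoundedGeometry X) (x : X) (R : ℝ) :
    (Metric.closedBall x R).Finite := by
  obtain ⟨N, hN⟩ := hX R
  exact Set.finite_of_encard_le_coe (hN x)

theorem BoundedGeometry.finite_nhd (hX : BoundedGeometry X) {S : Set X} (hS : S.Finite) (R : ℝ) :
    {x | ∃ y ∈ S, dist x y ≤ R}.Finite :=
  (hS.biUnion fun y _ => hX.finite_closedBall y R).subset fun _ ⟨_, hy, h⟩ =>
    Set.mem_biUnion hy (Metric.mem_closedBall.2 h)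

variable [DiscreteTopology X]

theorem tsupport_eq_support {M : Type*} [Zero M] (f : X → M) : tsupport f = Function.support f :=
  closure_discrete _

open scoped Classical in
/-- The indicator function of a subset of `X`, as an element of `C_b(X)`. -/
def chi (S : Set X) : X →ᵇ ℂ :=
  BoundedContinuousFunction.ofNormedAddCommGroupDiscrete (fun x => if x ∈ S then 1 else 0) 1
    fun x => by split_ifs <;> simp

theorem chi_mem {S : Set X} {x : X} (h : x ∈ S) : chi S x = 1 := if_pos h

theorem chi_notMem {S : Set X} {x : X} (h : x ∉ S) : chi S x = 0 := if_neg h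

theorem norm_chi_le (S : Set X) : ‖chi S‖ ≤ 1 :=
  (BoundedContinuousFunction.norm_le zero_le_one).2 fun x => by
    by_cases h : x ∈ S
    · simp [chi_mem h]
    · simp [chi_notMem h]

theorem support_chi (S : Set X) : Function.support (chi S) = S := by
  ext x
  by_cases h : x ∈ S
  · simp [chi_mem h, h]
  · simp [chi_notMem h, h]

theorem tsupport_chi (S : Set X) : tsupport (chi S) = S := by
  rw [tsupport_eq_support, support_chi]

theorem chi_mul_chi (S T : Set X) : chi S * chi T = chi (S ∩ T) := by
  ext x
  by_cases h : x ∈ S <;> by_cases h' : x ∈ T <;> simp [chi, h, h']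

theorem chi_compl (S : Set X) : chi Sᶜ = 1 - chi S := by
  ext x
  by_cases h : x ∈ S <;> simp [chi, h]

theorem chi_mul_eq_self {S : Set X} {f : X →ᵇ ℂ} (h : ∀ x ∉ S, f x = 0) : chi S * f = f := by
  ext x
  by_cases hx : x ∈ S
  · simp [chi_mem hx]
  · simp [chi_notMem hx, h x hx]

variable (E p) in
/-- The idempotent of `𝔅(ℓ^p_E(X))` given by restriction of vectors to the subset `S`. -/
def cut (S : Set X) : Op X E p := mulOp E p (chi S)

theorem value_cut_mem {S : Set X} {x : X} (h : x ∈ S) (ξ : ellP X E p) :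
    value (cut E p S ξ) x = value ξ x := by
  rw [cut, value_mulOp, chi_mem h, one_smul]

theorem value_cut_notMem {S : Set X} {x : X} (h : x ∉ S) (ξ : ellP X E p) :
    value (cut E p S ξ) x = 0 := by
  rw [cut, value_mulOp, chi_notMem h, zero_smul]

theorem norm_cut_le (S : Set X) : ‖cut E p S‖ ≤ 1 := (norm_mulOp_le _).trans (norm_chi_le S)

theorem norm_cut_apply_le (S : Set X) (ξ : ellP X E p) : ‖cut E p S ξ‖ ≤ ‖ξ‖ := by
  simpa using (cut E p S).le_of_opNorm_le (norm_cut_le S) ξ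

theorem cut_mul_cut (S T : Set X) : cut E p S * cut E p T = cut E p (S ∩ T) := by
  rw [cut, cut, ← mulOp_mul, chi_mul_chi, cut]

theorem cut_mul_self (S : Set X) : cut E p S * cut E p S = cut E p S := by
  rw [cut_mul_cut, Set.inter_self]

theorem cut_compl (S : Set X) : cut E p Sᶜ = 1 - cut E p S := by
  rw [cut, chi_compl, mulOp_sub, mulOp_one, cut]

theorem cut_univ : cut E p (Set.univ : Set X) = 1 :=
  op_ext fun ξ x => value_cut_mem (Set.mem_univ x) ξ

theorem cut_empty : cut E p (∅ : Set X) = 0 :=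
  op_ext fun ξ x => value_cut_notMem (Set.notMem_empty x) ξ

theorem cut_mul_mulOp_comm (S : Set X) (f : X →ᵇ ℂ) :
    cut E p S * mulOp E p f = mulOp E p f * cut E p S := by
  rw [cut, ← mulOp_mul, ← mulOp_mul, mul_comm]

theorem cut_mul_mulOp_of_support {S : Set X} {f : X →ᵇ ℂ} (h : ∀ x ∉ S, f x = 0) :
    cut E p S * mulOp E p f = mulOp E p f := by
  rw [cut, ← mulOp_mul, chi_mul_eq_self h]

theorem mulOp_mul_cut_of_support {S : Set X} {f : X →ᵇ ℂ} (h : ∀ x ∉ S, f x = 0) :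
    mulOp E p f * cut E p S = mulOp E p f := by
  rw [← cut_mul_mulOp_comm, cut_mul_mulOp_of_support h]

theorem cut_add_cut_diff {S T : Set X} (h : S ⊆ T) :
    cut E p S + cut E p (T \ S) = cut E p T := by
  refine op_ext fun ξ x => ?_
  rw [add_apply, value_add]
  by_cases hS : x ∈ S
  · rw [value_cut_mem hS, value_cut_mem (h hS), value_cut_notMem fun h' => h'.2 hS, add_zero]
  · rw [value_cut_notMem hS, zero_add]
    by_cases hT : x ∈ T
    · rw [value_cut_mem hT, value_cut_mem (S := T \ S) ⟨hT, hS⟩]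
    · rw [value_cut_notMem hT, value_cut_notMem fun h' => hT h'.1]

theorem norm_cut_mul_cut_mono {A A' C C' : Set X} (hA : A ⊆ A') (hC : C ⊆ C') (T : Op X E p) :
    ‖cut E p A * T * cut E p C‖ ≤ ‖cut E p A' * T * cut E p C'‖ := by
  have h1 : cut E p A * T * cut E p C
      = cut E p A * (cut E p A' * T * cut E p C') * cut E p C := by
    have e1 : cut E p A = cut E p A * cut E p A' := by
      rw [cut_mul_cut, Set.inter_eq_left.2 hA]
    have e2 : cut E p C = cut E p C' * cut E p C := by
      rw [cut_mul_cut, Set.inter_eq_right.2 hC]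
    calc _ = (cut E p A * cut E p A') * T * (cut E p C' * cut E p C) := by rw [← e1, ← e2]
      _ = _ := by noncomm_ring
  rw [h1]
  exact (norm_mul_le_right_of_le_one (norm_cut_le C)).trans
    (norm_mul_le_left_of_le_one (norm_cut_le A))

theorem norm_cut_mul_mono {A A' : Set X} (hA : A ⊆ A') (T : Op X E p) :
    ‖cut E p A * T‖ ≤ ‖cut E p A' * T‖ := by
  simpa [cut_univ] using norm_cut_mul_cut_mono hA (Set.Subset.refl Set.univ) T

theorem norm_mul_cut_mono {C C' : Set X} (hC : C ⊆ C') (T : Op X E p) :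
    ‖T * cut E p C‖ ≤ ‖T * cut E p C'‖ := by
  simpa [cut_univ] using norm_cut_mul_cut_mono (Set.Subset.refl Set.univ) hC T

open Filter in
/-- The norm of a vector is the supremum of the norms of its finite cut-downs, for every `p`. -/
theorem norm_le_of_finite_cut {ξ : ellP X E p} {C : ℝ}
    (h : ∀ G : Finset X, ‖cut E p (G : Set X) ξ‖ ≤ C) : ‖ξ‖ ≤ C := by
  refine lp.norm_le_of_tendsto (l := atTop) (F := fun G : Finset X => (cut E p (G : Set X) ξ).toLp)
    (f := ξ.toLp) (Eventually.of_forall h) ?_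
  refine tendsto_pi_nhds.2 fun x => tendsto_const_nhds.congr' ?_
  filter_upwards [eventually_ge_atTop {x}] with G hG
  exact (value_cut_mem (Finset.mem_coe.2 (hG (Finset.mem_singleton_self x))) ξ).symm

theorem exists_finite_lt_norm_cut_mul {T : Op X E p} {c : ℝ} (hc0 : 0 ≤ c) (hc : c < ‖T‖) :
    ∃ G : Finset X, c < ‖cut E p (G : Set X) * T‖ := by
  by_contra! h
  refine hc.not_ge (T.opNorm_le_bound hc0 fun ξ => norm_le_of_finite_cut fun G => ?_)
  exact (cut E p (G : Set X) * T).le_of_opNorm_le (h G) ξ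

theorem exists_finset_norm_tail_lt {α F : Type*} [NormedAddCommGroup F] {q : ℝ≥0∞}
    [Fact (1 ≤ q)] (hq : q ≠ ⊤) (f : lp (fun _ : α => F) q) {ε : ℝ} (hε : 0 < ε) :
    ∃ K : Finset α, ∀ g : lp (fun _ : α => F) q,
      (∀ x ∈ K, g x = 0) → (∀ x ∉ K, g x = f x) → ‖g‖ < ε := by
  classical
  have h := lp.hasSum_single (E := fun _ : α => F) hq f
  obtain ⟨K, hK⟩ := (Metric.tendsto_nhds.1 h ε hε).exists
  refine ⟨K, fun g hg0 hg => ?_⟩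
  rw [dist_comm, dist_eq_norm] at hK
  have hg' : g = f - ∑ i ∈ K, lp.single q i (f i) := ?_
  · rwa [hg']
  refine lp.ext (funext fun x => ?_)
  rw [lp.coeFn_sub, Pi.sub_apply, lp.coeFn_sum, Finset.sum_apply]
  by_cases hx : x ∈ K
  · rw [hg0 x hx, Finset.sum_eq_single x, lp.single_apply_self, sub_self]
    · exact fun i _ hi => lp.single_apply_ne _ _ _ hi.symm
    · exact fun h => absurd hx h
  · rw [hg x hx, Finset.sum_eq_zero, sub_zero]
    exact fun i hi => lp.single_apply_ne _ _ _ fun h' => hx (h' ▸ hi)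

/-- For `p ≠ ∞` every vector is concentrated on a finite set up to a small error. -/
theorem exists_finite_norm_cut_compl_lt (hp : p ≠ .infty) (ξ : ellP X E p) {ε : ℝ} (hε : 0 < ε) :
    ∃ K : Finset X, ‖cut E p (K : Set X)ᶜ ξ‖ < ε := by
  classical
  cases p with
  | zero =>
    have h := (ξ.2 rfl).2
    rw [Filter.cocompact_eq_cofinite] at h
    have h2 : {x | ¬ ‖value ξ x‖ < ε / 2}.Finite :=
      (tendsto_zero_iff_norm_tendsto_zero.1 h).eventually_lt_const (half_pos hε)
    refine ⟨h2.toFinset, lt_of_le_of_lt ?_ (half_lt_self hε)⟩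
    refine lp.norm_le_of_forall_le (E := fun _ : X => E) (f := (cut E .zero _ ξ).toLp)
      (half_pos hε).le fun x => ?_
    change ‖value _ x‖ ≤ _
    by_cases hx : ‖value ξ x‖ < ε / 2
    · rw [value_cut_mem (by simpa using hx)]
      exact hx.le
    · rw [value_cut_notMem (by simpa using hx), norm_zero]
      exact (half_pos hε).le
  | ofOneLE q hq =>
    have hq' : q ≠ ⊤ := by
      rintro rfl
      exact hp rfl
    have : Fact (1 ≤ q) := ⟨hq⟩
    obtain ⟨K, hK⟩ := exists_finset_norm_tail_lt hq' ξ.toLp hε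
    exact ⟨K, hK (cut E (.ofOneLE q hq) (K : Set X)ᶜ ξ).toLp
      (fun x hx => value_cut_notMem (by simpa using hx) ξ)
      (fun x hx => value_cut_mem (by simpa using hx) ξ)⟩

end

section

/-! ### Pinching -/

/-- Pinching along two finite families of orthogonal idempotents is an average of the maps
`T ↦ (1 - 2 P_S) T (1 - 2 Q_S)`: a bound on the distance of `T₀` to all of these carries over to
the block diagonal part. -/
theorem norm_sub_pinch_le {A ι : Type*} [NormedRing A] [NormedAlgebra ℝ A] (P Q : ι → A)
    (F : Finset ι)
    (hPF : ∀ i ∈ F, ∀ j ∈ F, i ≠ j → P i * P j = 0)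
    (hQF : ∀ i ∈ F, ∀ j ∈ F, i ≠ j → Q i * Q j = 0) (T₀ : A) {κ : ℝ} (T : A)
    (h : ∀ S ⊆ F, ‖T₀ - (1 - 2 * ∑ i ∈ S, P i) * T * (1 - 2 * ∑ i ∈ S, Q i)‖ ≤ κ) :
    ‖T₀ - (∑ i ∈ F, P i * T * Q i
      + (1 - ∑ i ∈ F, P i) * T * (1 - ∑ i ∈ F, Q i))‖ ≤ κ := by
  classical
  induction F using Finset.induction_on generalizing T with
  | empty => simpa using h ∅ subset_rfl
  | insert j F hj ih =>
    have hPF' : ∀ i ∈ F, ∀ k ∈ F, i ≠ k → P i * P k = 0 := fun i hi k hk =>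
      hPF i (Finset.mem_insert_of_mem hi) k (Finset.mem_insert_of_mem hk)
    have hQF' : ∀ i ∈ F, ∀ k ∈ F, i ≠ k → Q i * Q k = 0 := fun i hi k hk =>
      hQF i (Finset.mem_insert_of_mem hi) k (Finset.mem_insert_of_mem hk)
    have hne : ∀ i ∈ F, i ≠ j := fun i hi h' => hj (h' ▸ hi)
    have hPj : ∀ i ∈ F, P i * P j = 0 := fun i hi =>
      hPF i (Finset.mem_insert_of_mem hi) j (Finset.mem_insert_self _ _) (hne i hi)
    have hQj : ∀ i ∈ F, Q j * Q i = 0 := fun i hi =>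
      hQF j (Finset.mem_insert_self _ _) i (Finset.mem_insert_of_mem hi) (hne i hi).symm
    have sP : ∀ S ⊆ F, (∑ i ∈ S, P i) * P j = 0 := fun S hS => by
      rw [Finset.sum_mul]
      exact Finset.sum_eq_zero fun i hi => hPj i (hS hi)
    have sQ : ∀ S ⊆ F, Q j * ∑ i ∈ S, Q i = 0 := fun S hS => by
      rw [Finset.mul_sum]
      exact Finset.sum_eq_zero fun i hi => hQj i (hS hi)
    set T' : A := (1 - 2 * P j) * T * (1 - 2 * Q j) with hT'
    have h1 := ih hPF' hQF' T fun S hS => h S (hS.trans (Finset.subset_insert _ _))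
    have h2 := ih hPF' hQF' T' fun S hS => by
      have h3 := h (insert j S) (Finset.insert_subset_insert _ hS)
      rw [Finset.sum_insert fun h' => hj (hS h'), Finset.sum_insert fun h' => hj (hS h')] at h3
      convert h3 using 2
      have e1 : (1 - 2 * ∑ i ∈ S, P i) * (1 - 2 * P j) = 1 - 2 * (P j + ∑ i ∈ S, P i) := by
        have : (1 - 2 * ∑ i ∈ S, P i) * (1 - 2 * P j)
            = 1 - 2 * (P j + ∑ i ∈ S, P i) + 4 * ((∑ i ∈ S, P i) * P j) := by noncomm_ring
        rw [this, sP S hS, mul_zero, add_zero]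
      have e2 : (1 - 2 * Q j) * (1 - 2 * ∑ i ∈ S, Q i) = 1 - 2 * (Q j + ∑ i ∈ S, Q i) := by
        have : (1 - 2 * Q j) * (1 - 2 * ∑ i ∈ S, Q i)
            = 1 - 2 * (Q j + ∑ i ∈ S, Q i) + 4 * (Q j * ∑ i ∈ S, Q i) := by noncomm_ring
        rw [this, sQ S hS, mul_zero, add_zero]
      rw [← e1, ← e2, hT']
      simp only [mul_assoc]
    have e3 : ∑ i ∈ F, P i * T' * Q i = ∑ i ∈ F, P i * T * Q i := by
      refine Finset.sum_congr rfl fun i hi => ?_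
      have : P i * T' * Q i = P i * T * Q i - 2 * (P i * P j) * (T * (1 - 2 * Q j) * Q i)
          - 2 * (P i * T) * (Q j * Q i) := by
        rw [hT']
        noncomm_ring
      rw [this, hPj i hi, hQj i hi]
      simp
    set p := ∑ i ∈ F, P i
    set q := ∑ i ∈ F, Q i
    have hp : p * P j = 0 := sP F subset_rfl
    have hq : Q j * q = 0 := sQ F subset_rfl
    have e4 : (1 - p) * T' * (1 - q) = (1 - p - 2 * P j) * T * (1 - q - 2 * Q j) := by
      have a1 : (1 - p) * (1 - 2 * P j) = 1 - p - 2 * P j := by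
        have : (1 - p) * (1 - 2 * P j) = 1 - p - 2 * P j + 2 * (p * P j) := by noncomm_ring
        rw [this, hp, mul_zero, add_zero]
      have a2 : (1 - 2 * Q j) * (1 - q) = 1 - q - 2 * Q j := by
        have : (1 - 2 * Q j) * (1 - q) = 1 - q - 2 * Q j + 2 * (Q j * q) := by noncomm_ring
        rw [this, hq, mul_zero, add_zero]
      rw [← a1, ← a2, hT']
      simp only [mul_assoc]
    rw [e3, e4] at h2
    rw [Finset.sum_insert hj, Finset.sum_insert hj, Finset.sum_insert hj]
    set D := ∑ i ∈ F, P i * T * Q i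
    -- Pinching along `insert j F` is the average of pinching `T` and its reflection `T'` along `F`.
    have e5 : T₀ - (P j * T * Q j + D + (1 - (P j + p)) * T * (1 - (Q j + q)))
        = (1 / 2 : ℝ) • ((T₀ - (D + (1 - p) * T * (1 - q)))
          + (T₀ - (D + (1 - p - 2 * P j) * T * (1 - q - 2 * Q j)))) := by
      have : (T₀ - (D + (1 - p) * T * (1 - q)))
          + (T₀ - (D + (1 - p - 2 * P j) * T * (1 - q - 2 * Q j)))
          = (2 : ℝ) • (T₀ - (P j * T * Q j + D + (1 - (P j + p)) * T * (1 - (Q j + q)))) := by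
        rw [two_smul]
        noncomm_ring
      rw [this, smul_smul]
      norm_num
    rw [e5, norm_smul]
    have := norm_add_le (T₀ - (D + (1 - p) * T * (1 - q)))
      (T₀ - (D + (1 - p - 2 * P j) * T * (1 - q - 2 * Q j)))
    rw [Real.norm_of_nonneg (by norm_num)]
    linarith

variable [DiscreteTopology X]

theorem cut_biUnion {ι : Type*} (A : ι → Set X) (F : Finset ι)
    (hA : ∀ i ∈ F, ∀ j ∈ F, i ≠ j → Disjoint (A i) (A j)) :
    cut E p (⋃ i ∈ F, A i) = ∑ i ∈ F, cut E p (A i) := by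
  classical
  refine op_ext fun ξ x => ?_
  rw [sum_apply, value_sum]
  by_cases h : ∃ i ∈ F, x ∈ A i
  · obtain ⟨i, hi, hx⟩ := h
    rw [value_cut_mem (Set.mem_iUnion₂_of_mem hi hx), Finset.sum_eq_single_of_mem i hi,
      value_cut_mem hx]
    intro j hj hji
    exact value_cut_notMem (fun hx' => Set.disjoint_left.1 (hA i hi j hj hji.symm) hx hx') ξ
  · push Not at h
    rw [value_cut_notMem (by simpa using h), Finset.sum_eq_zero]
    exact fun i hi => value_cut_notMem (h i hi) ξ

theorem cut_mul_cut_of_disjoint {S T : Set X} (h : Disjoint S T) :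
    cut E p S * cut E p T = 0 := by
  rw [cut_mul_cut, h.inter_eq, cut_empty]

theorem norm_one_sub_two_mul_cut_le (S : Set X) : ‖(1 - 2 * cut E p S : Op X E p)‖ ≤ 1 := by
  have h : (1 - 2 * cut E p S : Op X E p) = mulOp E p (1 - (chi S + chi S)) := by
    rw [mulOp_sub, mulOp_one, mulOp_add, two_mul, cut]
  rw [h]
  refine norm_mulOp_le_of_forall zero_le_one fun x => ?_
  by_cases hx : x ∈ S
  · norm_num [chi_mem hx]
  · simp [chi_notMem hx]

/-- The block part of an operator along two families of disjoint sets is no larger in norm than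
the operator, whatever `p` is. -/
theorem norm_sum_cut_mul_cut_le {ι : Type*} (A C : ι → Set X) (F : Finset ι)
    (hA : ∀ i ∈ F, ∀ j ∈ F, i ≠ j → Disjoint (A i) (A j))
    (hC : ∀ i ∈ F, ∀ j ∈ F, i ≠ j → Disjoint (C i) (C j)) (T : Op X E p) :
    ‖∑ i ∈ F, cut E p (A i) * T * cut E p (C i)‖ ≤ ‖T‖ := by
  let _ : NormedAlgebra ℝ (Op X E p) := NormedAlgebra.restrictScalars ℝ ℂ _
  have h := norm_sub_pinch_le (fun i => cut E p (A i)) (fun i => cut E p (C i)) F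
    (fun i hi j hj hij => cut_mul_cut_of_disjoint (hA i hi j hj hij))
    (fun i hi j hj hij => cut_mul_cut_of_disjoint (hC i hi j hj hij)) 0 (κ := ‖T‖) T (by
      intro S hS
      rw [← cut_biUnion A S fun i hi j hj => hA i (hS hi) j (hS hj),
        ← cut_biUnion C S fun i hi j hj => hC i (hS hi) j (hS hj), zero_sub, norm_neg]
      exact (norm_mul_le_right_of_le_one (norm_one_sub_two_mul_cut_le _)).trans
        (norm_mul_le_left_of_le_one (norm_one_sub_two_mul_cut_le _)))
  rw [zero_sub, norm_neg, ← cut_biUnion A F hA, ← cut_biUnion C F hC] at h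
  refine le_trans ?_ h
  refine le_of_eq_of_le (congrArg _ ?_)
    (norm_mul_le_left_of_le_one (norm_cut_le (E := E) (p := p) (⋃ i ∈ F, A i)))
  have h0 : cut E p (⋃ i ∈ F, A i) * (1 - cut E p (⋃ i ∈ F, A i)) = 0 := by
    rw [mul_sub, mul_one, cut_mul_self, sub_self]
  rw [mul_add, ← mul_assoc, ← mul_assoc, h0, zero_mul, zero_mul, add_zero, Finset.mul_sum]
  refine Finset.sum_congr rfl fun i hi => ?_
  rw [← mul_assoc, ← mul_assoc, cut_mul_cut,
    Set.inter_eq_right.2 (Set.subset_iUnion₂_of_subset i hi subset_rfl)]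

/-- If all corners of `T` between complementary subfamilies are small, so is the off-diagonal
part of `T`. -/
theorem norm_cut_sub_sum_le {ι : Type*} [DecidableEq ι] (A C : ι → Set X) (F : Finset ι)
    (hA : ∀ i ∈ F, ∀ j ∈ F, i ≠ j → Disjoint (A i) (A j))
    (hC : ∀ i ∈ F, ∀ j ∈ F, i ≠ j → Disjoint (C i) (C j)) (T : Op X E p) {δ : ℝ}
    (h : ∀ S ⊆ F, ‖cut E p (⋃ i ∈ S, A i) * T * cut E p (⋃ i ∈ F \ S, C i)‖ ≤ δ) :
    ‖cut E p (⋃ i ∈ F, A i) * T * cut E p (⋃ i ∈ F, C i)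
      - ∑ i ∈ F, cut E p (A i) * T * cut E p (C i)‖ ≤ 4 * δ := by
  let _ : NormedAlgebra ℝ (Op X E p) := NormedAlgebra.restrictScalars ℝ ℂ _
  set P := cut E p (⋃ i ∈ F, A i) with hP
  set Q := cut E p (⋃ i ∈ F, C i) with hQ
  have subA : ∀ S ⊆ F, (⋃ i ∈ S, A i) ⊆ ⋃ i ∈ F, A i := fun S hS =>
    Set.biUnion_subset_biUnion_left hS
  have subC : ∀ S ⊆ F, (⋃ i ∈ S, C i) ⊆ ⋃ i ∈ F, C i := fun S hS =>
    Set.biUnion_subset_biUnion_left hS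
  have compl : ∀ (D : ι → Set X), (∀ i ∈ F, ∀ j ∈ F, i ≠ j → Disjoint (D i) (D j)) → ∀ S ⊆ F,
      cut E p (⋃ i ∈ F \ S, D i) = cut E p (⋃ i ∈ F, D i) - cut E p (⋃ i ∈ S, D i) := by
    intro D hD S hS
    rw [cut_biUnion D F hD, cut_biUnion D S fun i hi j hj => hD i (hS hi) j (hS hj),
      cut_biUnion D (F \ S) fun i hi j hj =>
        hD i (Finset.sdiff_subset hi) j (Finset.sdiff_subset hj), eq_sub_iff_add_eq,
      Finset.sum_sdiff hS]
  -- Changing the signs of `P` and `Q` on `S` changes `P T Q` by twice the corners of `S` against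
  -- `F \ S` and of `F \ S` against `S`.
  have key := norm_sub_pinch_le (fun i => cut E p (A i)) (fun i => cut E p (C i)) F
    (fun i hi j hj hij => cut_mul_cut_of_disjoint (hA i hi j hj hij))
    (fun i hi j hj hij => cut_mul_cut_of_disjoint (hC i hi j hj hij)) (P * T * Q) (κ := 4 * δ)
    (P * T * Q) (by
      intro S hS
      rw [← cut_biUnion A S fun i hi j hj => hA i (hS hi) j (hS hj),
        ← cut_biUnion C S fun i hi j hj => hC i (hS hi) j (hS hj)]
      have h1 := h S hS
      have h2 := h (F \ S) Finset.sdiff_subset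
      rw [Finset.sdiff_sdiff_eq_self hS, compl A hA S hS] at h2
      rw [compl C hC S hS] at h1
      rw [← hP] at h2
      rw [← hQ] at h1
      have a1 : cut E p (⋃ i ∈ S, A i) * P = cut E p (⋃ i ∈ S, A i) := by
        rw [hP, cut_mul_cut, Set.inter_eq_left.2 (subA S hS)]
      have c1 : Q * cut E p (⋃ i ∈ S, C i) = cut E p (⋃ i ∈ S, C i) := by
        rw [hQ, cut_mul_cut, Set.inter_eq_right.2 (subC S hS)]
      set a := cut E p (⋃ i ∈ S, A i)
      set c := cut E p (⋃ i ∈ S, C i)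
      have e : P * T * Q - (1 - 2 * a) * (P * T * Q) * (1 - 2 * c)
          = (2 : ℂ) • (a * T * (Q - c)) + (2 : ℂ) • ((P - a) * T * c) := by
        have : P * T * Q - (1 - 2 * a) * (P * T * Q) * (1 - 2 * c)
            = 2 * ((a * P) * T * Q) + 2 * (P * T * (Q * c)) - 4 * ((a * P) * T * (Q * c)) := by
          noncomm_ring
        rw [this, a1, c1, two_smul, two_smul]
        noncomm_ring
      rw [e]
      refine (norm_add_le _ _).trans ?_
      rw [norm_smul, norm_smul, Complex.norm_ofNat]
      linarith)
  rw [← cut_biUnion A F hA, ← cut_biUnion C F hC] at key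
  have h0 : (1 - P) * (P * T * Q) * (1 - Q) = 0 := by
    have : (1 - P) * (P * T * Q) * (1 - Q) = (P - P * P) * T * (Q * (1 - Q)) := by noncomm_ring
    rw [this, hP, cut_mul_self, sub_self, zero_mul, zero_mul]
  have hsum : ∑ i ∈ F, cut E p (A i) * (P * T * Q) * cut E p (C i)
      = ∑ i ∈ F, cut E p (A i) * T * cut E p (C i) := ?_
  · rwa [← hP, ← hQ, h0, add_zero, hsum] at key
  refine Finset.sum_congr rfl fun i hi => ?_
  have a1 : cut E p (A i) * P = cut E p (A i) := by
    rw [hP, cut_mul_cut,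
      Set.inter_eq_left.2 (show A i ⊆ ⋃ i ∈ F, A i from
        fun x hx => Set.mem_iUnion₂_of_mem hi hx)]
  have c1 : Q * cut E p (C i) = cut E p (C i) := by
    rw [hQ, cut_mul_cut,
      Set.inter_eq_right.2 (show C i ⊆ ⋃ i ∈ F, C i from
        fun x hx => Set.mem_iUnion₂_of_mem hi hx)]
  calc cut E p (A i) * (P * T * Q) * cut E p (C i)
      = (cut E p (A i) * P) * T * (Q * cut E p (C i)) := by noncomm_ring
    _ = _ := by rw [a1, c1]

/-! ### Infinite block sums -/

/-- The block diagonal part of `a` along a disjoint family `A`, evaluated at `ξ`, as a function. -/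
def blockFun {J : Type*} (A : J → Set X) (a : Op X E p) (ξ : ellP X E p) (x : X) : E :=
  open scoped Classical in
  if h : ∃ j, x ∈ A j then value (a (cut E p (A h.choose) ξ)) x else 0

section BlockFun

variable {J : Type*} {A : J → Set X} (a : Op X E p)

theorem blockFun_of_mem (hA : Pairwise fun i j => Disjoint (A i) (A j)) {j : J} {x : X}
    (hx : x ∈ A j) (ξ : ellP X E p) : blockFun A a ξ x = value (a (cut E p (A j) ξ)) x := by
  have h : ∃ j, x ∈ A j := ⟨j, hx⟩
  have hj : h.choose = j := by
    by_contra hne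
    exact Set.disjoint_left.1 (hA hne) h.choose_spec hx
  rw [blockFun, dif_pos h, hj]

theorem blockFun_of_notMem {x : X} (hx : ∀ j, x ∉ A j) (ξ : ellP X E p) :
    blockFun A a ξ x = 0 := dif_neg fun ⟨j, hj⟩ => hx j hj

theorem norm_blockFun_le (ξ : ellP X E p) (x : X) : ‖blockFun A a ξ x‖ ≤ ‖a‖ * ‖ξ‖ := by
  unfold blockFun
  split_ifs with h
  · exact (norm_value_le _ x).trans ((a.le_opNorm _).trans
      (mul_le_mul_of_nonneg_left (norm_cut_apply_le _ ξ) (norm_nonneg a)))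
  · rw [norm_zero]
    positivity

theorem blockFun_add (ξ η : ellP X E p) (x : X) :
    blockFun A a (ξ + η) x = blockFun A a ξ x + blockFun A a η x := by
  unfold blockFun
  split_ifs with h
  · rw [map_add, map_add, value_add]
  · rw [add_zero]

theorem blockFun_smul (c : ℂ) (ξ : ellP X E p) (x : X) :
    blockFun A a (c • ξ) x = c • blockFun A a ξ x := by
  unfold blockFun
  split_ifs with h
  · rw [map_smul, map_smul, value_smul]
  · rw [smul_zero]

theorem value_sum_cut (hA : Pairwise fun i j => Disjoint (A i) (A j)) (F : Finset J)
    (ξ : ellP X E p) (x : X) [Decidable (∃ j ∈ F, x ∈ A j)] :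
    value ((∑ j ∈ F, cut E p (A j) * a * cut E p (A j)) ξ) x
      = if ∃ j ∈ F, x ∈ A j then blockFun A a ξ x else 0 := by
  rw [sum_apply, value_sum]
  split_ifs with h
  · obtain ⟨j, hj, hx⟩ := h
    rw [blockFun_of_mem a hA hx, Finset.sum_eq_single_of_mem j hj]
    · exact value_cut_mem hx _
    · exact fun i _ hij => value_cut_notMem
        (fun h' => Set.disjoint_left.1 (hA hij) h' hx) _
  · exact Finset.sum_eq_zero fun j hj => value_cut_notMem (fun hx => h ⟨j, hj, hx⟩) _

open Filter in
theorem tendsto_value_sum_cut (hA : Pairwise fun i j => Disjoint (A i) (A j)) (ξ : ellP X E p) :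
    Tendsto (fun F : Finset J => fun x =>
      value ((∑ j ∈ F, cut E p (A j) * a * cut E p (A j)) ξ) x) atTop (𝓝 (blockFun A a ξ)) := by
  classical
  refine tendsto_pi_nhds.2 fun x => tendsto_const_nhds.congr' ?_
  by_cases h : ∃ j, x ∈ A j
  · obtain ⟨j, hj⟩ := h
    filter_upwards [eventually_ge_atTop {j}] with F hF
    rw [value_sum_cut a hA, if_pos ⟨j, hF (Finset.mem_singleton_self j), hj⟩]
  · push Not at h
    filter_upwards with F
    rw [value_sum_cut a hA, blockFun_of_notMem a h, ite_self]

theorem norm_sum_cut_apply_le (hA : Pairwise fun i j => Disjoint (A i) (A j)) (F : Finset J)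
    (ξ : ellP X E p) :
    ‖(∑ j ∈ F, cut E p (A j) * a * cut E p (A j)) ξ‖ ≤ ‖a‖ * ‖ξ‖ :=
  ContinuousLinearMap.le_of_opNorm_le _ (norm_sum_cut_mul_cut_le A A F
    (fun _ _ _ _ h => hA h) (fun _ _ _ _ h => hA h) a) ξ

/-- Finitely many blocks meet a given finite set. -/
theorem finite_setOf_inter_nonempty {α J : Type*} {A : J → Set α}
    (hA : Pairwise fun i j => Disjoint (A i) (A j)) (K : Finset α) :
    {j | (A j ∩ K).Nonempty}.Finite := by
  classical
  refine Set.Finite.of_finite_image (f := fun j => A j ∩ (K : Set α)) ?_ ?_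
  · exact (K.finite_toSet.powerset).subset (by rintro _ ⟨j, _, rfl⟩; exact Set.inter_subset_right)
  · rintro i ⟨x, hx⟩ j _ hij
    by_contra hne
    have : x ∈ A j ∩ (K : Set α) := by
      have hij' : A i ∩ (K : Set α) = A j ∩ K := hij
      rwa [← hij']
    exact Set.disjoint_left.1 (hA hne) hx.1 this.1

/-- On a vector supported in a finite set a block sum is a finite sum. -/
theorem blockFun_cut_finite (hA : Pairwise fun i j => Disjoint (A i) (A j)) (K : Finset X)
    (F : Finset J) (hF : ∀ j, (A j ∩ K).Nonempty → j ∈ F) (ξ : ellP X E p) (x : X) :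
    blockFun A a (cut E p K ξ) x
      = value ((∑ j ∈ F, cut E p (A j) * a * cut E p (A j)) (cut E p K ξ)) x := by
  classical
  rw [value_sum_cut a hA]
  split_ifs with h
  · rfl
  · by_cases h' : ∃ j, x ∈ A j
    · obtain ⟨j, hj⟩ := h'
      have hj' : Disjoint (A j) (K : Set X) := by
        by_contra hne
        exact h ⟨j, hF j (Set.not_disjoint_iff_nonempty_inter.1 hne), hj⟩
      have h0 : cut E p (A j) (cut E p (K : Set X) ξ) = 0 :=
        DFunLike.congr_fun (cut_mul_cut_of_disjoint (E := E) (p := p) hj') ξ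
      rw [blockFun_of_mem a hA hj, h0, map_zero, value_zero]
    · push Not at h'
      exact blockFun_of_notMem a h' _

theorem cut_add_cut_compl_apply (K : Set X) (ξ : ellP X E p) :
    cut E p K ξ + cut E p Kᶜ ξ = ξ := by
  rw [cut_compl, sub_apply]
  exact add_sub_cancel _ _

open Filter in
theorem blockFun_tendsto_zero (hp : p = .zero) (hA : Pairwise fun i j => Disjoint (A i) (A j))
    (ξ : ellP X E p) : Tendsto (blockFun A a ξ) (cocompact X) (𝓝 0) := by
  refine Metric.tendsto_nhds.2 fun ε hε => ?_
  obtain ⟨K, hK⟩ := exists_finite_norm_cut_compl_lt (p := p) (by rw [hp]; nofun) ξ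
    (ε := ε / 2 / (‖a‖ + 1)) (by positivity)
  have h1 := ((((∑ j ∈ (finite_setOf_inter_nonempty hA K).toFinset,
    cut E p (A j) * a * cut E p (A j)) (cut E p K ξ)).2 hp).2)
  filter_upwards [Metric.tendsto_nhds.1 h1 (ε / 2) (half_pos hε)] with x hx
  rw [dist_zero_right] at hx ⊢
  rw [← cut_add_cut_compl_apply (K : Set X) ξ, blockFun_add, blockFun_cut_finite a hA K
    (finite_setOf_inter_nonempty hA K).toFinset (by simp)]
  have h2 := norm_blockFun_le (A := A) a (cut E p (K : Set X)ᶜ ξ) x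
  have h3 : ‖a‖ * ‖cut E p (K : Set X)ᶜ ξ‖ ≤ ε / 2 := by
    rw [lt_div_iff₀ (by positivity)] at hK
    nlinarith [norm_nonneg a, norm_nonneg (cut E p (K : Set X)ᶜ ξ)]
  refine (norm_add_le _ _).trans_lt ?_
  exact (add_lt_add_of_lt_of_le hx (h2.trans h3)).trans_eq (add_halves ε)

/-- The vector `∑ j, cut (A j) a cut (A j) ξ`. -/
def blockVec (hA : Pairwise fun i j => Disjoint (A i) (A j)) (ξ : ellP X E p) : ellP X E p :=
  ⟨⟨blockFun A a ξ, by
    refine lp.memℓp_of_tendsto (E := fun _ : X => E) (F := fun F : Finset J =>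
      ((∑ j ∈ F, cut E p (A j) * a * cut E p (A j)) ξ).toLp) ?_ (tendsto_value_sum_cut a hA ξ)
    refine isBounded_iff_forall_norm_le.2 ⟨‖a‖ * ‖ξ‖, ?_⟩
    rintro _ ⟨F, rfl⟩
    exact norm_sum_cut_apply_le a hA F ξ⟩,
  fun hp => ⟨continuous_of_discreteTopology, blockFun_tendsto_zero a hp hA ξ⟩⟩

theorem norm_blockVec_le (hA : Pairwise fun i j => Disjoint (A i) (A j)) (ξ : ellP X E p) :
    ‖blockVec a hA ξ‖ ≤ ‖a‖ * ‖ξ‖ :=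
  lp.norm_le_of_tendsto (E := fun _ : X => E) (f := (blockVec a hA ξ).toLp)
    (Filter.Eventually.of_forall fun F => norm_sum_cut_apply_le a hA F ξ)
    (tendsto_value_sum_cut a hA ξ)

/-- The block diagonal part `∑ j, cut (A j) a cut (A j)` of `a` along a disjoint family `A`. -/
def blockOp (hA : Pairwise fun i j => Disjoint (A i) (A j)) : Op X E p :=
  LinearMap.mkContinuous
    { toFun := blockVec a hA
      map_add' := fun ξ η => ellP_ext fun x => blockFun_add a ξ η x
      map_smul' := fun c ξ => ellP_ext fun x => blockFun_smul a c ξ x }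
    ‖a‖ (norm_blockVec_le a hA)

theorem value_blockOp (hA : Pairwise fun i j => Disjoint (A i) (A j)) (ξ : ellP X E p) (x : X) :
    value (blockOp a hA ξ) x = blockFun A a ξ x := rfl

theorem norm_blockOp_apply_le (hA : Pairwise fun i j => Disjoint (A i) (A j)) (ξ : ellP X E p) :
    ‖blockOp a hA ξ‖ ≤ ‖a‖ * ‖ξ‖ := norm_blockVec_le a hA ξ

theorem hasSum_blockOp (hp : p ≠ .infty) (hA : Pairwise fun i j => Disjoint (A i) (A j))
    (ξ : ellP X E p) :
    HasSum (fun j => (cut E p (A j) * a * cut E p (A j)) ξ) (blockOp a hA ξ) := by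
  classical
  refine Metric.tendsto_atTop.2 fun ε hε => ?_
  obtain ⟨K, hK⟩ := exists_finite_norm_cut_compl_lt hp ξ
    (ε := ε / (2 * ‖a‖ + 1)) (by positivity)
  refine ⟨(finite_setOf_inter_nonempty hA K).toFinset, fun F hF => ?_⟩
  rw [← sum_apply, dist_comm, dist_eq_norm]
  set S := ∑ j ∈ F, cut E p (A j) * a * cut E p (A j) with hS
  have h1 : blockOp a hA (cut E p (K : Set X) ξ) = S (cut E p (K : Set X) ξ) :=
    ellP_ext fun x => blockFun_cut_finite a hA K F
      (fun j hj => hF (by simpa using hj)) ξ x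
  have h2 : blockOp a hA ξ - S ξ
      = blockOp a hA (cut E p (K : Set X)ᶜ ξ) - S (cut E p (K : Set X)ᶜ ξ) := by
    conv_lhs => rw [← cut_add_cut_compl_apply (K : Set X) ξ]
    rw [map_add, map_add, h1, add_sub_add_left_eq_sub]
  rw [h2]
  refine (norm_sub_le _ _).trans_lt ?_
  have h3 := norm_blockOp_apply_le a hA (cut E p (K : Set X)ᶜ ξ)
  have h4 := norm_sum_cut_apply_le a hA F (cut E p (K : Set X)ᶜ ξ)
  rw [lt_div_iff₀ (by positivity)] at hK
  nlinarith [norm_nonneg a, norm_nonneg (cut E p (K : Set X)ᶜ ξ)]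

end BlockFun

open scoped ComplexOrder in
theorem isBlockFamily_chi {J : Type u} {A : J → Set X}
    (hA : Pairwise fun i j => Disjoint (A i) (A j)) : IsBlockFamily fun j => chi (A j) := by
  refine ⟨fun j x => ?_, fun j => norm_chi_le _, fun i j hij => ?_⟩
  · by_cases h : x ∈ A j
    · rw [chi_mem h]
      exact zero_le_one
    · rw [chi_notMem h]
  · simpa only [tsupport_chi] using hA hij

theorem isBlockCutdown_blockOp {J : Type u} {A : J → Set X} (a : Op X E p)
    (hA : Pairwise fun i j => Disjoint (A i) (A j)) :
    IsBlockCutdown (fun j => chi (A j)) a (blockOp a hA) := by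
  refine ⟨fun hp ξ => hasSum_blockOp a hp hA ξ, fun _ ξ x => ?_⟩
  have h := tendsto_pi_nhds.1 (tendsto_value_sum_cut a hA ξ) x
  refine h.congr fun F => ?_
  rw [sum_apply, value_sum]
  rfl

theorem blockOp_mem {B : NonUnitalSubalgebra ℂ (Op X E p)} (hBcut : ClosedUnderBlockCutdowns B)
    {J : Type u} {A : J → Set X} {a : Op X E p} (ha : a ∈ B)
    (hA : Pairwise fun i j => Disjoint (A i) (A j)) : blockOp a hA ∈ B :=
  hBcut J _ (isBlockFamily_chi hA) a ha _ (isBlockCutdown_blockOp a hA)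

end

section

/-! ### Quasi-locality in terms of corners -/

theorem lt_dist_of_lt_setDist {S T : Set X} {R : ℝ} (h : ENNReal.ofReal R < setDist S T)
    {x y : X} (hx : x ∈ S) (hy : y ∈ T) : R < dist x y := by
  have h1 : setDist S T ≤ edist x y := (iInf₂_le x hx).trans (iInf₂_le y hy)
  have h2 := h.trans_le h1
  rw [edist_dist] at h2
  exact (ENNReal.ofReal_lt_ofReal_iff'.1 h2).1

theorem lt_setDist {S T : Set X} {R : ℝ} (hR : 0 ≤ R)
    (h : ∀ x ∈ S, ∀ y ∈ T, R + 1 < dist x y) : ENNReal.ofReal R < setDist S T := by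
  have h1 : ENNReal.ofReal (R + 1) ≤ setDist S T :=
    le_iInf₂ fun x hx => le_iInf₂ fun y hy => by
      rw [edist_dist]
      exact ENNReal.ofReal_le_ofReal (h x hx y hy).le
  exact ((ENNReal.ofReal_lt_ofReal_iff (by positivity)).2 (lt_add_one R)).trans_le h1

/-- The commutator `[b, f]`. -/
def comm (b : Op X E p) (f : X →ᵇ ℂ) : Op X E p := b * mulOp E p f - mulOp E p f * b

theorem comm_add (b : Op X E p) (f g : X →ᵇ ℂ) : comm b (f + g) = comm b f + comm b g := by
  unfold comm
  rw [mulOp_add]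
  noncomm_ring

theorem comm_smul (b : Op X E p) (c : ℂ) (f : X →ᵇ ℂ) : comm b (c • f) = c • comm b f := by
  unfold comm
  rw [mulOp_smul, mul_smul_comm, smul_mul_assoc, smul_sub]

theorem norm_comm_le (b : Op X E p) {f : X →ᵇ ℂ} {C : ℝ} (hf : ‖f‖ ≤ C) :
    ‖comm b f‖ ≤ 2 * ‖b‖ * C := by
  have h1 := (norm_mulOp_le (E := E) (p := p) f).trans hf
  refine (norm_sub_le _ _).trans ?_
  have h2 := norm_mul_le b (mulOp E p f)
  have h3 := norm_mul_le (mulOp E p f) b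
  nlinarith [mul_le_mul_of_nonneg_left h1 (norm_nonneg b)]

variable [DiscreteTopology X]

/-- All corners of `T` between subsets of `X` at distance more than `R` have norm at most `δ`. -/
def FarCornersLE (T : Op X E p) (R δ : ℝ) : Prop :=
  ∀ A C : Set X, (∀ x ∈ A, ∀ y ∈ C, R < dist x y) → ‖cut E p A * T * cut E p C‖ ≤ δ

theorem norm_mulOp_mul_mulOp_le_corner {f g : X →ᵇ ℂ} {A C : Set X} (hf : ‖f‖ ≤ 1) (hg : ‖g‖ ≤ 1)
    (hA : ∀ x ∉ A, f x = 0) (hC : ∀ x ∉ C, g x = 0) (T : Op X E p) :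
    ‖mulOp E p f * T * mulOp E p g‖ ≤ ‖cut E p A * T * cut E p C‖ := by
  have h : mulOp E p f * T * mulOp E p g
      = mulOp E p f * (cut E p A * T * cut E p C) * mulOp E p g := by
    calc _ = (mulOp E p f * cut E p A) * T * (cut E p C * mulOp E p g) := by
          rw [mulOp_mul_cut_of_support hA, cut_mul_mulOp_of_support hC]
      _ = _ := by noncomm_ring
  rw [h]
  exact (norm_mul_le_right_of_le_one ((norm_mulOp_le g).trans hg)).trans
    (norm_mul_le_left_of_le_one ((norm_mulOp_le f).trans hf))

theorem quasiLocal_iff_farCornersLE (b : Op X E p) :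
    QuasiLocal b ↔ ∀ ε : ℝ, 0 < ε → ∃ R : ℝ, 0 ≤ R ∧ FarCornersLE b R ε := by
  constructor
  · intro h ε hε
    obtain ⟨R, hR, hb⟩ := h ε hε
    refine ⟨R + 1, by positivity, fun A C hAC => ?_⟩
    refine (hb (chi A) (chi C) (norm_chi_le A) (norm_chi_le C) ?_).le
    rw [tsupport_chi, tsupport_chi]
    exact lt_setDist hR hAC
  · intro h ε hε
    obtain ⟨R, hR, hb⟩ := h (ε / 2) (half_pos hε)
    refine ⟨R, hR, fun f g hf hg hfg => ?_⟩
    refine lt_of_le_of_lt ?_ (half_lt_self hε)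
    exact (norm_mulOp_mul_mulOp_le_corner hf hg (fun x => image_eq_zero_of_notMem_tsupport)
      (fun x => image_eq_zero_of_notMem_tsupport) b).trans
      (hb _ _ fun x hx y hy => lt_dist_of_lt_setDist hfg hx hy)

/-! ### Commutators with functions of small variation -/

theorem norm_cut_mul_mul_cut_le (S S' : Set X) (T : Op X E p) :
    ‖cut E p S * T * cut E p S'‖ ≤ ‖T‖ :=
  (norm_mul_le_right_of_le_one (norm_cut_le S')).trans
    (norm_mul_le_left_of_le_one (norm_cut_le S))

/-- Multiplication by the integer-valued function `D` has a commutator with `b` that only sees the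
corners of `b` between distinct level sets. Neighbouring levels contribute two block operators,
each of norm at most `‖b‖`. -/
theorem norm_cut_comm_int_le (b : Op X E p) (Y : Set X) (D : X → ℤ) (M : ℕ)
    (hD : ∀ x ∈ Y, D x ∈ Finset.Icc (-(M : ℤ)) M) (g : X →ᵇ ℂ) (hg : ∀ x ∈ Y, g x = (D x : ℂ))
    {ε : ℝ} (hε : 0 ≤ ε) (h : ∀ i j : ℤ, 2 ≤ |j - i| →
      ‖cut E p (Y ∩ D ⁻¹' {i}) * b * cut E p (Y ∩ D ⁻¹' {j})‖ ≤ ε) :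
    ‖cut E p Y * comm b g * cut E p Y‖ ≤ 2 * ‖b‖ + (2 * M + 1) ^ 2 * (2 * M * ε) := by
  classical
  set I := Finset.Icc (-(M : ℤ)) M with hI
  set L : ℤ → Set X := fun i => Y ∩ D ⁻¹' {i} with hL
  have hdisj : ∀ i j : ℤ, i ≠ j → Disjoint (L i) (L j) := fun i j hij =>
    Set.disjoint_left.2 fun x hx hx' => hij (hx.2.symm.trans hx'.2)
  have hY : cut E p Y = ∑ i ∈ I, cut E p (L i) := by
    rw [← cut_biUnion L I fun i _ j _ => hdisj i j]
    congr 1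
    ext x
    simp only [Set.mem_iUnion, exists_prop, hL, Set.mem_inter_iff, Set.mem_preimage,
      Set.mem_singleton_iff]
    exact ⟨fun hx => ⟨D x, hD x hx, hx, rfl⟩, fun ⟨_, _, hx, _⟩ => hx⟩
  have hgL : ∀ i, mulOp E p g * cut E p (L i) = (i : ℂ) • cut E p (L i) := by
    intro i
    refine op_ext fun ξ x => ?_
    change g x • value (cut E p (L i) ξ) x = (i : ℂ) • value (cut E p (L i) ξ) x
    by_cases hx : x ∈ L i
    · rw [hg x hx.1, hx.2]
    · rw [value_cut_notMem hx, smul_zero, smul_zero]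
  have hgY : mulOp E p g * cut E p Y = ∑ i ∈ I, (i : ℂ) • cut E p (L i) := by
    rw [hY, Finset.mul_sum]
    exact Finset.sum_congr rfl fun i _ => hgL i
  set K : ℤ → ℤ → Op X E p := fun i j => cut E p (L i) * b * cut E p (L j) with hK
  have e1 : cut E p Y * comm b g * cut E p Y = ∑ i ∈ I, ∑ j ∈ I, ((j : ℂ) - i) • K i j := by
    have : cut E p Y * comm b g * cut E p Y
        = cut E p Y * b * (mulOp E p g * cut E p Y)
          - (mulOp E p g * cut E p Y) * b * cut E p Y := by
      rw [comm, mul_sub, sub_mul]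
      congr 1
      rw [← mul_assoc, cut_mul_mulOp_comm]
    rw [this, hgY, hY, Finset.sum_mul, Finset.sum_mul_sum, Finset.sum_mul, Finset.sum_mul_sum,
      ← Finset.sum_sub_distrib]
    refine Finset.sum_congr rfl fun i _ => ?_
    rw [← Finset.sum_sub_distrib]
    refine Finset.sum_congr rfl fun j _ => ?_
    rw [mul_smul_comm, smul_mul_assoc, smul_mul_assoc, sub_smul]
  have e2 : ∀ i j : ℤ, ((j : ℂ) - i) • K i j
      = ((if j = i + 1 then K i j else 0) - (if i = j + 1 then K i j else 0))
        + (if 2 ≤ |j - i| then ((j : ℂ) - i) • K i j else 0) := by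
    intro i j
    by_cases h2 : 2 ≤ |j - i|
    · have h3 : j ≠ i + 1 := by
        rintro rfl
        norm_num at h2
      have h4 : i ≠ j + 1 := by
        rintro rfl
        norm_num at h2
      rw [if_neg h3, if_neg h4, if_pos h2, sub_zero, zero_add]
    · rw [if_neg h2, add_zero]
      have : j = i + 1 ∨ i = j + 1 ∨ i = j := by
        rw [not_le, abs_lt] at h2
        omega
      rcases this with rfl | rfl | rfl
      · rw [if_pos rfl, if_neg (by omega)]
        simp
      · rw [if_neg (by omega), if_pos rfl]
        simp
      · simp
  rw [e1, Finset.sum_congr rfl fun i _ => Finset.sum_congr rfl fun j _ => e2 i j]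
  simp only [Finset.sum_add_distrib, Finset.sum_sub_distrib]
  -- Neighbouring levels: block operators, to be bounded independently of `M` by pinching.
  have b1 : ‖∑ i ∈ I, ∑ j ∈ I, (if j = i + 1 then K i j else 0)‖ ≤ ‖b‖ := by
    simp only [Finset.sum_ite_eq']
    rw [← Finset.sum_filter]
    exact norm_sum_cut_mul_cut_le L (fun i => L (i + 1)) _ (fun i _ j _ => hdisj i j)
      (fun i _ j _ hij => hdisj _ _ (by omega)) b
  have b2 : ‖∑ i ∈ I, ∑ j ∈ I, (if i = j + 1 then K i j else 0)‖ ≤ ‖b‖ := by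
    rw [Finset.sum_comm]
    simp only [Finset.sum_ite_eq']
    rw [← Finset.sum_filter]
    exact norm_sum_cut_mul_cut_le (fun i => L (i + 1)) L _
      (fun i _ j _ hij => hdisj _ _ (by omega)) (fun i _ j _ => hdisj i j) b
  -- Distant levels: a number of small corners that depends on `M` only.
  have b3 : ‖∑ i ∈ I, ∑ j ∈ I, (if 2 ≤ |j - i| then ((j : ℂ) - i) • K i j else 0)‖
      ≤ (2 * M + 1) ^ 2 * (2 * M * ε) := by
    have hcard : (I.card : ℝ) = 2 * M + 1 := by
      rw [hI, Int.card_Icc]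
      have : ((M : ℤ) + 1 - -(M : ℤ)).toNat = 2 * M + 1 := by omega
      rw [this]
      push_cast
      ring
    have hterm : ∀ i ∈ I, ∀ j ∈ I,
        ‖(if 2 ≤ |j - i| then ((j : ℂ) - i) • K i j else 0)‖ ≤ 2 * M * ε := by
      intro i hi j hj
      split_ifs with h2
      · rw [norm_smul]
        refine mul_le_mul ?_ (h i j h2) (norm_nonneg _) (by positivity)
        rw [hI, Finset.mem_Icc] at hi hj
        rw [← Int.cast_sub, Complex.norm_intCast]
        have : |j - i| ≤ 2 * M := by
          rw [abs_le]
          omega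
        exact_mod_cast this
      · rw [norm_zero]
        positivity
    calc _ ≤ ∑ i ∈ I, ∑ j ∈ I, (2 * M * ε) :=
          norm_sum_le_of_le _ fun i hi => norm_sum_le_of_le _ fun j hj => hterm i hi j hj
      _ = _ := by
          rw [Finset.sum_const, Finset.sum_const, smul_smul, nsmul_eq_mul]
          push_cast
          rw [hcard]
          ring
  refine (norm_add_le _ _).trans ?_
  refine (add_le_add_left (norm_sub_le _ _) _).trans ?_
  linarith

/-- The function `h` is within `δ` of `δ` times an integer-valued function, whose distant level sets
are far apart because `h` varies slowly. -/
theorem exists_norm_cut_comm_real_le {b : Op X E p}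
    (hb : ∀ ε : ℝ, 0 < ε → ∃ R : ℝ, 0 ≤ R ∧ FarCornersLE b R ε) {ε C : ℝ} (hε : 0 < ε) :
    ∃ R δ : ℝ, 0 ≤ R ∧ 0 < δ ∧ ∀ (Y : Set X) (h : X → ℝ) (g : X →ᵇ ℂ), (∀ x, g x = h x) →
      (∀ x, |h x| ≤ C) → (∀ x ∈ Y, ∀ y ∈ Y, dist x y ≤ R → |h x - h y| ≤ δ) →
      ‖cut E p Y * comm b g * cut E p Y‖ ≤ ε := by
  -- Rounding `h` and the neighbouring levels cost `2 ‖b‖ δ` each, which fixes the mesh `δ` and thus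
  -- the number of levels; only then is the bound `ε₁` on the corners chosen.
  set δ : ℝ := ε / (8 * (‖b‖ + 1)) with hδ
  have hδ0 : 0 < δ := by positivity
  set M : ℕ := ⌈C / δ⌉₊ + 1 with hM
  set N : ℝ := (2 * M + 1) ^ 2 * (2 * M) with hN
  have hN0 : 0 ≤ N := by positivity
  set ε₁ : ℝ := ε / (2 * δ * (N + 1)) with hε₁
  have hε₁0 : 0 < ε₁ := by positivity
  obtain ⟨R, hR, hbR⟩ := hb ε₁ hε₁0
  refine ⟨R, δ, hR, hδ0, fun Y h g hg hC hvar => ?_⟩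
  set D : X → ℤ := fun x => ⌊h x / δ⌋ with hD
  have hDM : ∀ x, D x ∈ Finset.Icc (-(M : ℤ)) M := by
    intro x
    have h1 : C / δ ≤ (M : ℝ) - 1 := by
      rw [hM]
      push_cast
      linarith [Nat.le_ceil (C / δ)]
    have h2 := abs_le.1 (hC x)
    have h3 : h x / δ ≤ C / δ := by gcongr; exact h2.2
    have h4 : -(C / δ) ≤ h x / δ := by
      rw [← neg_div]
      gcongr
      exact h2.1
    rw [Finset.mem_Icc]
    constructor
    · refine Int.le_floor.2 ?_
      push_cast
      linarith
    · have : (D x : ℝ) ≤ M := (Int.floor_le _).trans (by linarith)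
      exact_mod_cast this
  set g' : X →ᵇ ℂ := BoundedContinuousFunction.ofNormedAddCommGroupDiscrete
    (fun x => (D x : ℂ)) M (fun x => by
      rw [Complex.norm_intCast]
      have := Finset.mem_Icc.1 (hDM x)
      exact_mod_cast abs_le.2 this) with hg'
  have hg'x : ∀ x, g' x = (D x : ℂ) := fun x => rfl
  have hnear : ‖g - (δ : ℂ) • g'‖ ≤ δ := by
    refine (BoundedContinuousFunction.norm_le hδ0.le).2 fun x => ?_
    have e : (g - (δ : ℂ) • g') x = ((h x - δ * D x : ℝ) : ℂ) := by
      change g x - (δ : ℂ) * g' x = _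
      rw [hg, hg'x]
      push_cast
      ring
    rw [e, Complex.norm_real, Real.norm_eq_abs, abs_le]
    have h1 := Int.floor_le (h x / δ)
    have h2 := Int.lt_floor_add_one (h x / δ)
    rw [le_div_iff₀ hδ0] at h1
    rw [div_lt_iff₀ hδ0] at h2
    constructor
    · nlinarith
    · nlinarith
  have hcorner : ∀ i j : ℤ, 2 ≤ |j - i| →
      ‖cut E p (Y ∩ D ⁻¹' {i}) * b * cut E p (Y ∩ D ⁻¹' {j})‖ ≤ ε₁ := by
    intro i j hij
    refine hbR _ _ fun x hx y hy => ?_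
    by_contra hle
    have h1 := abs_le.1 (hvar x hx.1 y hy.1 (not_lt.1 hle))
    have h2 : ⌊h x / δ⌋ = i := hx.2
    have h3 : ⌊h y / δ⌋ = j := hy.2
    have h4 : |h y / δ - h x / δ| ≤ 1 := by
      rw [← sub_div, abs_div, abs_of_pos hδ0, div_le_one hδ0, abs_sub_comm]
      exact abs_le.2 h1
    have h5 := abs_le.1 h4
    have h6 := Int.floor_le (h x / δ)
    have h7 := Int.lt_floor_add_one (h x / δ)
    have h8 := Int.floor_le (h y / δ)
    have h9 := Int.lt_floor_add_one (h y / δ)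
    rw [h2] at h6 h7
    rw [h3] at h8 h9
    have h10 : |j - i| < 2 := by
      rw [abs_lt]
      constructor
      · have : (-2 : ℝ) < ((j - i : ℤ) : ℝ) := by push_cast; linarith
        exact_mod_cast this
      · have : ((j - i : ℤ) : ℝ) < 2 := by push_cast; linarith
        exact_mod_cast this
    omega
  have hmain := norm_cut_comm_int_le b Y D M (fun x _ => hDM x) g' (fun x _ => hg'x x)
    hε₁0.le hcorner
  have hdec : cut E p Y * comm b g * cut E p Y
      = cut E p Y * comm b (g - (δ : ℂ) • g') * cut E p Y
        + (δ : ℂ) • (cut E p Y * comm b g' * cut E p Y) := by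
    conv_lhs => rw [← sub_add_cancel g ((δ : ℂ) • g'), comm_add, comm_smul]
    rw [mul_add, add_mul, mul_smul_comm, smul_mul_assoc]
  rw [hdec]
  refine (norm_add_le _ _).trans ?_
  rw [norm_smul, Complex.norm_real, Real.norm_of_nonneg hδ0.le]
  have h1 := (norm_cut_mul_mul_cut_le Y Y (comm b (g - (δ : ℂ) • g'))).trans
    (norm_comm_le b hnear)
  have h2 := mul_le_mul_of_nonneg_left hmain hδ0.le
  have h3 : 4 * ‖b‖ * δ ≤ ε / 2 := by
    rw [hδ, mul_div_assoc', div_le_div_iff₀ (by positivity) (by positivity)]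
    nlinarith [norm_nonneg b]
  have h4 : δ * (N * ε₁) ≤ ε / 2 := by
    rw [hε₁]
    have : δ * (N * (ε / (2 * δ * (N + 1)))) = (N / (N + 1)) * (ε / 2) := by
      field_simp
    rw [this]
    exact mul_le_of_le_one_left (by positivity) ((div_le_one (by positivity)).2 (by linarith))
  have h5 : δ * (2 * ‖b‖ + (2 * (M : ℝ) + 1) ^ 2 * (2 * M * ε₁)) = 2 * ‖b‖ * δ + δ * (N * ε₁) := by
    rw [hN]
    ring
  linarith

/-- A quasi-local operator almost commutes with every bounded function that varies little at a
suitable scale, also after compression to a subset. -/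
theorem exists_norm_cut_comm_le {b : Op X E p}
    (hb : ∀ ε : ℝ, 0 < ε → ∃ R : ℝ, 0 ≤ R ∧ FarCornersLE b R ε) {ε C : ℝ} (hε : 0 < ε) :
    ∃ R δ : ℝ, 0 ≤ R ∧ 0 < δ ∧ ∀ (Y : Set X) (g : X →ᵇ ℂ), ‖g‖ ≤ C →
      (∀ x ∈ Y, ∀ y ∈ Y, dist x y ≤ R → ‖g x - g y‖ ≤ δ) →
      ‖cut E p Y * comm b g * cut E p Y‖ ≤ ε := by
  obtain ⟨R, δ, hR, hδ, H⟩ := exists_norm_cut_comm_real_le hb (C := C) (half_pos hε)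
  refine ⟨R, δ, hR, hδ, fun Y g hgC hg => ?_⟩
  have hre : ∀ x, |(g x).re| ≤ C := fun x =>
    (Complex.abs_re_le_norm _).trans ((g.norm_coe_le_norm x).trans hgC)
  have him : ∀ x, |(g x).im| ≤ C := fun x =>
    (Complex.abs_im_le_norm _).trans ((g.norm_coe_le_norm x).trans hgC)
  set u : X →ᵇ ℂ := BoundedContinuousFunction.ofNormedAddCommGroupDiscrete
    (fun x => ((g x).re : ℂ)) C (fun x => by rw [Complex.norm_real]; exact hre x) with hu
  set w : X →ᵇ ℂ := BoundedContinuousFunction.ofNormedAddCommGroupDiscrete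
    (fun x => ((g x).im : ℂ)) C (fun x => by rw [Complex.norm_real]; exact him x) with hw
  have e : g = u + Complex.I • w := by
    ext x
    change g x = ((g x).re : ℂ) + Complex.I * ((g x).im : ℂ)
    rw [mul_comm]
    exact (Complex.re_add_im (g x)).symm
  have h1 := H Y (fun x => (g x).re) u (fun x => rfl) hre fun x hx y hy hxy =>
    (Complex.abs_re_le_norm (g x - g y)).trans (hg x hx y hy hxy)
  have h2 := H Y (fun x => (g x).im) w (fun x => rfl) him fun x hx y hy hxy =>
    (Complex.abs_im_le_norm (g x - g y)).trans (hg x hx y hy hxy)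
  rw [e, comm_add, comm_smul, mul_add, add_mul, mul_smul_comm, smul_mul_assoc]
  refine (norm_add_le _ _).trans ?_
  rw [norm_smul, Complex.norm_I, one_mul]
  linarith

end

section

/-! ### Very Lipschitz sequences -/

theorem commutesWithVL_iff (b : Op X E p) :
    CommutesWithVL b ↔ ∀ f : ℕ → X →ᵇ ℂ, VeryLipschitz f →
      Filter.Tendsto (fun n => ‖comm b (f n)‖) Filter.atTop (𝓝 0) := by
  have key : ∀ (f : ℕ → X →ᵇ ℂ) (hf : VeryLipschitz f),
      constClass b * seqClass (mulSeq X E p f hf) - seqClass (mulSeq X E p f hf) * constClass b = 0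
        ↔ Filter.Tendsto (fun n => ‖comm b (f n)‖) Filter.atTop (𝓝 0) := by
    intro f hf
    rw [sub_eq_zero]
    change ((_ : BddSeq (Op X E p)) : (nullIdeal (Op X E p)).ringCon.Quotient)
      = ((_ : BddSeq (Op X E p)) : (nullIdeal (Op X E p)).ringCon.Quotient) ↔ _
    rw [RingCon.eq, TwoSidedIdeal.rel_iff]
    exact TwoSidedIdeal.mem_mk' _ _ _ _ _ _ _
  constructor
  · intro h f hf
    exact (key f hf).1 (h _ ⟨f, hf, rfl⟩)
  · rintro h _ ⟨f, hf, rfl⟩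
    exact (key f hf).2 (h f hf)

theorem quasiLocal_of_mem_roe {B : NonUnitalSubalgebra ℂ (Op X E p)} {b : Op X E p}
    (hb : b ∈ Roe B) : QuasiLocal b := by
  intro ε hε
  obtain ⟨a, ⟨-, R, hR, ha⟩, hab⟩ := Metric.mem_closure_iff.1 hb ε hε
  refine ⟨R, hR, fun f f' hf hf' hd => ?_⟩
  have e : mulOp E p f * b * mulOp E p f' = mulOp E p f * (b - a) * mulOp E p f' := by
    rw [mul_sub, sub_mul, ha f f' hd, sub_zero]
  rw [e]
  refine lt_of_le_of_lt ?_ (by rwa [dist_eq_norm] at hab)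
  exact (norm_mul_le_right_of_le_one ((norm_mulOp_le f').trans hf')).trans
    (norm_mul_le_left_of_le_one ((norm_mulOp_le f).trans hf))

variable [DiscreteTopology X]

theorem commutesWithVL_of_quasiLocal {b : Op X E p} (hb : QuasiLocal b) : CommutesWithVL b := by
  refine (commutesWithVL_iff b).2 fun f hf => ?_
  obtain ⟨C, hC⟩ := hf.1
  refine Metric.tendsto_atTop.2 fun ε hε => ?_
  obtain ⟨R, δ, hR, hδ, H⟩ := exists_norm_cut_comm_le ((quasiLocal_iff_farCornersLE b).1 hb)
    (C := C) (half_pos hε)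
  have hL : 0 < δ / (R + 1) := by positivity
  obtain ⟨n₀, hn₀⟩ := hf.2 ⟨δ / (R + 1), hL.le⟩ hL
  refine ⟨n₀, fun n hn => ?_⟩
  have h := H Set.univ (f n) (hC n) fun x _ y _ hxy => by
    have h1 := (hn₀ n hn).dist_le_mul x y
    rw [dist_eq_norm] at h1
    refine h1.trans ?_
    change δ / (R + 1) * dist x y ≤ δ
    rw [div_mul_eq_mul_div, div_le_iff₀ (by positivity)]
    exact mul_le_mul_of_nonneg_left (hxy.trans (by linarith)) hδ.le
  rw [cut_univ, one_mul, mul_one] at h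
  rw [dist_zero_right, norm_norm]
  linarith

/-- If `f` is `1` on `A` and `0` on `C`, then the corner of `b` between `A` and `C` is, up to sign,
that of `[b, f]`. -/
theorem cut_comm_cut_eq (b : Op X E p) {A C : Set X} {f : X →ᵇ ℂ} (hA : ∀ x ∈ A, f x = 1)
    (hC : ∀ x ∈ C, f x = 0) :
    cut E p A * comm b f * cut E p C = -(cut E p A * b * cut E p C) := by
  have h1 : cut E p A * mulOp E p f = cut E p A := by
    rw [cut, ← mulOp_mul]
    congr 1
    ext x
    by_cases hx : x ∈ A
    · simp [hA x hx]
    · simp [chi_notMem hx]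
  have h2 : mulOp E p f * cut E p C = 0 := by
    rw [cut, ← mulOp_mul, ← mulOp_zero]
    congr 1
    ext x
    by_cases hx : x ∈ C
    · simp [hC x hx]
    · simp [chi_notMem hx]
  calc cut E p A * comm b f * cut E p C
      = cut E p A * b * (mulOp E p f * cut E p C)
        - (cut E p A * mulOp E p f) * b * cut E p C := by
        rw [comm]
        noncomm_ring
    _ = _ := by rw [h1, h2, mul_zero, zero_sub]

/-- The function `min(1, d(x, C) / R)`, which separates `C` from all points at distance at least
`R` from `C`. -/
theorem exists_lipschitz_separating (C : Set X) (hC : C.Nonempty) {R : ℝ} (hR : 0 < R) :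
    ∃ f : X →ᵇ ℂ, ‖f‖ ≤ 1 ∧ (∀ x y, dist (f x) (f y) ≤ dist x y / R) ∧ (∀ x ∈ C, f x = 0) ∧
      ∀ x, (∀ y ∈ C, R ≤ dist x y) → f x = 1 := by
  have hnn : ∀ x, 0 ≤ Metric.infDist x C / R := fun x =>
    div_nonneg Metric.infDist_nonneg hR.le
  refine ⟨BoundedContinuousFunction.ofNormedAddCommGroupDiscrete
    (fun x => ((min 1 (Metric.infDist x C / R) : ℝ) : ℂ)) 1 (fun x => ?_), ?_, ?_, ?_, ?_⟩
  · rw [Complex.norm_real, Real.norm_of_nonneg (le_min zero_le_one (hnn x))]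
    exact min_le_left _ _
  · refine (BoundedContinuousFunction.norm_le zero_le_one).2 fun x => ?_
    change ‖((min 1 (Metric.infDist x C / R) : ℝ) : ℂ)‖ ≤ 1
    rw [Complex.norm_real, Real.norm_of_nonneg (le_min zero_le_one (hnn x))]
    exact min_le_left _ _
  · intro x y
    change dist ((min 1 (Metric.infDist x C / R) : ℝ) : ℂ)
      ((min 1 (Metric.infDist y C / R) : ℝ) : ℂ) ≤ _
    rw [Complex.isometry_ofReal.dist_eq, Real.dist_eq]
    refine (abs_min_sub_min_le_max _ _ _ _).trans ?_
    rw [sub_self, abs_zero, ← sub_div, abs_div, abs_of_pos hR]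
    refine max_le (div_nonneg dist_nonneg hR.le) (div_le_div_of_nonneg_right ?_ hR.le)
    rw [← Real.dist_eq]
    simpa using (Metric.lipschitz_infDist_pt C).dist_le_mul x y
  · intro x hx
    change ((min 1 (Metric.infDist x C / R) : ℝ) : ℂ) = 0
    rw [Metric.infDist_zero_of_mem hx, zero_div, min_eq_right zero_le_one, Complex.ofReal_zero]
  · intro x hx
    change ((min 1 (Metric.infDist x C / R) : ℝ) : ℂ) = 1
    rw [min_eq_left, Complex.ofReal_one]
    rw [le_div_iff₀ hR, one_mul]
    exact (Metric.le_infDist hC).2 fun y hy => hx y hy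

theorem quasiLocal_of_commutesWithVL {b : Op X E p} (hb : CommutesWithVL b) : QuasiLocal b := by
  rw [quasiLocal_iff_farCornersLE]
  by_contra! hne
  obtain ⟨ε, hε, hne⟩ := hne
  have hex : ∀ n : ℕ, ∃ f : X →ᵇ ℂ, ‖f‖ ≤ 1 ∧
      (∀ x y, dist (f x) (f y) ≤ dist x y / ((n : ℝ) + 1)) ∧ ε < ‖comm b f‖ := by
    intro n
    have h := hne (n + 1) (by positivity)
    unfold FarCornersLE at h
    push Not at h
    obtain ⟨A, C, hAC, hb⟩ := h
    have hC : C.Nonempty := by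
      rw [Set.nonempty_iff_ne_empty]
      rintro rfl
      rw [cut_empty, mul_zero, norm_zero] at hb
      linarith
    obtain ⟨f, hf1, hfL, hf0, hfA⟩ := exists_lipschitz_separating C hC
      (R := (n : ℝ) + 1) (by positivity)
    refine ⟨f, hf1, hfL, hb.trans_le ?_⟩
    rw [← norm_neg, ← cut_comm_cut_eq b (fun x hx => hfA x fun y hy => (hAC x hx y hy).le) hf0]
    exact norm_cut_mul_mul_cut_le _ _ _
  choose f hf1 hfL hfb using hex
  have hVL : VeryLipschitz f := by
    refine ⟨⟨1, hf1⟩, fun L hL => ?_⟩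
    obtain ⟨n₀, hn₀⟩ := exists_nat_gt ((L : ℝ)⁻¹)
    refine ⟨n₀, fun n hn => LipschitzWith.of_dist_le_mul fun x y => (hfL n x y).trans ?_⟩
    rw [div_eq_inv_mul]
    refine mul_le_mul_of_nonneg_right ?_ dist_nonneg
    refine inv_le_of_inv_le₀ (NNReal.coe_pos.2 hL) (hn₀.le.trans ?_)
    have : (n₀ : ℝ) ≤ n := by exact_mod_cast hn
    linarith
  have h := (commutesWithVL_iff b).1 hb f hVL
  obtain ⟨n, hn⟩ := (h.eventually_lt_const hε).exists
  exact absurd (hfb n) (not_lt.2 hn.le)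

end

section

/-! ### Higson functions -/

theorem mul_mem_of_cbMulCb {B : NonUnitalSubalgebra ℂ (Op X E p)}
    (hB : cbMulCb B = (B : Set (Op X E p))) (f g : X →ᵇ ℂ) {a : Op X E p} (ha : a ∈ B) :
    mulOp E p f * a * mulOp E p g ∈ B := by
  rw [← SetLike.mem_coe, ← hB]
  exact ⟨f, g, a, ha, rfl⟩

theorem mulOp_mul_mem {B : NonUnitalSubalgebra ℂ (Op X E p)}
    (hB : cbMulCb B = (B : Set (Op X E p))) (f : X →ᵇ ℂ) {a : Op X E p} (ha : a ∈ B) :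
    mulOp E p f * a ∈ B := by
  simpa [mulOp_one] using mul_mem_of_cbMulCb hB f 1 ha

theorem mul_mulOp_mem {B : NonUnitalSubalgebra ℂ (Op X E p)}
    (hB : cbMulCb B = (B : Set (Op X E p))) (f : X →ᵇ ℂ) {a : Op X E p} (ha : a ∈ B) :
    a * mulOp E p f ∈ B := by
  simpa [mulOp_one] using mul_mem_of_cbMulCb hB 1 f ha

theorem comm_mem {B : NonUnitalSubalgebra ℂ (Op X E p)}
    (hB : cbMulCb B = (B : Set (Op X E p))) (f : X →ᵇ ℂ) {a : Op X E p} (ha : a ∈ B) :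
    comm a f ∈ B :=
  sub_mem (mul_mulOp_mem hB f ha) (mulOp_mul_mem hB f ha)

variable [DiscreteTopology X]

/-- Elements of `𝒦(X, B)` are small off a finite set, on both sides. -/
theorem exists_finset_norm_lt_of_mem_kIdeal {B : NonUnitalSubalgebra ℂ (Op X E p)} {T : Op X E p}
    (hT : T ∈ kIdeal B) {ε : ℝ} (hε : 0 < ε) :
    ∃ K : Finset X, ‖cut E p (K : Set X)ᶜ * T‖ ≤ ε ∧ ‖T * cut E p (K : Set X)ᶜ‖ ≤ ε := by
  classical
  have tail : ∀ (h : C₀(X, ℂ)) (η : ℝ), 0 < η → ∃ K : Finset X, ∀ K' : Finset X, K ⊆ K' →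
      ‖mulOp E p h.toBCF * cut E p (K' : Set X)ᶜ‖ ≤ η := by
    intro h η hη
    have h1 := h.zero_at_infty'
    rw [Filter.cocompact_eq_cofinite] at h1
    have h2 : {x | ¬ ‖h x‖ < η}.Finite :=
      (tendsto_zero_iff_norm_tendsto_zero.1 h1).eventually_lt_const hη
    refine ⟨h2.toFinset, fun K' hK' => ?_⟩
    rw [cut, ← mulOp_mul]
    refine norm_mulOp_le_of_forall hη.le fun x => ?_
    change ‖h x * chi (K' : Set X)ᶜ x‖ ≤ η
    by_cases hx : x ∈ (K' : Set X)ᶜ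
    · rw [chi_mem hx, mul_one]
      have : x ∉ h2.toFinset := fun h' => hx (hK' h')
      simpa using (not_not.1 (by simpa using this) : ‖h x‖ < η).le
    · rw [chi_notMem hx, mul_zero, norm_zero]
      exact hη.le
  obtain ⟨S, ⟨f, g, b, -, rfl⟩, hTS⟩ := Metric.mem_closure_iff.1 hT (ε / 2) (half_pos hε)
  rw [dist_eq_norm] at hTS
  obtain ⟨K₁, hK₁⟩ := tail f (ε / 2 / (‖b * mulOp E p g.toBCF‖ + 1)) (by positivity)
  obtain ⟨K₂, hK₂⟩ := tail g (ε / 2 / (‖mulOp E p f.toBCF * b‖ + 1)) (by positivity)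
  have small : ∀ s t : ℝ, 0 ≤ s → t ≤ ε / 2 / (s + 1) → t * s ≤ ε / 2 := by
    intro s t hs ht
    calc t * s ≤ ε / 2 / (s + 1) * s := mul_le_mul_of_nonneg_right ht hs
      _ ≤ ε / 2 := by
        rw [div_mul_eq_mul_div, div_le_iff₀ (by positivity)]
        exact mul_le_mul_of_nonneg_left (by linarith) (half_pos hε).le
  refine ⟨K₁ ∪ K₂, ?_, ?_⟩
  · have h1 := hK₁ (K₁ ∪ K₂) Finset.subset_union_left
    set Z := cut E p ((K₁ ∪ K₂ : Finset X) : Set X)ᶜ with hZ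
    have e : Z * T = Z * (T - mulOp E p f.toBCF * b * mulOp E p g.toBCF)
        + (mulOp E p f.toBCF * Z) * (b * mulOp E p g.toBCF) := by
      rw [hZ, ← cut_mul_mulOp_comm]
      noncomm_ring
    rw [e]
    have h2 := (norm_mul_le_left_of_le_one (S := T - mulOp E p f.toBCF * b * mulOp E p g.toBCF)
      (norm_cut_le (E := E) (p := p) ((K₁ ∪ K₂ : Finset X) : Set X)ᶜ))
    have h3 := norm_mul_le (mulOp E p f.toBCF * Z) (b * mulOp E p g.toBCF)
    have h4 := small _ _ (norm_nonneg (b * mulOp E p g.toBCF)) h1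
    refine (norm_add_le _ _).trans ?_
    linarith
  · have h1 := hK₂ (K₁ ∪ K₂) Finset.subset_union_right
    set Z := cut E p ((K₁ ∪ K₂ : Finset X) : Set X)ᶜ with hZ
    have e : T * Z = (T - mulOp E p f.toBCF * b * mulOp E p g.toBCF) * Z
        + (mulOp E p f.toBCF * b) * (mulOp E p g.toBCF * Z) := by
      noncomm_ring
    rw [e]
    have h2 := (norm_mul_le_right_of_le_one (S := T - mulOp E p f.toBCF * b * mulOp E p g.toBCF)
      (norm_cut_le (E := E) (p := p) ((K₁ ∪ K₂ : Finset X) : Set X)ᶜ))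
    have h3 := norm_mul_le (mulOp E p f.toBCF * b) (mulOp E p g.toBCF * Z)
    have h4 := small _ _ (norm_nonneg (mulOp E p f.toBCF * b)) h1
    rw [mul_comm] at h4
    refine (norm_add_le _ _).trans ?_
    linarith

theorem cut_mul_mul_cut_mem_kIdeal_set {B : NonUnitalSubalgebra ℂ (Op X E p)} (K : Finset X)
    {S : Op X E p} (hS : S ∈ B) :
    ∃ (f g : C₀(X, ℂ)), ∃ b ∈ B, cut E p (K : Set X) * S * cut E p (K : Set X)
      = mulOp E p f.toBCF * b * mulOp E p g.toBCF := by
  have h0 : Filter.Tendsto (chi (K : Set X)) (Filter.cocompact X) (𝓝 0) := by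
    rw [Filter.cocompact_eq_cofinite]
    refine tendsto_const_nhds.congr' ?_
    filter_upwards [K.finite_toSet.compl_mem_cofinite] with x hx
    exact (chi_notMem hx).symm
  let k : C₀(X, ℂ) := ⟨(chi (K : Set X)).toContinuousMap, h0⟩
  have hk : k.toBCF = chi (K : Set X) := by
    ext x
    rfl
  exact ⟨k, k, S, hS, by rw [hk]; rfl⟩

theorem higsonCommutatorsIn_of_quasiLocal (hX : BoundedGeometry X)
    {B : NonUnitalSubalgebra ℂ (Op X E p)}
    (hBmod : cbMulCb B = (B : Set (Op X E p))) {b : Op X E p} (hbB : b ∈ B) (hb : QuasiLocal b) :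
    HigsonCommutatorsIn B b := by
  classical
  intro g hg
  rw [quasiLocal_iff_farCornersLE] at hb
  change comm b g ∈ _
  refine Metric.mem_closure_iff.2 fun ε hε => ?_
  obtain ⟨R, δ, hR, hδ, H⟩ := exists_norm_cut_comm_le hb (C := ‖g‖) (ε := ε / 4) (by positivity)
  obtain ⟨K, hK, hgK⟩ := hg (R + 1) δ (by positivity) hδ
  have hKfin : K.Finite := isCompact_iff_finite.1 hK
  obtain ⟨R', hR', hbR'⟩ := hb (ε / (8 * (‖g‖ + 1))) (by positivity)
  set K' : Set X := {x | ∃ y ∈ K, dist x y ≤ R'} with hK'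
  have hK'fin : K'.Finite := hX.finite_nhd hKfin R'
  have hKK' : K ⊆ K' := fun x hx => ⟨x, hx, by rw [dist_self]; exact hR'⟩
  set T := comm b g with hT
  have hTB : T ∈ B := comm_mem hBmod g hbB
  set P := cut E p K with hP
  set P' := cut E p K' with hP'
  -- The compression of `[b, g]` to the complement of `K` is small since `g` varies slowly there.
  -- The rest, `S`, is a sum of terms with a factor `P`, and quasi-locality makes it almost
  -- supported in the finite set `K'`.
  set S := T - cut E p Kᶜ * T * cut E p Kᶜ with hS
  have hSB : S ∈ B := sub_mem hTB (mul_mem_of_cbMulCb hBmod _ _ hTB)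
  have hfar1 : ‖P * T * cut E p K'ᶜ‖ ≤ ε / 4 := by
    have e : P * T * cut E p K'ᶜ = (P * b * cut E p K'ᶜ) * mulOp E p g
        - mulOp E p g * (P * b * cut E p K'ᶜ) := by
      rw [hT, comm, mul_sub, sub_mul, ← mul_assoc, hP, ← mul_assoc, cut_mul_mulOp_comm]
      rw [mul_assoc (cut E p K * b), ← cut_mul_mulOp_comm]
      simp only [mul_assoc]
    have h1 : ‖P * b * cut E p K'ᶜ‖ ≤ ε / (8 * (‖g‖ + 1)) := hbR' _ _ fun x hx y hy => by
      by_contra hle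
      exact hy ⟨x, hx, by rw [dist_comm]; exact not_lt.1 hle⟩
    rw [e]
    have h2 := norm_mul_le (P * b * cut E p K'ᶜ) (mulOp E p g)
    have h3 := norm_mul_le (mulOp E p g) (P * b * cut E p K'ᶜ)
    have h4 := norm_mulOp_le (E := E) (p := p) g
    have h5 : ‖mulOp E p g‖ * ‖P * b * cut E p K'ᶜ‖ ≤ ‖g‖ * (ε / (8 * (‖g‖ + 1))) :=
      mul_le_mul h4 h1 (norm_nonneg _) (norm_nonneg _)
    have h6 : ‖g‖ * (ε / (8 * (‖g‖ + 1))) ≤ ε / 8 := by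
      rw [mul_div_assoc', div_le_div_iff₀ (by positivity) (by positivity)]
      nlinarith [norm_nonneg g]
    refine (norm_sub_le _ _).trans ?_
    rw [mul_comm] at h2
    linarith
  have hfar2 : ‖cut E p K'ᶜ * T * P‖ ≤ ε / 4 := by
    have e : cut E p K'ᶜ * T * P = (cut E p K'ᶜ * b * P) * mulOp E p g
        - mulOp E p g * (cut E p K'ᶜ * b * P) := by
      rw [hT, comm, mul_sub, sub_mul, ← mul_assoc, hP, ← mul_assoc, cut_mul_mulOp_comm]
      rw [mul_assoc (cut E p K'ᶜ * b), ← cut_mul_mulOp_comm]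
      simp only [mul_assoc]
    have h1 : ‖cut E p K'ᶜ * b * P‖ ≤ ε / (8 * (‖g‖ + 1)) := hbR' _ _ fun x hx y hy => by
      by_contra hle
      exact hx ⟨y, hy, not_lt.1 hle⟩
    rw [e]
    have h2 := norm_mul_le (cut E p K'ᶜ * b * P) (mulOp E p g)
    have h3 := norm_mul_le (mulOp E p g) (cut E p K'ᶜ * b * P)
    have h4 := norm_mulOp_le (E := E) (p := p) g
    have h5 : ‖mulOp E p g‖ * ‖cut E p K'ᶜ * b * P‖ ≤ ‖g‖ * (ε / (8 * (‖g‖ + 1))) :=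
      mul_le_mul h4 h1 (norm_nonneg _) (norm_nonneg _)
    have h6 : ‖g‖ * (ε / (8 * (‖g‖ + 1))) ≤ ε / 8 := by
      rw [mul_div_assoc', div_le_div_iff₀ (by positivity) (by positivity)]
      nlinarith [norm_nonneg g]
    refine (norm_sub_le _ _).trans ?_
    rw [mul_comm] at h2
    linarith
  have hmid := H Kᶜ g le_rfl fun x hx y hy hxy => (hgK x hx y hy (by linarith)).le
  have hPP' : P' * P = P := by rw [hP, hP', cut_mul_cut, Set.inter_eq_right.2 hKK']
  have hPP'' : P * P' = P := by rw [hP, hP', cut_mul_cut, Set.inter_eq_left.2 hKK']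
  have hc : cut E p Kᶜ = 1 - P := cut_compl K
  have hc' : cut E p K'ᶜ = 1 - P' := cut_compl K'
  have e : T - P' * S * P' = cut E p Kᶜ * T * cut E p Kᶜ + P * T * cut E p K'ᶜ
      + cut E p Kᶜ * (cut E p K'ᶜ * T * P) := by
    have hz : cut E p Kᶜ * cut E p K'ᶜ = cut E p K'ᶜ := by
      rw [cut_mul_cut, Set.inter_eq_right.2 (Set.compl_subset_compl.2 hKK')]
    have e1 : cut E p Kᶜ * (cut E p K'ᶜ * T * P) = cut E p K'ᶜ * T * P := by
      rw [← mul_assoc, ← mul_assoc, hz]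
    have hS' : S = P * T + T * P - P * T * P := by
      rw [hS, hc]
      noncomm_ring
    have e2 : P' * S * P' = P * T * P' + P' * T * P - P * T * P := by
      rw [hS']
      have : P' * (P * T + T * P - P * T * P) * P'
          = (P' * P) * T * P' + P' * T * (P * P') - (P' * P) * T * (P * P') := by noncomm_ring
      rw [this, hPP', hPP'']
    rw [e1, e2, hc, hc']
    noncomm_ring
  obtain ⟨f, k, b', hb', hfk⟩ := cut_mul_mul_cut_mem_kIdeal_set hK'fin.toFinset hSB
  refine ⟨_, ⟨f, k, b', hb', hfk⟩, ?_⟩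
  rw [hK'fin.coe_toFinset, dist_eq_norm, e]
  have h1 := norm_mul_le_left_of_le_one (S := cut E p K'ᶜ * T * P)
    (norm_cut_le (E := E) (p := p) Kᶜ)
  refine (norm_add₃_le).trans_lt ?_
  linarith

end

section

/-! ### The gliding hump -/

variable [DiscreteTopology X]

theorem isHigson_chi_finite {F : Set X} (hF : F.Finite) : IsHigson (chi F) := by
  intro R ε _ hε
  refine ⟨F, hF.isCompact, fun x hx y hy _ => ?_⟩
  rw [chi_notMem hx, chi_notMem hy, sub_self, norm_zero]
  exact hε

/-- Commutators with indicators of finite sets show that under the Higson condition the rows and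
columns of `b` over a finite set are concentrated on a finite set. -/
theorem exists_finset_norm_corner_le {B : NonUnitalSubalgebra ℂ (Op X E p)} {b : Op X E p}
    (hb : HigsonCommutatorsIn B b) (F : Finset X) {ε : ℝ} (hε : 0 < ε) :
    ∃ F' : Finset X, ‖cut E p (F : Set X) * b * cut E p (F' : Set X)ᶜ‖ ≤ ε ∧
      ‖cut E p (F' : Set X)ᶜ * b * cut E p (F : Set X)‖ ≤ ε := by
  classical
  have h : comm b (chi (F : Set X)) ∈ kIdeal B := hb _ (isHigson_chi_finite F.finite_toSet)
  obtain ⟨K, hK1, hK2⟩ := exists_finset_norm_lt_of_mem_kIdeal h hε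
  refine ⟨F ∪ K, ?_, ?_⟩
  · rw [← norm_neg, ← cut_comm_cut_eq b (C := ((F ∪ K : Finset X) : Set X)ᶜ)
      (f := chi (F : Set X)) (fun x hx => chi_mem hx)
      (fun x hx => chi_notMem fun h' =>
        (Set.mem_compl_iff _ _).1 hx (by simp [Finset.mem_coe.1 h']))]
    rw [mul_assoc]
    refine (norm_mul_le_left_of_le_one (norm_cut_le _)).trans ((norm_mul_cut_mono ?_ _).trans hK2)
    exact Set.compl_subset_compl.2 (by simp)
  · have e : cut E p ((F ∪ K : Finset X) : Set X)ᶜ * b * cut E p (F : Set X)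
        = cut E p ((F ∪ K : Finset X) : Set X)ᶜ * comm b (chi (F : Set X))
          * cut E p (F : Set X) := by
      have h1 : cut E p ((F ∪ K : Finset X) : Set X)ᶜ * cut E p (F : Set X) = 0 :=
        cut_mul_cut_of_disjoint (Set.disjoint_left.2 fun x hx h' =>
          (Set.mem_compl_iff _ _).1 hx (by simp [Finset.mem_coe.1 h']))
      change _ = _ * (b * cut E p (F : Set X) - cut E p (F : Set X) * b) * _
      rw [mul_sub, ← mul_assoc _ (cut E p (F : Set X)) b, h1, zero_mul, sub_zero,
        mul_assoc _ (b * _) _, mul_assoc b, cut_mul_self, mul_assoc]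
    rw [e]
    refine (norm_mul_le_right_of_le_one (norm_cut_le _)).trans ((norm_cut_mul_mono ?_ _).trans hK1)
    exact Set.compl_subset_compl.2 (by simp)

/-- One step of a gliding hump: a large far-off-diagonal corner of `b` can be found between
finite sets that avoid a given finite set. -/
theorem exists_finite_large_corner {B : NonUnitalSubalgebra ℂ (Op X E p)}
    {b : Op X E p} (hb : HigsonCommutatorsIn B b) {ε : ℝ} (hε : 0 < ε)
    (hne : ∀ R : ℝ, 0 ≤ R → ¬ FarCornersLE b R ε) (F : Finset X) (n : ℝ) :
    ∃ A C : Finset X, (∀ x ∈ A, ∀ y ∈ C, n < dist x y) ∧ (∀ x ∈ A, x ∉ F) ∧ (∀ x ∈ C, x ∉ F) ∧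
      ε / 2 < ‖cut E p (A : Set X) * b * cut E p (C : Set X)‖ := by
  classical
  obtain ⟨F', hF'1, hF'2⟩ := exists_finset_norm_corner_le hb F (ε := ε / 8) (by positivity)
  -- A set at distance more than `R` from a point of `F` misses `F'`. So `F` contributes little to a
  -- corner between sets further apart than `R`.
  obtain ⟨R, hR⟩ : ∃ R : ℝ, ∀ x ∈ F, ∀ y ∈ F', dist x y ≤ R := by
    obtain ⟨R, hR⟩ := ((F ×ˢ F').finite_toSet.image fun z : X × X => dist z.1 z.2).bddAbove
    exact ⟨R, fun x hx y hy => hR ⟨(x, y), by simp [hx, hy], rfl⟩⟩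
  have h := hne (max (max R n) 0) (le_max_right _ _)
  unfold FarCornersLE at h
  push Not at h
  obtain ⟨A, C, hAC, hlarge⟩ := h
  have hRAC : ∀ x ∈ A, ∀ y ∈ C, R < dist x y := fun x hx y hy =>
    ((le_max_left R n).trans (le_max_left _ _)).trans_lt (hAC x hx y hy)
  have hnAC : ∀ x ∈ A, ∀ y ∈ C, n < dist x y := fun x hx y hy =>
    ((le_max_right R n).trans (le_max_left _ _)).trans_lt (hAC x hx y hy)
  have hε8 : (0 : ℝ) ≤ ε / 8 := by positivity
  have h1 : ‖cut E p (A ∩ F) * b * cut E p C‖ ≤ ε / 8 := by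
    rcases (A ∩ (F : Set X)).eq_empty_or_nonempty with he | ⟨x, hxA, hxF⟩
    · rw [he, cut_empty, zero_mul, zero_mul, norm_zero]
      exact hε8
    · refine (norm_cut_mul_cut_mono Set.inter_subset_right ?_ b).trans hF'1
      exact fun y hy hyF' => (hRAC x hxA y hy).not_ge (hR x hxF y hyF')
  have h2 : ‖cut E p (A \ F) * b * cut E p (C ∩ F)‖ ≤ ε / 8 := by
    rcases (C ∩ (F : Set X)).eq_empty_or_nonempty with he | ⟨y, hyC, hyF⟩
    · rw [he, cut_empty, mul_zero, norm_zero]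
      exact hε8
    · refine (norm_cut_mul_cut_mono ?_ Set.inter_subset_right b).trans hF'2
      intro x hx hxF'
      have := hRAC x hx.1 y hyC
      rw [dist_comm] at this
      exact this.not_ge (hR y hyF x hxF')
  have hA : cut E p A = cut E p (A ∩ F) + cut E p (A \ F) := by
    rw [← cut_add_cut_diff (S := A ∩ (F : Set X)) Set.inter_subset_left, Set.sdiff_self_inter]
  have hC : cut E p C = cut E p (C ∩ F) + cut E p (C \ F) := by
    rw [← cut_add_cut_diff (S := C ∩ (F : Set X)) Set.inter_subset_left, Set.sdiff_self_inter]
  have h3 : 3 / 4 * ε < ‖cut E p (A \ F) * b * cut E p (C \ F)‖ := by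
    have e : cut E p A * b * cut E p C = cut E p (A ∩ F) * b * cut E p C
        + cut E p (A \ F) * b * cut E p (C ∩ F) + cut E p (A \ F) * b * cut E p (C \ F) := by
      rw [add_assoc, ← mul_add, ← hC, ← add_mul, ← add_mul, ← hA]
    rw [e] at hlarge
    have := hlarge.trans_le norm_add₃_le
    linarith
  obtain ⟨G, hG⟩ := exists_finite_lt_norm_cut_mul (by positivity) h3
  rw [← mul_assoc, ← mul_assoc, cut_mul_cut] at hG
  have hA' : (↑(G.filter (· ∈ A \ (F : Set X))) : Set X) = (G : Set X) ∩ (A \ F) := by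
    ext x
    simp
  set A' := G.filter (· ∈ A \ (F : Set X))
  rw [← hA'] at hG
  obtain ⟨F'', hF'', -⟩ := exists_finset_norm_corner_le hb A' (ε := ε / 8) (by positivity)
  have hC' : (↑(F''.filter (· ∈ C \ (F : Set X))) : Set X) = (C \ F) ∩ F'' := by
    ext x
    simp [and_comm]
  refine ⟨A', F''.filter (· ∈ C \ (F : Set X)), ?_, ?_, ?_, ?_⟩
  · intro x hx y hy
    exact hnAC x (Finset.mem_filter.1 hx).2.1 y (Finset.mem_filter.1 hy).2.1
  · exact fun x hx => (Finset.mem_filter.1 hx).2.2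
  · exact fun x hx => (Finset.mem_filter.1 hx).2.2
  · rw [hC']
    have e : cut E p (C \ F) = cut E p ((C \ F) ∩ F'') + cut E p ((C \ F) \ F'') := by
      rw [← cut_add_cut_diff (S := (C \ F) ∩ (F'' : Set X)) Set.inter_subset_left,
        Set.sdiff_self_inter]
    rw [e, mul_add] at hG
    have h4 : ‖cut E p (A' : Set X) * b * cut E p ((C \ F) \ F'')‖ ≤ ε / 8 :=
      (norm_cut_mul_cut_mono subset_rfl (fun x hx => hx.2) b).trans hF''
    have := hG.trans_le (norm_add_le _ _)
    linarith

/-- If `A k`, `C k` are finite sets such that `A j` and `C k` are at distance at least `r j` from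
each other for all `j` and `k`, where `r j → ∞`, then some Higson function is `1` on all `A k` and
`0` on all `C k`. It is the supremum of tents over the `A k` of slope `1 / r k`. -/
theorem exists_isHigson_separating (hX : BoundedGeometry X) (A C : ℕ → Finset X) (r : ℕ → ℝ)
    (hA : ∀ k, (A k).Nonempty) (hr0 : ∀ k, 0 < r k) (hrmono : Monotone r)
    (hr : Filter.Tendsto r Filter.atTop Filter.atTop)
    (hAC : ∀ j k, ∀ x ∈ A j, ∀ y ∈ C k, r j ≤ dist y x) :
    ∃ g : X →ᵇ ℂ, IsHigson g ∧ (∀ k, ∀ x ∈ A k, g x = 1) ∧ ∀ k, ∀ x ∈ C k, g x = 0 := by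
  set t : ℕ → X → ℝ := fun k x => max 0 (1 - Metric.infDist x (A k : Set X) / r k) with ht
  have ht0 : ∀ k x, 0 ≤ t k x := fun k x => le_max_left _ _
  have ht1 : ∀ k x, t k x ≤ 1 := fun k x => max_le zero_le_one
    (sub_le_self _ (div_nonneg Metric.infDist_nonneg (hr0 k).le))
  have htlip : ∀ k x y, t k x ≤ t k y + dist x y / r k := by
    intro k x y
    refine max_le (add_nonneg (ht0 k y) (div_nonneg dist_nonneg (hr0 k).le)) ?_
    have h1 : Metric.infDist y (A k : Set X) ≤ Metric.infDist x (A k : Set X) + dist x y := by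
      rw [dist_comm]
      exact Metric.infDist_le_infDist_add_dist
    have h2 : Metric.infDist y (A k : Set X) / r k
        ≤ Metric.infDist x (A k : Set X) / r k + dist x y / r k := by
      rw [← add_div]
      exact div_le_div_of_nonneg_right h1 (hr0 k).le
    have h3 : 1 - Metric.infDist y (A k : Set X) / r k ≤ t k y := le_max_right _ _
    linarith
  have hbdd : ∀ x, BddAbove (Set.range fun k => t k x) := fun x =>
    ⟨1, by rintro _ ⟨k, rfl⟩; exact ht1 k x⟩
  set s : X → ℝ := fun x => ⨆ k, t k x with hs
  have hs0 : ∀ x, 0 ≤ s x := fun x => (ht0 0 x).trans (le_ciSup (hbdd x) 0)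
  have hs1 : ∀ x, s x ≤ 1 := fun x => ciSup_le fun k => ht1 k x
  refine ⟨BoundedContinuousFunction.ofNormedAddCommGroupDiscrete (fun x => (s x : ℂ)) 1
    (fun x => ?_), ?_, ?_, ?_⟩
  · rw [Complex.norm_real, Real.norm_of_nonneg (hs0 x)]
    exact hs1 x
  · intro R ε hR hε
    obtain ⟨k, hk⟩ := (hr.eventually_gt_atTop (R / ε)).exists
    -- Off the neighbourhoods of `A j`, `j < k`, only tents of slope at most `1 / r k` are visible.
    have hfin : (⋃ j ∈ Finset.range k, {x | ∃ y ∈ (A j : Set X), dist x y ≤ r j}).Finite :=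
      Set.Finite.biUnion (Finset.finite_toSet _) fun j _ =>
        hX.finite_nhd (A j).finite_toSet (r j)
    refine ⟨_, hfin.isCompact, fun x hx y hy hxy => ?_⟩
    have hvan : ∀ z, z ∉ (⋃ j ∈ Finset.range k, {x | ∃ y ∈ (A j : Set X), dist x y ≤ r j}) →
        ∀ j < k, t j z = 0 := by
      intro z hz j hj
      refine max_eq_left (sub_nonpos.2 ((one_le_div (hr0 j)).2 ?_))
      refine (Metric.le_infDist (hA j)).2 fun a ha => ?_
      by_contra hlt
      exact hz (Set.mem_iUnion₂_of_mem (Finset.mem_range.2 hj) ⟨a, ha, (not_le.1 hlt).le⟩)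
    have hle : ∀ x y, x ∉ (⋃ j ∈ Finset.range k, {x | ∃ y ∈ (A j : Set X), dist x y ≤ r j}) →
        s x ≤ s y + dist x y / r k := by
      intro x y hx
      refine ciSup_le fun j => ?_
      rcases lt_or_ge j k with hj | hj
      · rw [hvan x hx j hj]
        exact add_nonneg (hs0 y) (div_nonneg dist_nonneg (hr0 k).le)
      · refine (htlip j x y).trans (add_le_add (le_ciSup (hbdd y) j) ?_)
        exact div_le_div_of_nonneg_left dist_nonneg (hr0 k) (hrmono hj)
    have h1 := hle x y hx
    have h2 := hle y x hy
    rw [dist_comm] at h2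
    change ‖(s x : ℂ) - (s y : ℂ)‖ < ε
    rw [← Complex.ofReal_sub, Complex.norm_real, Real.norm_eq_abs]
    have h3 : dist x y / r k < ε := by
      rw [div_lt_iff₀ (hr0 k)]
      rw [div_lt_iff₀ hε] at hk
      linarith
    rw [abs_lt]
    constructor <;> linarith
  · intro k x hx
    change (s x : ℂ) = 1
    have : s x = 1 := by
      refine le_antisymm (hs1 x) (le_trans ?_ (le_ciSup (hbdd x) k))
      refine le_max_of_le_right ?_
      rw [Metric.infDist_zero_of_mem (Finset.mem_coe.2 hx), zero_div, sub_zero]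
    rw [this, Complex.ofReal_one]
  · intro k x hx
    change (s x : ℂ) = 0
    have : s x = 0 := by
      refine le_antisymm (ciSup_le fun j => ?_) (hs0 x)
      refine max_le le_rfl (sub_nonpos.2 ((one_le_div (hr0 j)).2 ?_))
      exact (Metric.le_infDist (hA j)).2 fun a ha => hAC j k a ha x hx
    rw [this, Complex.ofReal_zero]

theorem quasiLocal_of_higsonCommutatorsIn (hX : BoundedGeometry X)
    {B : NonUnitalSubalgebra ℂ (Op X E p)} {b : Op X E p} (hb : HigsonCommutatorsIn B b) :
    QuasiLocal b := by
  classical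
  rw [quasiLocal_iff_farCornersLE]
  by_contra! hne
  obtain ⟨ε, hε, hne⟩ := hne
  -- A sequence of triples `(n, A, C)`: the finite sets `A`, `C` have a large corner, are more than
  -- `n` apart from each other, and more than `n` away from all their predecessors.
  obtain ⟨f, hf, hfr⟩ := exists_seq_of_forall_finset_exists
    (α := ℕ × Finset X × Finset X)
    (fun z => 0 < z.1 ∧ (∀ x ∈ z.2.1, ∀ y ∈ z.2.2, (z.1 : ℝ) < dist x y) ∧
      ε / 2 < ‖cut E p (z.2.1 : Set X) * b * cut E p (z.2.2 : Set X)‖)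
    (fun z w => z.1 < w.1 ∧ ∀ x ∈ z.2.1 ∪ z.2.2, ∀ y ∈ w.2.1 ∪ w.2.2, (w.1 : ℝ) < dist x y) (by
      intro s _
      set n : ℕ := s.sup (fun z => z.1) + 1 with hn
      have hfin := hX.finite_nhd (s.biUnion fun z => z.2.1 ∪ z.2.2).finite_toSet (n : ℝ)
      obtain ⟨A, C, hAC, hA, hC, hlarge⟩ :=
        exists_finite_large_corner hb hε hne hfin.toFinset n
      refine ⟨(n, A, C), ⟨Nat.succ_pos _, hAC, hlarge⟩, fun z hz => ⟨?_, ?_⟩⟩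
      · exact Nat.lt_succ_of_le (Finset.le_sup (f := fun z : ℕ × Finset X × Finset X => z.1) hz)
      · intro x hx y hy
        by_contra hle
        have hy' : y ∈ hfin.toFinset := by
          rw [Set.Finite.mem_toFinset]
          exact ⟨x, Finset.mem_coe.2 (Finset.mem_biUnion.2 ⟨z, hz, hx⟩), by
            rw [dist_comm]; exact not_lt.1 hle⟩
        rcases Finset.mem_union.1 hy with h | h
        · exact hA y h hy'
        · exact hC y h hy')
  set A : ℕ → Finset X := fun k => (f k).2.1 with hA
  set C : ℕ → Finset X := fun k => (f k).2.2 with hC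
  set r : ℕ → ℝ := fun k => ((f k).1 : ℝ) with hr
  have hmono : StrictMono fun k => (f k).1 := fun j k hjk => (hfr j k hjk).1
  have hr0 : ∀ k, 0 < r k := fun k => Nat.cast_pos.2 (hf k).1
  have hrm : Monotone r := fun j k hjk => Nat.cast_le.2 (hmono.monotone hjk)
  have hlarge : ∀ k, ε / 2 < ‖cut E p (A k : Set X) * b * cut E p (C k : Set X)‖ :=
    fun k => (hf k).2.2
  have hAne : ∀ k, (A k).Nonempty := by
    intro k
    rw [Finset.nonempty_iff_ne_empty]
    intro h0
    have := hlarge k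
    rw [h0, Finset.coe_empty, cut_empty, zero_mul, zero_mul, norm_zero] at this
    linarith
  obtain ⟨g, hg, hg1, hg0⟩ := exists_isHigson_separating hX A C r hAne hr0 hrm
    (tendsto_natCast_atTop_atTop.comp hmono.tendsto_atTop) (by
      intro j k x hx y hy
      rcases lt_trichotomy j k with hjk | rfl | hkj
      · have h1 := (hfr j k hjk).2 x (Finset.mem_union_left _ hx) y (Finset.mem_union_right _ hy)
        rw [dist_comm]
        exact (hrm hjk.le).trans h1.le
      · rw [dist_comm]
        exact ((hf j).2.1 x hx y hy).le
      · exact ((hfr k j hkj).2 y (Finset.mem_union_right _ hy) x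
          (Finset.mem_union_left _ hx)).le)
  obtain ⟨K, hK, -⟩ := exists_finset_norm_lt_of_mem_kIdeal (hb g hg) (half_pos hε)
  -- The sets `A k` are pairwise disjoint, so one of them misses the finite set `K`.
  have hdisj : Pairwise fun i j => Disjoint (A i : Set X) (A j : Set X) := by
    have h : ∀ i j, i < j → Disjoint (A i : Set X) (A j : Set X) := by
      intro i j hij
      refine Set.disjoint_left.2 fun x hx hx' => ?_
      have h1 := (hfr i j hij).2 x (Finset.mem_union_left _ hx) x (Finset.mem_union_left _ hx')
      rw [dist_self] at h1
      exact (hr0 j).not_gt h1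
    intro i j hij
    rcases lt_or_gt_of_ne hij with h' | h'
    · exact h i j h'
    · exact (h j i h').symm
  obtain ⟨k, hk⟩ : ∃ k, k ∉ {j | ((A j : Set X) ∩ K).Nonempty} :=
    (finite_setOf_inter_nonempty hdisj K).exists_notMem
  have hsub : (A k : Set X) ⊆ (K : Set X)ᶜ := fun x hx hxK => hk ⟨x, hx, hxK⟩
  have h1 := hlarge k
  rw [← norm_neg, ← cut_comm_cut_eq b (hg1 k) (hg0 k)] at h1
  have h2 := (norm_mul_le_right_of_le_one (S := cut E p (A k : Set X) * comm b g)
    (norm_cut_le (E := E) (p := p) (C k : Set X))).trans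
    ((norm_cut_mul_mono hsub (comm b g)).trans hK)
  linarith

end

section

/-! ### Colourings and approximants of finite propagation -/

/-- Greedy colouring along a well-order: a symmetric relation with at most `N` neighbours of each
point has a proper colouring with `N + 1` colours. -/
theorem exists_coloring {I : Type*} (adj : I → I → Prop) (hsymm : ∀ i j, adj i j → adj j i) (N : ℕ)
    (hdeg : ∀ i, {j | adj i j}.encard ≤ N) :
    ∃ c : I → Fin (N + 1), ∀ i j, i ≠ j → adj i j → c i ≠ c j := by
  classical
  have hwf : WellFounded (WellOrderingRel : I → I → Prop) := IsWellFounded.wf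
  let c : I → ℕ := hwf.fix fun i rec => sInf {n | ∀ j, ∀ h : WellOrderingRel j i,
    adj i j → rec j h ≠ n}
  have hc : ∀ i, c i = sInf {n | ∀ j, WellOrderingRel j i → adj i j → c j ≠ n} := fun i =>
    hwf.fix_eq _ i
  have hex : ∀ i, ∃ n ∈ {n | ∀ j, WellOrderingRel j i → adj i j → c j ≠ n}, n < N + 1 := by
    intro i
    have hfin : {j | adj i j}.Finite := Set.finite_of_encard_le_coe (hdeg i)
    have hcard : (hfin.toFinset.image c).card < (Finset.range (N + 1)).card := by
      rw [Finset.card_range]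
      refine Nat.lt_succ_of_le (Finset.card_image_le.trans ?_)
      have := hdeg i
      rw [hfin.encard_eq_coe_toFinset_card] at this
      exact_mod_cast this
    obtain ⟨n, hn, hn'⟩ := Finset.exists_mem_notMem_of_card_lt_card hcard
    refine ⟨n, fun j _ hj hjn => hn' ?_, Finset.mem_range.1 hn⟩
    exact Finset.mem_image.2 ⟨j, by simpa using hj, hjn⟩
  have hlt : ∀ i, c i < N + 1 := by
    intro i
    obtain ⟨n, hn, hnN⟩ := hex i
    rw [hc i]
    exact (Nat.sInf_le hn).trans_lt hnN
  have hne : ∀ i j, WellOrderingRel j i → adj i j → c j ≠ c i := by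
    intro i j hji hadj
    obtain ⟨n, hn, -⟩ := hex i
    have := Nat.sInf_mem ⟨n, hn⟩
    rw [← hc i] at this
    exact this j hji hadj
  refine ⟨fun i => ⟨c i, hlt i⟩, fun i j hij hadj h => ?_⟩
  have h' : c i = c j := congrArg Fin.val h
  rcases trichotomous_of WellOrderingRel i j with h1 | h1 | h1
  · exact hne j i h1 (hsymm i j hadj) h'
  · exact hij h1
  · exact hne i j h1 hadj h'.symm

/-- In a space of bounded geometry, a family of uniformly bounded subsets with finite multiplicity
splits into finitely many subfamilies of pairwise disjoint sets. -/
theorem BoundedGeometry.exists_disjoint_coloring (hX : BoundedGeometry X) {I : Type*}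
    (S : I → Set X) {D : ℝ} (hD : ∀ i, ∀ x ∈ S i, ∀ y ∈ S i, dist x y ≤ D) {M : ℕ}
    (hM : ∀ x, {i | x ∈ S i}.encard ≤ M) :
    ∃ (n : ℕ) (c : I → Fin n), ∀ i j, i ≠ j → c i = c j → Disjoint (S i) (S j) := by
  classical
  obtain ⟨N, hN⟩ := hX D
  have hfinM : ∀ x, {i | x ∈ S i}.Finite := fun x => Set.finite_of_encard_le_coe (hM x)
  obtain ⟨c, hc⟩ := exists_coloring (fun i j => (S i ∩ S j).Nonempty)
    (fun i j h => by rwa [Set.inter_comm]) (N * M) (by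
      intro i
      rcases (S i).eq_empty_or_nonempty with he | ⟨x₀, hx₀⟩
      · simp [he]
      · have hball := hX.finite_closedBall x₀ D
        have hsub : {j | (S i ∩ S j).Nonempty} ⊆
            ((hball.toFinset.biUnion fun x => (hfinM x).toFinset : Finset I) : Set I) := by
          rintro j ⟨x, hxi, hxj⟩
          rw [Finset.mem_coe, Finset.mem_biUnion]
          exact ⟨x, by simpa using hD i x hxi x₀ hx₀, by simpa using hxj⟩
        refine (Set.encard_le_encard hsub).trans ?_
        rw [Set.encard_coe_eq_coe_finsetCard]
        refine Nat.cast_le.2 ((Finset.card_biUnion_le_card_mul _ _ M fun x _ => ?_).trans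
          (Nat.mul_le_mul_right M ?_))
        · have := hM x
          rw [(hfinM x).encard_eq_coe_toFinset_card] at this
          exact_mod_cast this
        · have := hN x₀
          rw [hball.encard_eq_coe_toFinset_card] at this
          exact_mod_cast this)
  refine ⟨_, c, fun i j hij h => ?_⟩
  by_contra hne
  exact hc i j hij (Set.not_disjoint_iff_nonempty_inter.1 hne) h

variable [DiscreteTopology X]

/-- Glueing of functions supported in disjoint sets. -/
theorem exists_glue {J : Type*} (A : J → Set X) (hA : Pairwise fun i j => Disjoint (A i) (A j))
    (u : J → X →ᵇ ℂ) (hu : ∀ j, ‖u j‖ ≤ 1) :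
    ∃ f : X →ᵇ ℂ, (∀ j, ∀ x ∈ A j, f x = u j x) ∧ ∀ x, (∀ j, x ∉ A j) → f x = 0 := by
  classical
  refine ⟨BoundedContinuousFunction.ofNormedAddCommGroupDiscrete
    (fun x => if h : ∃ j, x ∈ A j then u h.choose x else 0) 1 (fun x => ?_), ?_, ?_⟩
  · split_ifs with h
    · exact ((u _).norm_coe_le_norm x).trans (hu _)
    · rw [norm_zero]
      exact zero_le_one
  · intro j x hx
    have h : ∃ j, x ∈ A j := ⟨j, hx⟩
    have hj : h.choose = j := by
      by_contra hne
      exact Set.disjoint_left.1 (hA hne) h.choose_spec hx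
    change (if h : ∃ j, x ∈ A j then u h.choose x else 0) = _
    rw [dif_pos h, hj]
  · intro x hx
    change (if h : ∃ j, x ∈ A j then u h.choose x else 0) = _
    exact dif_neg fun ⟨j, hj⟩ => hx j hj

/-- For functions `u i`, `v i` supported in uniformly bounded sets of finite multiplicity, the
operator `∑ i, u i b (v i)` is an element of `B` of finite propagation: along a colouring it is a
finite sum of block cutdowns multiplied by functions. -/
theorem exists_sum_mul_mul_mem (hX : BoundedGeometry X) {B : NonUnitalSubalgebra ℂ (Op X E p)}
    (hBmod : cbMulCb B = (B : Set (Op X E p))) (hBcut : ClosedUnderBlockCutdowns B)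
    {b : Op X E p} (hb : b ∈ B) {I : Type u} (S : I → Set X) {D : ℝ}
    (hD : ∀ i, ∀ x ∈ S i, ∀ y ∈ S i, dist x y ≤ D) {M : ℕ}
    (hM : ∀ x, {i | x ∈ S i}.encard ≤ M) (u v : I → X →ᵇ ℂ) (hu : ∀ i, ‖u i‖ ≤ 1)
    (hv : ∀ i, ‖v i‖ ≤ 1) (hu0 : ∀ i, ∀ x ∉ S i, u i x = 0) (hv0 : ∀ i, ∀ x ∉ S i, v i x = 0) :
    ∃ T ∈ B, FinitePropagation T ∧ ∀ (ξ : ellP X E p) (x : X) (G : Finset I),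
      (∀ i, x ∈ S i → i ∈ G) →
        value (T ξ) x = ∑ i ∈ G, u i x • value (b (mulOp E p (v i) ξ)) x := by
  classical
  obtain ⟨n, c, hc⟩ := hX.exists_disjoint_coloring S hD hM
  let A : (k : Fin n) → {i // c i = k} → Set X := fun k i => S i
  have hA : ∀ k, Pairwise fun i j => Disjoint (A k i) (A k j) := fun k i j hij =>
    hc i j (fun h => hij (Subtype.ext h)) (i.2.trans j.2.symm)
  choose f hf1 hf0 using fun k => exists_glue (A k) (hA k) (fun i => u i) fun i => hu i
  choose g hg1 hg0 using fun k => exists_glue (A k) (hA k) (fun i => v i) fun i => hv i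
  set T : Op X E p := ∑ k, mulOp E p (f k) * blockOp b (hA k) * mulOp E p (g k) with hT
  have hTval : ∀ (ξ : ellP X E p) (x : X) (G : Finset I), (∀ i, x ∈ S i → i ∈ G) →
      value (T ξ) x = ∑ i ∈ G, u i x • value (b (mulOp E p (v i) ξ)) x := by
    intro ξ x G hG
    rw [hT, sum_apply, value_sum, ← Finset.sum_fiberwise G c]
    refine Finset.sum_congr rfl fun k _ => ?_
    change f k x • value (blockOp b (hA k) (mulOp E p (g k) ξ)) x = _
    rw [value_blockOp]
    by_cases h : ∃ i : {i // c i = k}, x ∈ A k i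
    · obtain ⟨i, hi⟩ := h
      have hgv : cut E p (A k i) (mulOp E p (g k) ξ) = mulOp E p (v i) ξ := by
        refine ellP_ext fun y => ?_
        by_cases hy : y ∈ A k i
        · rw [value_cut_mem hy, value_mulOp, value_mulOp, hg1 k i y hy]
        · rw [value_cut_notMem hy, value_mulOp, hv0 i y hy, zero_smul]
      rw [blockFun_of_mem b (hA k) hi, hf1 k i x hi, hgv, Finset.sum_eq_single (i : I)]
      · intro j hj hji
        have hjk : c j = k := (Finset.mem_filter.1 hj).2
        have hxj : x ∉ S j := fun hxj =>
          Set.disjoint_left.1 (hc j i hji (hjk.trans i.2.symm)) hxj hi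
        rw [hu0 j x hxj, zero_smul]
      · intro hi'
        exact absurd (Finset.mem_filter.2 ⟨hG i hi, i.2⟩) hi'
    · push Not at h
      rw [hf0 k x h, zero_smul, Finset.sum_eq_zero]
      intro j hj
      rw [hu0 j x (h ⟨j, (Finset.mem_filter.1 hj).2⟩), zero_smul]
  refine ⟨T, ?_, ⟨max D 0, le_max_right _ _, fun φ φ' hφ => ?_⟩, hTval⟩
  · exact sum_mem fun k _ => mul_mem_of_cbMulCb hBmod _ _ (blockOp_mem hBcut hb (hA k))
  · refine op_ext fun ξ x => ?_
    change φ x • value (T (mulOp E p φ' ξ)) x = 0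
    by_cases hx : φ x = 0
    · rw [hx, zero_smul]
    have hfin : {i | x ∈ S i}.Finite := Set.finite_of_encard_le_coe (hM x)
    rw [hTval _ x hfin.toFinset (by simp), Finset.sum_eq_zero, smul_zero]
    intro i hi
    have hxi : x ∈ S i := by simpa using hi
    have hz : mulOp E p (v i) (mulOp E p φ' ξ) = 0 := by
      refine ellP_ext fun y => ?_
      rw [value_mulOp, value_mulOp, value_zero]
      by_cases hy : y ∈ S i
      · have : φ' y = 0 := by
          by_contra hne
          have h1 := lt_dist_of_lt_setDist hφ (subset_tsupport _ hx) (subset_tsupport _ hne)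
          exact ((le_max_left D 0).trans_lt h1).not_ge (hD i x hxi y hy)
        rw [this, zero_smul, smul_zero]
      · rw [hv0 i y hy, zero_smul]
    rw [hz, map_zero, value_zero, smul_zero]

end

section

/-! ### Quasi-local operators for `p ∈ {0, 1, ∞}` -/

theorem norm_le_of_forall_norm_value_le (hp : p.exponent = ∞) {ξ : ellP X E p} {C : ℝ}
    (hC : 0 ≤ C) (h : ∀ x, ‖value ξ x‖ ≤ C) : ‖ξ‖ ≤ C := by
  cases p with
  | zero => exact lp.norm_le_of_forall_le (E := fun _ : X => E) (f := ξ.toLp) hC h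
  | ofOneLE q hq =>
    change q = ∞ at hp
    subst hp
    exact lp.norm_le_of_forall_le (E := fun _ : X => E) (f := ξ.toLp) hC h

theorem encard_setOf_mem_closedBall_le {R : ℝ} {N : ℕ}
    (hN : ∀ x : X, (Metric.closedBall x R).encard ≤ N) (x : X) :
    {i | x ∈ Metric.closedBall i R}.encard ≤ N := by
  have : {i | x ∈ Metric.closedBall i R} = Metric.closedBall x R := by
    ext i
    rw [Set.mem_ofPred_eq, Metric.mem_closedBall, Metric.mem_closedBall, dist_comm]
  rw [this]
  exact hN x

theorem dist_le_of_mem_closedBall {R : ℝ} (i x : X) (hx : x ∈ Metric.closedBall i R) (y : X)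
    (hy : y ∈ Metric.closedBall i R) : dist x y ≤ 2 * R := by
  rw [Metric.mem_closedBall] at hx hy
  have := dist_triangle_right x y i
  linarith

variable [DiscreteTopology X]

theorem cut_singleton_sum (K : Finset X) :
    ∑ y ∈ K, cut E p ({y} : Set X) = cut E p (K : Set X) := by
  rw [← cut_biUnion (fun y : X => ({y} : Set X)) K fun i _ j _ hij =>
    Set.disjoint_singleton.2 hij]
  congr 1
  ext x
  simp

/-- On `ℓ¹` the norm of an operator is the supremum of the norms of its columns. -/
theorem norm_le_of_forall_norm_mul_cut_singleton_le {T : Op X E .one} {δ : ℝ} (hδ : 0 ≤ δ)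
    (h : ∀ y, ‖T * cut E .one ({y} : Set X)‖ ≤ δ) : ‖T‖ ≤ δ := by
  classical
  refine T.opNorm_le_bound hδ fun ξ => le_of_forall_pos_le_add fun ε hε => ?_
  obtain ⟨K, hK⟩ := exists_finite_norm_cut_compl_lt (p := .one) (by
    intro h
    injection h with h
    exact ENNReal.one_ne_top h) ξ (ε := ε / (‖T‖ + 1)) (by positivity)
  have hsingle : ∀ y, ‖cut E .one ({y} : Set X) ξ‖ = ‖value ξ y‖ := by
    intro y
    have e : (cut E .one ({y} : Set X) ξ).toLp
        = lp.single (E := fun _ : X => E) 1 y (value ξ y) := by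
      refine lp.ext (funext fun x => ?_)
      change value (cut E .one ({y} : Set X) ξ) x = _
      by_cases hx : x = y
      · subst hx
        rw [value_cut_mem (Set.mem_singleton x), lp.single_apply_self]
      · exact (value_cut_notMem (S := {y}) hx ξ).trans
          (lp.single_apply_ne (E := fun _ : X => E) _ _ _ hx).symm
    have := lp.norm_single (E := fun _ : X => E) (p := 1) zero_lt_one y (value ξ y)
    rw [← e] at this
    exact this
  have h1 : ‖T (cut E .one (K : Set X) ξ)‖ ≤ δ * ‖ξ‖ := by
    rw [← cut_singleton_sum, sum_apply, map_sum]
    calc ‖∑ y ∈ K, T (cut E .one ({y} : Set X) ξ)‖ ≤ ∑ y ∈ K, δ * ‖value ξ y‖ := by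
          refine norm_sum_le_of_le _ fun y _ => ?_
          have e : T (cut E .one ({y} : Set X) ξ)
              = (T * cut E .one ({y} : Set X)) (cut E .one ({y} : Set X) ξ) := by
            have := DFunLike.congr_fun (cut_mul_self (E := E) (p := .one) ({y} : Set X)) ξ
            exact congrArg T this.symm
          rw [e, ← hsingle]
          exact ContinuousLinearMap.le_of_opNorm_le _ (h y) _
      _ = δ * ∑ y ∈ K, ‖value ξ y‖ := by rw [Finset.mul_sum]
      _ ≤ δ * ‖ξ‖ := by
          refine mul_le_mul_of_nonneg_left ?_ hδ
          have := lp.sum_rpow_le_norm_rpow (E := fun _ : X => E) (p := 1) (by norm_num) ξ.toLp K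
          simp only [ENNReal.toReal_one, Real.rpow_one] at this
          exact this
  have h2 : ‖T (cut E .one (K : Set X)ᶜ ξ)‖ ≤ ε := by
    refine (T.le_opNorm _).trans ?_
    rw [lt_div_iff₀ (by positivity)] at hK
    nlinarith [norm_nonneg T, norm_nonneg (cut E .one (K : Set X)ᶜ ξ)]
  rw [← cut_add_cut_compl_apply (K : Set X) ξ, map_add]
  refine (norm_add_le _ _).trans (add_le_add ?_ h2)
  rwa [cut_add_cut_compl_apply]

/-- For the supremum norm, truncating the rows of a quasi-local operator gives approximants of
finite propagation. -/
theorem mem_roe_of_quasiLocal_of_exponent_eq_top (hX : BoundedGeometry X) (hp : p.exponent = ∞)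
    {B : NonUnitalSubalgebra ℂ (Op X E p)} (hBmod : cbMulCb B = (B : Set (Op X E p)))
    (hBcut : ClosedUnderBlockCutdowns B) {b : Op X E p} (hbB : b ∈ B) (hb : QuasiLocal b) :
    b ∈ Roe B := by
  rw [quasiLocal_iff_farCornersLE] at hb
  refine Metric.mem_closure_iff.2 fun ε hε => ?_
  obtain ⟨R, hR, hbR⟩ := hb (ε / 2) (half_pos hε)
  obtain ⟨N, hN⟩ := hX R
  have hself : ∀ i : X, i ∈ Metric.closedBall i R := fun i => Metric.mem_closedBall_self hR
  obtain ⟨T, hTB, hTfin, hT⟩ := exists_sum_mul_mul_mem hX hBmod hBcut hbB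
    (fun i : X => Metric.closedBall i R) dist_le_of_mem_closedBall
    (encard_setOf_mem_closedBall_le hN) (fun i => chi {i})
    (fun i => chi (Metric.closedBall i R)) (fun i => norm_chi_le _) (fun i => norm_chi_le _)
    (fun i x hx => chi_notMem fun h => hx (h ▸ hself i)) (fun i x hx => chi_notMem hx)
  refine ⟨T, ⟨hTB, hTfin⟩, lt_of_le_of_lt ?_ (half_lt_self hε)⟩
  rw [dist_eq_norm]
  refine ContinuousLinearMap.opNorm_le_bound _ (half_pos hε).le fun ξ =>
    norm_le_of_forall_norm_value_le hp (by positivity) fun x => ?_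
  have hval : value (T ξ) x = value (b (cut E p (Metric.closedBall x R) ξ)) x := by
    have hfin := hX.finite_closedBall x R
    rw [hT ξ x hfin.toFinset (fun i hi => by
      rw [Set.Finite.mem_toFinset, Metric.mem_closedBall, dist_comm]
      exact hi), Finset.sum_eq_single x]
    · rw [chi_mem (Set.mem_singleton x), one_smul]
      rfl
    · intro i _ hix
      rw [chi_notMem (fun h => hix h.symm), zero_smul]
    · intro h
      exact absurd (by simpa using hR) h
  have e : value ((b - T) ξ) x
      = value ((cut E p {x} * b * cut E p (Metric.closedBall x R)ᶜ) ξ) x := by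
    change _ = value (cut E p {x} (b (cut E p (Metric.closedBall x R)ᶜ ξ))) x
    rw [value_cut_mem (Set.mem_singleton x), sub_apply, value_sub, hval, ← value_sub, ← map_sub]
    congr 2
    rw [sub_eq_iff_eq_add, add_comm, cut_add_cut_compl_apply]
  rw [e]
  refine (norm_value_le _ x).trans (ContinuousLinearMap.le_of_opNorm_le _ (hbR _ _ ?_) ξ)
  rintro _ rfl y hy
  rw [Set.mem_compl_iff, Metric.mem_closedBall, not_le, dist_comm] at hy
  exact hy

/-- On `ℓ¹`, truncating the columns of a quasi-local operator gives approximants of finite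
propagation. -/
theorem mem_roe_of_quasiLocal_of_eq_one (hX : BoundedGeometry X)
    {B : NonUnitalSubalgebra ℂ (Op X E .one)} (hBmod : cbMulCb B = (B : Set (Op X E .one)))
    (hBcut : ClosedUnderBlockCutdowns B) {b : Op X E .one} (hbB : b ∈ B) (hb : QuasiLocal b) :
    b ∈ Roe B := by
  classical
  rw [quasiLocal_iff_farCornersLE] at hb
  refine Metric.mem_closure_iff.2 fun ε hε => ?_
  obtain ⟨R, hR, hbR⟩ := hb (ε / 2) (half_pos hε)
  obtain ⟨N, hN⟩ := hX R
  have hself : ∀ i : X, i ∈ Metric.closedBall i R := fun i => Metric.mem_closedBall_self hR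
  obtain ⟨T, hTB, hTfin, hT⟩ := exists_sum_mul_mul_mem hX hBmod hBcut hbB
    (fun i : X => Metric.closedBall i R) dist_le_of_mem_closedBall
    (encard_setOf_mem_closedBall_le hN) (fun i => chi (Metric.closedBall i R))
    (fun i => chi {i}) (fun i => norm_chi_le _) (fun i => norm_chi_le _)
    (fun i x hx => chi_notMem hx) (fun i x hx => chi_notMem fun h => hx (h ▸ hself i))
  refine ⟨T, ⟨hTB, hTfin⟩, lt_of_le_of_lt ?_ (half_lt_self hε)⟩
  rw [dist_eq_norm]
  refine norm_le_of_forall_norm_mul_cut_singleton_le (half_pos hε).le fun y => ?_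
  have e : (b - T) * cut E .one {y}
      = cut E .one (Metric.closedBall y R)ᶜ * b * cut E .one {y} := by
    refine op_ext fun ξ x => ?_
    change value (b (cut E .one {y} ξ)) x - value (T (cut E .one {y} ξ)) x
      = value (cut E .one (Metric.closedBall y R)ᶜ (b (cut E .one {y} ξ))) x
    have hfin := hX.finite_closedBall x R
    rw [hT _ x (insert y hfin.toFinset) (fun i hi => by
      rw [Finset.mem_insert, Set.Finite.mem_toFinset, Metric.mem_closedBall, dist_comm]
      exact Or.inr hi), Finset.sum_eq_single y]
    · have h1 : mulOp E .one (chi {y}) (cut E .one {y} ξ) = cut E .one {y} ξ :=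
        DFunLike.congr_fun (cut_mul_self (E := E) (p := .one) ({y} : Set X)) ξ
      rw [h1]
      by_cases hx : x ∈ Metric.closedBall y R
      · rw [chi_mem hx, one_smul, sub_self,
          value_cut_notMem (S := (Metric.closedBall y R)ᶜ) fun h => h hx]
      · rw [chi_notMem hx, zero_smul, sub_zero, value_cut_mem hx]
    · intro i _ hiy
      have h1 : mulOp E .one (chi {i}) (cut E .one {y} ξ) = 0 :=
        DFunLike.congr_fun (cut_mul_cut_of_disjoint (E := E) (p := .one)
          (Set.disjoint_singleton.2 hiy)) ξ
      rw [h1, map_zero, value_zero, smul_zero]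
    · intro h
      exact absurd (Finset.mem_insert_self _ _) h
  rw [e]
  refine hbR _ _ ?_
  rintro x hx _ rfl
  rw [Set.mem_compl_iff, Metric.mem_closedBall, not_le] at hx
  exact hx

end

section

/-! ### Norm localisation for `p < ∞` -/

theorem exponent_toReal_pos (hp : p.exponent ≠ ∞) : 0 < p.exponent.toReal :=
  ENNReal.toReal_pos (exponent_ne_zero p) hp

theorem hasSum_norm_value_rpow (hp : p.exponent ≠ ∞) (ξ : ellP X E p) :
    HasSum (fun x => ‖value ξ x‖ ^ p.exponent.toReal) (‖ξ‖ ^ p.exponent.toReal) :=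
  lp.hasSum_norm (exponent_toReal_pos hp) ξ.toLp

/-- Pointwise comparison of sums of `p`-th powers. -/
theorem sum_norm_rpow_le_sum_norm_rpow (hp : p.exponent ≠ ∞) {ι κ : Type*} (F : Finset ι)
    (G : Finset κ) (η : ι → ellP X E p) (ζ : κ → ellP X E p)
    (h : ∀ x, ∑ i ∈ F, ‖value (η i) x‖ ^ p.exponent.toReal
      ≤ ∑ k ∈ G, ‖value (ζ k) x‖ ^ p.exponent.toReal) :
    ∑ i ∈ F, ‖η i‖ ^ p.exponent.toReal ≤ ∑ k ∈ G, ‖ζ k‖ ^ p.exponent.toReal :=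
  hasSum_le h (hasSum_sum fun i _ => hasSum_norm_value_rpow hp (η i))
    (hasSum_sum fun k _ => hasSum_norm_value_rpow hp (ζ k))

variable (X) in
/-- Every finite weight on `X` has at least half of its mass on a union of sets of diameter at most
`s` with mutual distances more than `r`. -/
def HasSparsification (r s : ℝ) : Prop :=
  ∀ (S : Finset X) (μ : X → ℝ), (∀ x, 0 ≤ μ x) → ∃ F : Finset (Finset X),
    (∀ A ∈ F, A ⊆ S) ∧ (∀ A ∈ F, ∀ x ∈ A, ∀ y ∈ A, dist x y ≤ s) ∧
    (∀ A ∈ F, ∀ A' ∈ F, A ≠ A' → ∀ x ∈ A, ∀ y ∈ A', r < dist x y) ∧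
    ∑ x ∈ S, μ x ≤ 2 * ∑ A ∈ F, ∑ x ∈ A, μ x

variable [DiscreteTopology X]

theorem norm_cut_finset_rpow (hp : p.exponent ≠ ∞) (A : Finset X) (ξ : ellP X E p) :
    ‖cut E p (A : Set X) ξ‖ ^ p.exponent.toReal = ∑ x ∈ A, ‖value ξ x‖ ^ p.exponent.toReal := by
  have h1 := hasSum_norm_value_rpow hp (cut E p (A : Set X) ξ)
  have h2 : HasSum (fun x => ‖value (cut E p (A : Set X) ξ) x‖ ^ p.exponent.toReal)
      (∑ x ∈ A, ‖value (cut E p (A : Set X) ξ) x‖ ^ p.exponent.toReal) :=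
    hasSum_sum_of_ne_finset_zero fun x hx => by
      rw [value_cut_notMem (by simpa using hx), norm_zero,
        Real.zero_rpow (exponent_toReal_pos hp).ne']
  rw [h1.unique h2]
  exact Finset.sum_congr rfl fun x hx => by rw [value_cut_mem (Finset.mem_coe.2 hx)]

/-- An operator that is block diagonal for two disjoint families has norm bounded by those of its
blocks, when `p < ∞`. -/
theorem norm_sum_cut_mul_mul_cut_apply_le (hp : p.exponent ≠ ∞) {ι : Type*} (F : Finset ι)
    (A C : ι → Set X) (hA : ∀ i ∈ F, ∀ j ∈ F, i ≠ j → Disjoint (A i) (A j))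
    (hC : ∀ i ∈ F, ∀ j ∈ F, i ≠ j → Disjoint (C i) (C j)) (T : Op X E p) {ν : ℝ} (hν0 : 0 ≤ ν)
    (hν : ∀ i ∈ F, ‖T * cut E p (C i)‖ ≤ ν) (ξ : ellP X E p) :
    ‖(∑ i ∈ F, cut E p (A i) * T * cut E p (C i)) ξ‖ ≤ ν * ‖ξ‖ := by
  classical
  have ht := exponent_toReal_pos hp
  set t := p.exponent.toReal with htdef
  rw [← Real.rpow_le_rpow_iff (norm_nonneg _) (by positivity) ht]
  have h1 : ‖(∑ i ∈ F, cut E p (A i) * T * cut E p (C i)) ξ‖ ^ t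
      ≤ ∑ i ∈ F, ‖T (cut E p (C i) ξ)‖ ^ t := by
    have := sum_norm_rpow_le_sum_norm_rpow hp {()} F
      (fun _ => (∑ i ∈ F, cut E p (A i) * T * cut E p (C i)) ξ)
      (fun i => T (cut E p (C i) ξ)) (fun x => by
        rw [Finset.sum_singleton, sum_apply, value_sum]
        by_cases h : ∃ i ∈ F, x ∈ A i
        · obtain ⟨i, hi, hx⟩ := h
          have hsingle : ∑ j ∈ F, value ((cut E p (A j) * T * cut E p (C j)) ξ) x
              = value (T (cut E p (C i) ξ)) x := by
            rw [Finset.sum_eq_single_of_mem i hi]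
            · exact value_cut_mem hx _
            · intro j hj hji
              exact value_cut_notMem
                (fun hx' => Set.disjoint_left.1 (hA j hj i hi hji) hx' hx) _
          rw [hsingle]
          exact Finset.single_le_sum
            (f := fun i => ‖value (T (cut E p (C i) ξ)) x‖ ^ p.exponent.toReal)
            (fun _ _ => Real.rpow_nonneg (norm_nonneg _) _) hi
        · push Not at h
          rw [Finset.sum_eq_zero fun i hi => value_cut_notMem (h i hi) _, norm_zero,
            Real.zero_rpow ht.ne']
          exact Finset.sum_nonneg fun _ _ => Real.rpow_nonneg (norm_nonneg _) _)
    simpa using this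
  have h2 : ∑ i ∈ F, ‖cut E p (C i) ξ‖ ^ t ≤ ‖ξ‖ ^ t := by
    have := sum_norm_rpow_le_sum_norm_rpow hp F {()} (fun i => cut E p (C i) ξ) (fun _ => ξ)
      (fun x => by
        rw [Finset.sum_singleton]
        by_cases h : ∃ i ∈ F, x ∈ C i
        · obtain ⟨i, hi, hx⟩ := h
          rw [Finset.sum_eq_single_of_mem i hi, value_cut_mem hx]
          intro j hj hji
          rw [value_cut_notMem fun hx' => Set.disjoint_left.1 (hC j hj i hi hji) hx' hx,
            norm_zero, Real.zero_rpow ht.ne']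
        · push Not at h
          rw [Finset.sum_eq_zero fun i hi => by
            rw [value_cut_notMem (h i hi), norm_zero, Real.zero_rpow ht.ne']]
          exact Real.rpow_nonneg (norm_nonneg _) _)
    simpa using this
  refine h1.trans ?_
  rw [Real.mul_rpow hν0 (norm_nonneg _)]
  refine le_trans ?_ (mul_le_mul_of_nonneg_left h2 (Real.rpow_nonneg hν0 t))
  rw [Finset.mul_sum]
  refine Finset.sum_le_sum fun i hi => ?_
  rw [← Real.mul_rpow hν0 (norm_nonneg _)]
  refine Real.rpow_le_rpow (norm_nonneg _) ?_ ht.le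
  have e : T (cut E p (C i) ξ) = (T * cut E p (C i)) (cut E p (C i) ξ) :=
    congrArg T (DFunLike.congr_fun (cut_mul_self (E := E) (p := p) (C i)) ξ).symm
  rw [e]
  exact ContinuousLinearMap.le_of_opNorm_le _ (hν i hi) _

theorem ne_infty_of_exponent_ne_top (hp : p.exponent ≠ ∞) : p ≠ .infty := by
  rintro rfl
  exact hp rfl

theorem norm_le_of_forall_finset_norm_apply_cut_le (hp : p ≠ .infty) {T : Op X E p} {c : ℝ}
    (hc : 0 ≤ c) (h : ∀ (K : Finset X) ξ, ‖T (cut E p (K : Set X) ξ)‖ ≤ c * ‖ξ‖) : ‖T‖ ≤ c := by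
  refine T.opNorm_le_bound hc fun ξ => le_of_forall_pos_le_add fun ε hε => ?_
  obtain ⟨K, hK⟩ := exists_finite_norm_cut_compl_lt hp ξ (ε := ε / (‖T‖ + 1)) (by positivity)
  have h2 : ‖T (cut E p (K : Set X)ᶜ ξ)‖ ≤ ε := by
    refine (T.le_opNorm _).trans ?_
    rw [lt_div_iff₀ (by positivity)] at hK
    nlinarith [norm_nonneg T, norm_nonneg (cut E p (K : Set X)ᶜ ξ)]
  calc ‖T ξ‖ = ‖T (cut E p (K : Set X) ξ) + T (cut E p (K : Set X)ᶜ ξ)‖ := by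
        rw [← map_add, cut_add_cut_compl_apply]
    _ ≤ c * ‖ξ‖ + ε := (norm_add_le _ _).trans (add_le_add (h K ξ) h2)

/-- Norm localisation: up to a fixed factor and a multiple of the far corners, the norm of an
operator is attained on vectors of bounded support. Half of the mass of a vector lives on
sets that are far apart from each other, where the operator is almost block diagonal. -/
theorem norm_le_of_hasSparsification (hp : p.exponent ≠ ∞) {T : Op X E p} {R δ s ν : ℝ}
    (hT : FarCornersLE T R δ) (hX : HasSparsification X (2 * R) s) (hR : 0 ≤ R) (hν0 : 0 ≤ ν)
    (hν : ∀ A : Finset X, (∀ x ∈ A, ∀ y ∈ A, dist x y ≤ s) →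
      ‖T * cut E p (A : Set X)‖ ≤ ν) :
    ‖T‖ ≤ (1 / 2 : ℝ) ^ (1 / p.exponent.toReal) * ‖T‖ + (5 * δ + ν) := by
  classical
  have hδ : 0 ≤ δ := (norm_nonneg _).trans (hT ∅ ∅ (by simp))
  have ht := exponent_toReal_pos hp
  set t := p.exponent.toReal with htdef
  refine norm_le_of_forall_finset_norm_apply_cut_le (ne_infty_of_exponent_ne_top hp)
    (by positivity) fun K ξ => ?_
  obtain ⟨F, hFK, hFs, hFr, hFμ⟩ := hX K (fun x => ‖value ξ x‖ ^ t)
    fun x => Real.rpow_nonneg (norm_nonneg _) _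
  set Ω : Finset X := F.biUnion id with hΩ
  have hΩK : Ω ⊆ K := Finset.biUnion_subset.2 hFK
  -- The `R`-neighbourhoods `A S` of the pieces `S` are disjoint since the pieces are more than
  -- `2 * R` apart, and `T` maps vectors supported in `S` to vectors almost supported in `A S`.
  let A : Finset X → Set X := fun S => {x | ∃ y ∈ S, dist x y ≤ R}
  let C : Finset X → Set X := fun S => S
  have hAdisj : ∀ i ∈ F, ∀ j ∈ F, i ≠ j → Disjoint (A i) (A j) := by
    intro i hi j hj hij
    refine Set.disjoint_left.2 ?_
    rintro x ⟨y, hy, hxy⟩ ⟨z, hz, hxz⟩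
    have h1 := hFr i hi j hj hij y hy z hz
    have h2 := dist_triangle_left y z x
    linarith
  have hCdisj : ∀ i ∈ F, ∀ j ∈ F, i ≠ j → Disjoint (C i) (C j) := by
    intro i hi j hj hij
    refine Set.disjoint_left.2 fun x hx hx' => ?_
    have h1 := hFr i hi j hj hij x hx x hx'
    rw [dist_self] at h1
    linarith
  have hΩC : (⋃ i ∈ F, C i) = (Ω : Set X) := by
    ext x
    simp [C, hΩ]
  -- The part of the vector off `Ω` has at most half of its mass.
  have hoff : ‖cut E p ((K \ Ω : Finset X) : Set X) ξ‖ ≤ (1 / 2 : ℝ) ^ (1 / t) * ‖ξ‖ := by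
    rw [← Real.rpow_le_rpow_iff (norm_nonneg _) (by positivity) ht,
      Real.mul_rpow (by positivity) (norm_nonneg _), ← Real.rpow_mul (by norm_num),
      one_div_mul_cancel ht.ne', Real.rpow_one, htdef, norm_cut_finset_rpow hp]
    have h1 : ∑ x ∈ Ω, ‖value ξ x‖ ^ t = ∑ S ∈ F, ∑ x ∈ S, ‖value ξ x‖ ^ t :=
      Finset.sum_biUnion fun i hi j hj hij =>
        Finset.disjoint_coe.1 (hCdisj i hi j hj hij)
    have h2 := Finset.sum_sdiff hΩK (f := fun x => ‖value ξ x‖ ^ t)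
    have h3 : ∑ x ∈ K, ‖value ξ x‖ ^ t ≤ ‖ξ‖ ^ t := by
      rw [htdef, ← norm_cut_finset_rpow hp]
      exact Real.rpow_le_rpow (norm_nonneg _) (norm_cut_apply_le _ _) ht.le
    rw [← htdef]
    linarith
  have hsplit : cut E p (K : Set X) ξ
      = cut E p ((K \ Ω : Finset X) : Set X) ξ + cut E p (Ω : Set X) ξ := by
    have := cut_add_cut_diff (E := E) (p := p) (Finset.coe_subset.2 hΩK)
    rw [← this, Finset.coe_sdiff, add_apply, add_comm]
  set P := cut E p (⋃ i ∈ F, A i) with hP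
  set Q := ∑ i ∈ F, cut E p (A i) * T * cut E p (C i) with hQ
  -- `T` restricted to `Ω` splits into the part that leaves the neighbourhood of `Ω`, the part that
  -- leads from one piece to the neighbourhoods of others, and the block diagonal part `Q`.
  have h1 : ‖P * T * cut E p (Ω : Set X) - Q‖ ≤ 4 * δ := by
    rw [← hΩC]
    refine norm_cut_sub_sum_le A C F hAdisj hCdisj T fun S hS => hT _ _ ?_
    intro x hx y hy
    obtain ⟨i, hi, z, hz, hxz⟩ := Set.mem_iUnion₂.1 hx
    obtain ⟨j, hj, hyj⟩ := Set.mem_iUnion₂.1 hy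
    rw [Finset.mem_sdiff] at hj
    have h1 := hFr i (hS hi) j hj.1 (fun h => hj.2 (h ▸ hi)) z hz y hyj
    have h2 := dist_triangle_left z y x
    linarith
  have h2 : ‖cut E p (⋃ i ∈ F, A i)ᶜ * T * cut E p (Ω : Set X)‖ ≤ δ := by
    refine hT _ _ fun x hx y hy => ?_
    by_contra hle
    obtain ⟨i, hi, hyi⟩ := Finset.mem_biUnion.1 (Finset.mem_coe.1 hy)
    exact hx (Set.mem_iUnion₂_of_mem hi ⟨y, hyi, not_lt.1 hle⟩)
  have h3 : ‖Q ξ‖ ≤ ν * ‖ξ‖ :=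
    norm_sum_cut_mul_mul_cut_apply_le hp F A C hAdisj hCdisj T hν0
      (fun i hi => hν i (hFs i hi)) ξ
  have e : T (cut E p (Ω : Set X) ξ)
      = (cut E p (⋃ i ∈ F, A i)ᶜ * T * cut E p (Ω : Set X)) ξ
        + (P * T * cut E p (Ω : Set X) - Q) ξ + Q ξ := by
    have : T * cut E p (Ω : Set X) = cut E p (⋃ i ∈ F, A i)ᶜ * T * cut E p (Ω : Set X)
        + (P * T * cut E p (Ω : Set X) - Q) + Q := by
      rw [cut_compl, ← hP]
      noncomm_ring
    exact DFunLike.congr_fun this ξ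
  rw [hsplit, map_add, e]
  have b1 := (T.le_opNorm _).trans (mul_le_mul_of_nonneg_left hoff (norm_nonneg T))
  have b2 := ContinuousLinearMap.le_of_opNorm_le _ h2 ξ
  have b3 := ContinuousLinearMap.le_of_opNorm_le _ h1 ξ
  refine (norm_add_le _ _).trans ((add_le_add_right norm_add₃_le _).trans ?_)
  linarith

end

section

/-! ### Property A and sparsification -/

/-- A partition of unity with nonnegative functions `ψ i`, supported in uniformly bounded sets `S i`
of finite multiplicity, whose `ℓ¹`-variation at scale `r` is at most `ε`. -/
structure IsLocalPartition {I : Type u} (ψ : I → X → ℝ) (S : I → Set X) (r ε : ℝ) : Prop where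
  nonneg : ∀ i x, 0 ≤ ψ i x
  eq_zero : ∀ i, ∀ x ∉ S i, ψ i x = 0
  bounded : ∃ D : ℝ, ∀ i, ∀ x ∈ S i, ∀ y ∈ S i, dist x y ≤ D
  multiplicity : ∃ M : ℕ, ∀ x, {i | x ∈ S i}.encard ≤ M
  hasSum : ∀ x, HasSum (fun i => ψ i x) 1
  variation : ∀ x y, dist x y ≤ r → ∀ F : Finset I, ∑ i ∈ F, |ψ i x - ψ i y| ≤ ε

/-- A substitute for Hölder's inequality in comparing `q`-variation and `1`-variation: either
`|a - b|` is small relative to `max a b`, and Bernoulli's inequality applies, or it is not, and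
`max a b` is bounded by a multiple of `|a - b|`. -/
theorem abs_rpow_sub_rpow_le {a b q η : ℝ} (ha : 0 ≤ a) (hb : 0 ≤ b) (hq : 1 ≤ q) (hη : 0 < η) :
    |a ^ q - b ^ q| ≤ q * η * (a ^ q + b ^ q) + (|a - b| / η) ^ q := by
  wlog hab : b ≤ a generalizing a b
  · have := this hb ha (le_of_not_ge hab)
    rwa [abs_sub_comm, abs_sub_comm a b, add_comm (a ^ q)]
  have hq0 : 0 ≤ q := zero_le_one.trans hq
  have haq : 0 ≤ a ^ q := Real.rpow_nonneg ha q
  have hbq : 0 ≤ b ^ q := Real.rpow_nonneg hb q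
  have hle : b ^ q ≤ a ^ q := Real.rpow_le_rpow hb hab hq0
  rw [abs_of_nonneg (sub_nonneg.2 hle), abs_of_nonneg (sub_nonneg.2 hab)]
  have hlast : 0 ≤ ((a - b) / η) ^ q := Real.rpow_nonneg (div_nonneg (sub_nonneg.2 hab) hη.le) q
  have hfirst : 0 ≤ q * η * (a ^ q + b ^ q) := by positivity
  rcases le_or_gt a ((a - b) / η) with h | h
  · have := Real.rpow_le_rpow ha h hq0
    linarith
  · have ha0 : 0 < a := (div_nonneg (sub_nonneg.2 hab) hη.le).trans_lt h
    have hB := one_add_mul_self_le_rpow_one_add (s := b / a - 1)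
      (by linarith [div_nonneg hb ha]) hq
    rw [add_sub_cancel, Real.div_rpow hb ha, le_div_iff₀ (Real.rpow_pos_of_pos ha0 q)] at hB
    rw [div_lt_iff₀ hη] at h
    have h1 : 1 - b / a ≤ η := by
      rw [one_sub_div ha0.ne', div_le_iff₀ ha0]
      linarith
    have h2 : q * a ^ q * (1 - b / a) ≤ q * a ^ q * η :=
      mul_le_mul_of_nonneg_left h1 (by positivity)
    nlinarith [mul_nonneg (mul_nonneg hq0 hη.le) hbq]

/-- The `q`-th powers of a metric `q`-partition of unity of small variation. -/
theorem PropertyA.exists_isLocalPartition (hA : PropertyA X) {r ε : ℝ} (hr : 0 < r) (hε : 0 < ε) :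
    ∃ (I : Type u) (ψ : I → X → ℝ) (S : I → Set X), IsLocalPartition ψ S r ε := by
  classical
  obtain ⟨q, hq, hA⟩ := hA
  have hq0 : 0 < q := zero_lt_one.trans_le hq
  -- With these choices `2 q η = ε / 2` and `(ε' / η) ^ q = ε / 2`.
  set η : ℝ := ε / (4 * q) with hη
  have hη0 : 0 < η := by positivity
  set ε' : ℝ := η * (ε / 2) ^ (1 / q) with hε'
  have hε'0 : 0 < ε' := mul_pos hη0 (Real.rpow_pos_of_pos (half_pos hε) _)
  obtain ⟨I, φ, ⟨h01, ⟨D, hD⟩, ⟨M, hM⟩, hsum⟩, hvar⟩ := hA r ε' hr hε'0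
  have hψ0 : ∀ i x, 0 ≤ φ i x ^ q := fun i x => Real.rpow_nonneg (h01 i x).1 q
  refine ⟨I, fun i x => φ i x ^ q, fun i => tsupport (φ i), hψ0, ?_, ⟨D, hD⟩, ⟨M, hM⟩, hsum, ?_⟩
  · intro i x hx
    rw [image_eq_zero_of_notMem_tsupport hx, Real.zero_rpow hq0.ne']
  · intro x y hxy F
    have hfin : ∀ x, {i | x ∈ tsupport (φ i)}.Finite := fun x =>
      Set.finite_of_encard_le_coe (hM x)
    have hsummable : Summable fun i => |φ i x - φ i y| ^ q := by
      refine summable_of_hasFiniteSupport (((hfin x).union (hfin y)).subset fun i hi => ?_)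
      by_contra hne
      rw [Set.mem_union, not_or] at hne
      refine hi ?_
      change |φ i x - φ i y| ^ q = 0
      rw [image_eq_zero_of_notMem_tsupport hne.1, image_eq_zero_of_notMem_tsupport hne.2,
        sub_zero, abs_zero, Real.zero_rpow hq0.ne']
    have h1 : ∑ i ∈ F, |φ i x - φ i y| ^ q ≤ ε' ^ q :=
      (hsummable.sum_le_tsum F fun i _ => Real.rpow_nonneg (abs_nonneg _) q).trans
        (hvar x y hxy).le
    have h2 : ∀ x, ∑ i ∈ F, φ i x ^ q ≤ 1 := fun x =>
      sum_le_hasSum F (fun i _ => hψ0 i x) (hsum x)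
    have h3 : ε' ^ q = η ^ q * (ε / 2) := by
      rw [hε', Real.mul_rpow hη0.le (Real.rpow_nonneg (half_pos hε).le _),
        ← Real.rpow_mul (half_pos hε).le, one_div_mul_cancel hq0.ne', Real.rpow_one]
    calc ∑ i ∈ F, |φ i x ^ q - φ i y ^ q|
        ≤ ∑ i ∈ F, (q * η * (φ i x ^ q + φ i y ^ q) + (|φ i x - φ i y| / η) ^ q) :=
          Finset.sum_le_sum fun i _ => abs_rpow_sub_rpow_le (h01 i x).1 (h01 i y).1 hq hη0
      _ = q * η * (∑ i ∈ F, φ i x ^ q + ∑ i ∈ F, φ i y ^ q)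
          + (∑ i ∈ F, |φ i x - φ i y| ^ q) / η ^ q := by
          rw [Finset.sum_add_distrib, ← Finset.mul_sum, Finset.sum_add_distrib, Finset.sum_div]
          congr 1
          exact Finset.sum_congr rfl fun i _ => Real.div_rpow (abs_nonneg _) hη0.le q
      _ ≤ q * η * (1 + 1) + ε / 2 := by
          refine add_le_add
            (mul_le_mul_of_nonneg_left (add_le_add (h2 x) (h2 y)) (by positivity)) ?_
          rw [div_le_iff₀ (Real.rpow_pos_of_pos hη0 q), mul_comm, ← h3]
          exact h1
      _ = ε := by
          rw [hη]
          field_simp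
          ring

/-- The indicator function of `(-∞, a)`, which turns a value `a` into a family of level sets. -/
def lev (a t : ℝ) : ℝ := (Set.Iio a).indicator (fun _ => 1) t

theorem lev_of_lt {a t : ℝ} (h : t < a) : lev a t = 1 := Set.indicator_of_mem (s := Set.Iio a) h _

theorem lev_of_not_lt {a t : ℝ} (h : ¬ t < a) : lev a t = 0 :=
  Set.indicator_of_notMem (s := Set.Iio a) h _

theorem lev_mono {a b : ℝ} (h : a ≤ b) (t : ℝ) : lev a t ≤ lev b t := by
  by_cases h1 : t < a
  · rw [lev_of_lt h1, lev_of_lt (h1.trans_le h)]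
  · rw [lev_of_not_lt h1]
    exact Set.indicator_nonneg (fun _ _ => zero_le_one) t

open MeasureTheory in
theorem integrable_lev (a : ℝ) : Integrable (lev a) (volume.restrict (Set.Ico 0 1)) :=
  (integrable_const 1).indicator measurableSet_Iio

open MeasureTheory in
theorem integral_lev {a : ℝ} (h0 : 0 ≤ a) (h1 : a ≤ 1) :
    ∫ t, lev a t ∂(volume.restrict (Set.Ico (0 : ℝ) 1)) = a := by
  have h : Set.Iio a ∩ Set.Ico 0 1 = Set.Ico 0 a := by
    ext t
    simp only [Set.mem_inter_iff, Set.mem_Iio, Set.mem_Ico]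
    exact ⟨fun h => ⟨h.2.1, h.1⟩, fun h => ⟨h.2, h.1, h.2.trans_le h1⟩⟩
  calc ∫ t, lev a t ∂(volume.restrict (Set.Ico (0 : ℝ) 1))
      = (volume.restrict (Set.Ico (0 : ℝ) 1)).real (Set.Iio a) :=
        integral_indicator_one measurableSet_Iio
    _ = a := by
      rw [measureReal_restrict_apply measurableSet_Iio, h, Real.volume_real_Ico_of_le h0, sub_zero]

open MeasureTheory in
/-- Among the level sets `{t < ψ i}` of a partition of unity of small variation there is one whose
`r`-boundary has no more mass than the set itself: this holds on average over `i` and `t`. -/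
theorem exists_level_set {I : Type*} (S : Finset X) (μ : X → ℝ) (hμ : ∀ x, 0 ≤ μ x) (r : ℝ)
    (I₀ : Finset I) (ψ : I → X → ℝ) (h0 : ∀ i x, 0 ≤ ψ i x) (h1 : ∀ i x, ψ i x ≤ 1)
    (hsum : ∀ x ∈ S, ∑ i ∈ I₀, ψ i x = 1)
    (hvar : ∀ x ∈ S, ∑ i ∈ I₀, ∑ y ∈ S with dist x y ≤ r, |ψ i y - ψ i x| ≤ 1 / 2)
    (hpos : 0 < ∑ x ∈ S, μ x) :
    ∃ i, ∃ t : ℝ, 0 ≤ t ∧ (∃ x ∈ S, t < ψ i x) ∧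
      ∑ x ∈ S with ¬ t < ψ i x ∧ ∃ y ∈ S, t < ψ i y ∧ dist x y ≤ r, μ x
        ≤ ∑ x ∈ S with t < ψ i x, μ x := by
  classical
  by_contra! hcon
  -- A point `x` of the boundary at level `t` has a neighbour `y` with `ψ i x ≤ t < ψ i y`, so the
  -- boundary is counted by the right-hand side.
  have hpt : ∀ i, ∀ t : ℝ, 0 ≤ t → ∑ x ∈ S, μ x * lev (ψ i x) t ≤
      ∑ x ∈ S, μ x * ∑ y ∈ S with dist x y ≤ r, (lev (max (ψ i x) (ψ i y)) t - lev (ψ i x) t) := by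
    intro i t ht
    have hterm : ∀ x y, 0 ≤ lev (max (ψ i x) (ψ i y)) t - lev (ψ i x) t := fun x y =>
      sub_nonneg.2 (lev_mono (le_max_left _ _) t)
    have hinner : ∀ x, 0 ≤ ∑ y ∈ S with dist x y ≤ r,
        (lev (max (ψ i x) (ψ i y)) t - lev (ψ i x) t) := fun x =>
      Finset.sum_nonneg fun y _ => hterm x y
    by_cases hne : ∃ x ∈ S, t < ψ i x
    · have h := (hcon i t ht hne).le
      rw [Finset.sum_filter, Finset.sum_filter] at h
      refine le_trans (le_of_eq (Finset.sum_congr rfl fun x _ => ?_))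
        (h.trans (Finset.sum_le_sum fun x hx => ?_))
      · split_ifs with hlt
        · rw [lev_of_lt hlt, mul_one]
        · rw [lev_of_not_lt hlt, mul_zero]
      · split_ifs with hb
        · obtain ⟨hx', y, hy, hty, hxy⟩ := hb
          refine le_mul_of_one_le_right (hμ x) ?_
          refine le_trans ?_ (Finset.single_le_sum (fun y _ => hterm x y)
            (Finset.mem_filter.2 ⟨hy, hxy⟩))
          rw [lev_of_lt (lt_max_of_lt_right hty), lev_of_not_lt (not_lt.2 hx'), sub_zero]
        · exact mul_nonneg (hμ x) (hinner x)
    · push Not at hne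
      rw [Finset.sum_eq_zero fun x hx => by
        rw [lev_of_not_lt (not_lt.2 (hne x hx)), mul_zero]]
      exact Finset.sum_nonneg fun x _ => mul_nonneg (hμ x) (hinner x)
  -- Integration over `t` turns `lev a t` into `a`.
  have hint : ∀ i, ∑ x ∈ S, μ x * ψ i x
      ≤ ∑ x ∈ S, μ x * ∑ y ∈ S with dist x y ≤ r, |ψ i y - ψ i x| := by
    intro i
    have i1 : Integrable (fun t => ∑ x ∈ S, μ x * lev (ψ i x) t)
        (volume.restrict (Set.Ico (0 : ℝ) 1)) :=
      integrable_finsetSum _ fun x _ => (integrable_lev _).const_mul _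
    have i4 : ∀ x y, Integrable (fun t => lev (max (ψ i x) (ψ i y)) t - lev (ψ i x) t)
        (volume.restrict (Set.Ico (0 : ℝ) 1)) := fun x y =>
      (integrable_lev _).sub (integrable_lev _)
    have i3 : ∀ x, Integrable (fun t => ∑ y ∈ S with dist x y ≤ r,
        (lev (max (ψ i x) (ψ i y)) t - lev (ψ i x) t)) (volume.restrict (Set.Ico (0 : ℝ) 1)) :=
      fun x => integrable_finsetSum _ fun y _ => i4 x y
    have i2 : Integrable (fun t => ∑ x ∈ S, μ x * ∑ y ∈ S with dist x y ≤ r,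
        (lev (max (ψ i x) (ψ i y)) t - lev (ψ i x) t)) (volume.restrict (Set.Ico (0 : ℝ) 1)) :=
      integrable_finsetSum _ fun x _ => (i3 x).const_mul _
    have h := integral_mono_ae i1 i2 (by
      filter_upwards [ae_restrict_mem measurableSet_Ico] with t ht
      exact hpt i t ht.1)
    rw [integral_finsetSum _ fun x _ => (integrable_lev _).const_mul _,
      integral_finsetSum _ fun x _ => (i3 x).const_mul _] at h
    simp only [integral_const_mul, integral_lev (h0 i _) (h1 i _)] at h
    refine h.trans (Finset.sum_le_sum fun x _ => mul_le_mul_of_nonneg_left ?_ (hμ x))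
    rw [integral_finsetSum _ fun y _ => i4 x y]
    refine Finset.sum_le_sum fun y _ => ?_
    rw [integral_sub (integrable_lev _) (integrable_lev _), integral_lev (h0 i x) (h1 i x),
      integral_lev (le_max_of_le_left (h0 i x)) (max_le (h1 i x) (h1 i y))]
    rcases max_cases (ψ i x) (ψ i y) with ⟨h, -⟩ | ⟨h, -⟩
    · rw [h, sub_self]
      exact abs_nonneg _
    · rw [h]
      exact le_abs_self _
  have htot := Finset.sum_le_sum fun i (_ : i ∈ I₀) => hint i
  rw [Finset.sum_comm, Finset.sum_comm (s := I₀)] at htot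
  simp only [← Finset.mul_sum] at htot
  have h3 : ∑ x ∈ S, μ x * ∑ i ∈ I₀, ψ i x = ∑ x ∈ S, μ x :=
    Finset.sum_congr rfl fun x hx => by rw [hsum x hx, mul_one]
  have h4 : ∑ x ∈ S, μ x * ∑ i ∈ I₀, ∑ y ∈ S with dist x y ≤ r, |ψ i y - ψ i x|
      ≤ ∑ x ∈ S, μ x * (1 / 2) :=
    Finset.sum_le_sum fun x hx => mul_le_mul_of_nonneg_left (hvar x hx) (hμ x)
  rw [← Finset.sum_mul] at h4
  linarith

theorem IsLocalPartition.le_one {I : Type u} {ψ : I → X → ℝ} {S : I → Set X} {r ε : ℝ}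
    (h : IsLocalPartition ψ S r ε) (i : I) (x : X) : ψ i x ≤ 1 :=
  le_hasSum (h.hasSum x) i fun j _ => h.nonneg j x

theorem IsLocalPartition.sum_eq_one {I : Type u} {ψ : I → X → ℝ} {S : I → Set X} {r ε : ℝ}
    (h : IsLocalPartition ψ S r ε) {x : X} {G : Finset I} (hG : ∀ i, x ∈ S i → i ∈ G) :
    ∑ i ∈ G, ψ i x = 1 :=
  (hasSum_sum_of_ne_finset_zero fun i hi => h.eq_zero i x fun hx => hi (hG i hx)).unique
    (h.hasSum x)

theorem IsLocalPartition.exists_finset {I : Type u} {ψ : I → X → ℝ} {S : I → Set X} {r ε : ℝ}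
    (h : IsLocalPartition ψ S r ε) {K : Set X} (hK : K.Finite) :
    ∃ G : Finset I, ∀ x ∈ K, ∀ i, x ∈ S i → i ∈ G := by
  obtain ⟨M, hM⟩ := h.multiplicity
  have hfin : (⋃ x ∈ K, {i | x ∈ S i}).Finite :=
    hK.biUnion fun x _ => Set.finite_of_encard_le_coe (hM x)
  exact ⟨hfin.toFinset, fun x hx i hi => by
    rw [Set.Finite.mem_toFinset]
    exact Set.mem_biUnion hx hi⟩

/-- Property A gives sparsification: cut out, one after the other, level sets with small boundary,
discarding the boundaries. -/
theorem PropertyA.exists_hasSparsification (hX : BoundedGeometry X) (hA : PropertyA X) {r : ℝ}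
    (hr : 0 ≤ r) : ∃ s, HasSparsification X r s := by
  classical
  obtain ⟨N, hN⟩ := hX r
  obtain ⟨I, ψ, U, hψ⟩ := hA.exists_isLocalPartition (r := r + 1) (ε := 1 / (2 * (N + 1)))
    (by positivity) (by positivity)
  obtain ⟨D, hD⟩ := hψ.bounded
  -- The pieces lie in supports of the partition, of diameter at most `D`.
  refine ⟨D, fun S μ hμ => ?_⟩
  induction S using Finset.strongInduction with
  | H S ih =>
    rcases (Finset.sum_nonneg fun x (_ : x ∈ S) => hμ x).eq_or_lt with h0 | hpos
    · exact ⟨∅, by simp, by simp, by simp, by simp [← h0]⟩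
    obtain ⟨I₀, hI₀⟩ := hψ.exists_finset S.finite_toSet
    obtain ⟨i, t, ht, ⟨x₀, hx₀, hx₀t⟩, hbd⟩ := exists_level_set S μ hμ r I₀ ψ hψ.nonneg hψ.le_one
      (fun x hx => hψ.sum_eq_one (hI₀ x hx)) (by
        intro x hx
        rw [Finset.sum_comm]
        have hcard : (({y ∈ S | dist x y ≤ r} : Finset X).card : ℝ) ≤ N := by
          have h1 : (({y ∈ S | dist x y ≤ r} : Finset X) : Set X) ⊆ Metric.closedBall x r := by
            intro y hy
            rw [Metric.mem_closedBall, dist_comm]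
            exact (Finset.mem_filter.1 (Finset.mem_coe.1 hy)).2
          have h2 := (Set.encard_le_encard h1).trans (hN x)
          rw [Set.encard_coe_eq_coe_finsetCard] at h2
          exact_mod_cast h2
        calc ∑ y ∈ S with dist x y ≤ r, ∑ i ∈ I₀, |ψ i y - ψ i x|
            ≤ ∑ y ∈ S with dist x y ≤ r, 1 / (2 * ((N : ℝ) + 1)) :=
              Finset.sum_le_sum fun y hy => hψ.variation y x (by
                rw [dist_comm]
                linarith [(Finset.mem_filter.1 hy).2]) I₀
          _ ≤ 1 / 2 := by
              rw [Finset.sum_const, nsmul_eq_mul, mul_one_div, div_le_div_iff₀ (by positivity)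
                (by positivity)]
              linarith) hpos
    -- The level set `A` is one of the pieces; `S'` is what remains of `S` off `A` and its boundary.
    set A : Finset X := {x ∈ S | t < ψ i x} with hAdef
    set S' : Finset X := {x ∈ S | ¬ t < ψ i x ∧ ¬ ∃ y ∈ S, t < ψ i y ∧ dist x y ≤ r} with hS'
    have hx₀A : x₀ ∈ A := Finset.mem_filter.2 ⟨hx₀, hx₀t⟩
    have hss : S' ⊂ S := Finset.filter_ssubset.2 ⟨x₀, hx₀, fun h => h.1 hx₀t⟩
    obtain ⟨F, hFS, hFD, hFr, hFμ⟩ := ih S' hss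
    have hfar : ∀ x ∈ A, ∀ B ∈ F, ∀ y ∈ B, r < dist x y := by
      intro x hx B hB y hy
      have hy' := (Finset.mem_filter.1 (hFS B hB hy)).2.2
      by_contra hle
      rw [Finset.mem_filter] at hx
      exact hy' ⟨x, hx.1, hx.2, by rw [dist_comm]; exact not_lt.1 hle⟩
    have hAF : A ∉ F := by
      intro h
      have := hfar x₀ hx₀A A h x₀ hx₀A
      rw [dist_self] at this
      linarith
    have hAU : ∀ x ∈ A, x ∈ U i := by
      intro x hx
      by_contra hxU
      have h1 := (Finset.mem_filter.1 hx).2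
      rw [hψ.eq_zero i x hxU] at h1
      linarith
    refine ⟨insert A F, ?_, ?_, ?_, ?_⟩
    · intro B hB
      rcases Finset.mem_insert.1 hB with rfl | hB
      · exact Finset.filter_subset _ _
      · exact (hFS B hB).trans hss.subset
    · intro B hB x hx y hy
      rcases Finset.mem_insert.1 hB with rfl | hB
      · exact hD i x (hAU x hx) y (hAU y hy)
      · exact hFD B hB x hx y hy
    · intro B hB B' hB' hne x hx y hy
      rcases Finset.mem_insert.1 hB with h | hB <;> rcases Finset.mem_insert.1 hB' with h' | hB'
      · exact absurd (h.trans h'.symm) hne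
      · exact hfar x (h ▸ hx) B' hB' y hy
      · rw [dist_comm]
        exact hfar y (h' ▸ hy) B hB x hx
      · exact hFr B hB B' hB' hne x hx y hy
    · rw [Finset.sum_insert hAF]
      have h1 := Finset.sum_filter_add_sum_filter_not S (fun x => t < ψ i x) μ
      have h2 := Finset.sum_filter_add_sum_filter_not ({x ∈ S | ¬ t < ψ i x} : Finset X)
        (fun x => ∃ y ∈ S, t < ψ i y ∧ dist x y ≤ r) μ
      rw [Finset.filter_filter, Finset.filter_filter] at h2
      linarith

end

section

/-! ### Averaging over a partition of unity -/

theorem abs_rpow_inv_sub_rpow_le {a b t : ℝ} (ha : 0 ≤ a) (hb : 0 ≤ b) (ht : 1 ≤ t) :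
    |a ^ (1 / t) - b ^ (1 / t)| ^ t ≤ |a - b| := by
  wlog hab : b ≤ a generalizing a b
  · have := this hb ha (le_of_not_ge hab)
    rwa [abs_sub_comm, abs_sub_comm a b]
  have ht0 : 0 < t := zero_lt_one.trans_le ht
  have hpow : ∀ c : ℝ, 0 ≤ c → (c ^ (1 / t)) ^ t = c := fun c hc => by
    rw [← Real.rpow_mul hc, one_div_mul_cancel ht0.ne', Real.rpow_one]
  have hle : b ^ (1 / t) ≤ a ^ (1 / t) := Real.rpow_le_rpow hb hab (by positivity)
  rw [abs_of_nonneg (sub_nonneg.2 hle), abs_of_nonneg (sub_nonneg.2 hab)]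
  have := Real.add_rpow_le_rpow_add (sub_nonneg.2 hle) (Real.rpow_nonneg hb (1 / t)) ht
  rw [sub_add_cancel, hpow a ha, hpow b hb] at this
  linarith

/-- Hölder's inequality for averages with weights `a i ^ (1 / t')`. -/
theorem norm_sum_rpow_smul_rpow_le {I : Type*} {t t' : ℝ} (htt' : t.HolderConjugate t')
    (G : Finset I) (a : I → ℝ) (ha : ∀ i, 0 ≤ a i) (hsum : ∑ i ∈ G, a i ≤ 1) (c : I → ℂ)
    (hc : ∀ i, ‖c i‖ = a i ^ (1 / t')) (e : I → E) :
    ‖∑ i ∈ G, c i • e i‖ ^ t ≤ ∑ i ∈ G, ‖e i‖ ^ t := by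
  have ht : 0 < t := htt'.pos
  have ht' : 0 < t' := htt'.symm.pos
  have hS : 0 ≤ ∑ i ∈ G, ‖e i‖ ^ t :=
    Finset.sum_nonneg fun i _ => Real.rpow_nonneg (norm_nonneg _) _
  have h1 : ‖∑ i ∈ G, c i • e i‖ ≤ (∑ i ∈ G, ‖e i‖ ^ t) ^ (1 / t) := by
    calc ‖∑ i ∈ G, c i • e i‖ ≤ ∑ i ∈ G, ‖c i‖ * ‖e i‖ :=
          norm_sum_le_of_le _ fun i _ => (norm_smul _ _).le
      _ ≤ (∑ i ∈ G, |‖c i‖| ^ t') ^ (1 / t') * (∑ i ∈ G, |‖e i‖| ^ t) ^ (1 / t) :=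
          Real.inner_le_Lp_mul_Lq G _ _ htt'.symm
      _ ≤ 1 * (∑ i ∈ G, ‖e i‖ ^ t) ^ (1 / t) := by
          simp only [abs_norm]
          refine mul_le_mul_of_nonneg_right ?_ (Real.rpow_nonneg hS _)
          refine Real.rpow_le_one (Finset.sum_nonneg fun i _ => Real.rpow_nonneg (norm_nonneg _) _)
            ?_ (by positivity)
          refine le_trans (le_of_eq (Finset.sum_congr rfl fun i _ => ?_)) hsum
          rw [hc, ← Real.rpow_mul (ha i), one_div_mul_cancel ht'.ne', Real.rpow_one]
      _ = _ := one_mul _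
  calc ‖∑ i ∈ G, c i • e i‖ ^ t ≤ ((∑ i ∈ G, ‖e i‖ ^ t) ^ (1 / t)) ^ t :=
        Real.rpow_le_rpow (norm_nonneg _) h1 ht.le
    _ = _ := by rw [← Real.rpow_mul hS, one_div_mul_cancel ht.ne', Real.rpow_one]

/-- Averages with weights `ψ i ^ (1 / t')` are contractions from `ℓ^p`-sums of copies of
`ℓ^p_E(X)`. -/
theorem norm_sum_mulOp_rpow_le (hp : p.exponent ≠ ∞) {I : Type*} {t' : ℝ}
    (htt' : p.exponent.toReal.HolderConjugate t') (G : Finset I) (ψ : I → X → ℝ)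
    (h0 : ∀ i x, 0 ≤ ψ i x) (hsum : ∀ x, ∑ i ∈ G, ψ i x ≤ 1) (u : I → X →ᵇ ℂ)
    (hu : ∀ i x, ‖u i x‖ = ψ i x ^ (1 / t')) (η : I → ellP X E p) :
    ‖∑ i ∈ G, mulOp E p (u i) (η i)‖ ^ p.exponent.toReal
      ≤ ∑ i ∈ G, ‖η i‖ ^ p.exponent.toReal := by
  have := sum_norm_rpow_le_sum_norm_rpow hp {()} G
    (fun _ => ∑ i ∈ G, mulOp E p (u i) (η i)) η (fun x => by
      rw [Finset.sum_singleton, value_sum]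
      exact norm_sum_rpow_smul_rpow_le htt' G (fun i => ψ i x) (fun i => h0 i x) (hsum x)
        (fun i => u i x) (fun i => hu i x) fun i => value (η i) x)
  simpa using this

theorem sum_norm_mulOp_rpow_le (hp : p.exponent ≠ ∞) {I : Type*} (G : Finset I) (w : I → X →ᵇ ℂ)
    {ε : ℝ} (hε : 0 ≤ ε) (ξ : ellP X E p)
    (hw : ∀ x, value ξ x ≠ 0 → ∑ i ∈ G, ‖w i x‖ ^ p.exponent.toReal
      ≤ ε ^ p.exponent.toReal) :
    ∑ i ∈ G, ‖mulOp E p (w i) ξ‖ ^ p.exponent.toReal ≤ (ε * ‖ξ‖) ^ p.exponent.toReal := by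
  have ht := exponent_toReal_pos hp
  have := sum_norm_rpow_le_sum_norm_rpow hp G {()} (fun i => mulOp E p (w i) ξ)
    (fun _ => (ε : ℂ) • ξ) (fun x => by
      rw [Finset.sum_singleton, value_smul, norm_smul, Complex.norm_real,
        Real.norm_of_nonneg hε, Real.mul_rpow hε (norm_nonneg _)]
      by_cases hx : value ξ x = 0
      · rw [hx, norm_zero, Real.zero_rpow ht.ne', mul_zero]
        refine (Finset.sum_eq_zero fun i _ => ?_).le
        rw [value_mulOp, hx, smul_zero, norm_zero, Real.zero_rpow ht.ne']
      · refine le_trans (le_of_eq ?_) (mul_le_mul_of_nonneg_right (hw x hx)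
          (Real.rpow_nonneg (norm_nonneg _) _))
        rw [Finset.sum_mul]
        refine Finset.sum_congr rfl fun i _ => ?_
        rw [value_mulOp, norm_smul, Real.mul_rpow (norm_nonneg _) (norm_nonneg _)])
  rw [Finset.sum_singleton, norm_smul, Complex.norm_real, Real.norm_of_nonneg hε] at this
  exact this

theorem sum_norm_apply_rpow_le (hp : p.exponent ≠ ∞) {I : Type*} (G : Finset I)
    (η : I → ellP X E p) (T : Op X E p) {C : ℝ} (hT : ‖T‖ ≤ C) :
    ∑ i ∈ G, ‖T (η i)‖ ^ p.exponent.toReal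
      ≤ C ^ p.exponent.toReal * ∑ i ∈ G, ‖η i‖ ^ p.exponent.toReal := by
  have hC : 0 ≤ C := (norm_nonneg _).trans hT
  rw [Finset.mul_sum]
  refine Finset.sum_le_sum fun i _ => ?_
  rw [← Real.mul_rpow hC (norm_nonneg _)]
  exact Real.rpow_le_rpow (norm_nonneg _) (T.le_of_opNorm_le hT _) (exponent_toReal_pos hp).le

variable [DiscreteTopology X]

/-- The function `ψ ^ s` as an element of `C_b(X)`. -/
def powFun (ψ : X → ℝ) (h0 : ∀ x, 0 ≤ ψ x) (h1 : ∀ x, ψ x ≤ 1) {s : ℝ} (hs : 0 ≤ s) : X →ᵇ ℂ :=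
  BoundedContinuousFunction.ofNormedAddCommGroupDiscrete (fun x => ((ψ x ^ s : ℝ) : ℂ)) 1
    fun x => by
      rw [Complex.norm_real, Real.norm_of_nonneg (Real.rpow_nonneg (h0 x) s)]
      exact Real.rpow_le_one (h0 x) (h1 x) hs

theorem powFun_apply (ψ : X → ℝ) (h0 : ∀ x, 0 ≤ ψ x) (h1 : ∀ x, ψ x ≤ 1) {s : ℝ} (hs : 0 ≤ s)
    (x : X) : powFun ψ h0 h1 hs x = ((ψ x ^ s : ℝ) : ℂ) := rfl

theorem norm_powFun_apply (ψ : X → ℝ) (h0 : ∀ x, 0 ≤ ψ x) (h1 : ∀ x, ψ x ≤ 1) {s : ℝ}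
    (hs : 0 ≤ s) (x : X) : ‖powFun ψ h0 h1 hs x‖ = ψ x ^ s := by
  rw [powFun_apply, Complex.norm_real, Real.norm_of_nonneg (Real.rpow_nonneg (h0 x) s)]

theorem norm_powFun_le (ψ : X → ℝ) (h0 : ∀ x, 0 ≤ ψ x) (h1 : ∀ x, ψ x ≤ 1) {s : ℝ} (hs : 0 ≤ s) :
    ‖powFun ψ h0 h1 hs‖ ≤ 1 :=
  (BoundedContinuousFunction.norm_le zero_le_one).2 fun x => by
    rw [norm_powFun_apply]
    exact Real.rpow_le_one (h0 x) (h1 x) hs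

/-- An operator `T` in `B` of finite propagation obtained by averaging `b` over a partition of
unity `ψ` of small variation, `T = ∑ i, ψ i ^ (1 / p') b ψ i ^ (1 / p)`. Far corners of `T` are no
larger than those of `b`, by Hölder's inequality, and `T` is close to `b` on vectors with support
small compared to the scale of `ψ`, because there the functions `ψ i` are almost constant. -/
theorem exists_average (hX : BoundedGeometry X) (hp1 : 1 < p.exponent) (hp : p.exponent ≠ ∞)
    {B : NonUnitalSubalgebra ℂ (Op X E p)} (hBmod : cbMulCb B = (B : Set (Op X E p)))
    (hBcut : ClosedUnderBlockCutdowns B) {b : Op X E p} (hbB : b ∈ B) {R δ s ε : ℝ} (hR : 0 ≤ R)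
    (hb : FarCornersLE b R δ) (hε : 0 ≤ ε) {I : Type u} {ψ : I → X → ℝ} {S : I → Set X}
    (hψ : IsLocalPartition ψ S (s + R) (ε ^ p.exponent.toReal)) :
    ∃ T ∈ B, FinitePropagation T ∧ FarCornersLE T R δ ∧
      ∀ K : Finset X, (∀ x ∈ K, ∀ y ∈ K, dist x y ≤ s) →
        ‖(b - T) * cut E p (K : Set X)‖ ≤ 2 * δ + 2 * (ε * ‖b‖) := by
  classical
  have hδ : 0 ≤ δ := (norm_nonneg _).trans (hb ∅ ∅ (by simp))
  have ht := exponent_toReal_pos hp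
  have ht1 : 1 < p.exponent.toReal := by
    have := (ENNReal.toReal_lt_toReal ENNReal.one_ne_top hp).2 hp1
    rwa [ENNReal.toReal_one] at this
  set t := p.exponent.toReal with htdef
  obtain ⟨t', htt'⟩ : ∃ t' : ℝ, t.HolderConjugate t' :=
    ⟨_, Real.HolderConjugate.conjExponent ht1⟩
  have ht' : 0 < t' := htt'.symm.pos
  obtain ⟨D, hD⟩ := hψ.bounded
  obtain ⟨M, hM⟩ := hψ.multiplicity
  set u : I → X →ᵇ ℂ := fun i => powFun (ψ i) (hψ.nonneg i) (hψ.le_one i)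
    (s := 1 / t') (by positivity) with hu
  set v : I → X →ᵇ ℂ := fun i => powFun (ψ i) (hψ.nonneg i) (hψ.le_one i)
    (s := 1 / t) (by positivity) with hv
  have hnu : ∀ i x, ‖u i x‖ = ψ i x ^ (1 / t') := fun i x => norm_powFun_apply _ _ _ _ x
  have hnv : ∀ i x, ‖v i x‖ = ψ i x ^ (1 / t) := fun i x => norm_powFun_apply _ _ _ _ x
  have hu0 : ∀ i, ∀ x ∉ S i, u i x = 0 := fun i x hx => by
    rw [← norm_eq_zero, hnu, hψ.eq_zero i x hx, Real.zero_rpow (by positivity)]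
  have hv0 : ∀ i, ∀ x ∉ S i, v i x = 0 := fun i x hx => by
    rw [← norm_eq_zero, hnv, hψ.eq_zero i x hx, Real.zero_rpow (by positivity)]
  have hsum1 : ∀ (G : Finset I) x, ∑ i ∈ G, ψ i x ≤ 1 := fun G x =>
    sum_le_hasSum G (fun i _ => hψ.nonneg i x) (hψ.hasSum x)
  have hvpow : ∀ (G : Finset I) x, ∑ i ∈ G, ‖v i x‖ ^ t ≤ 1 := fun G x => by
    refine le_trans (le_of_eq (Finset.sum_congr rfl fun i _ => ?_)) (hsum1 G x)
    rw [hnv, ← Real.rpow_mul (hψ.nonneg i x), one_div_mul_cancel ht.ne', Real.rpow_one]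
  obtain ⟨T, hTB, hTfin, hT⟩ := exists_sum_mul_mul_mem hX hBmod hBcut hbB S hD hM u v
    (fun i => norm_powFun_le _ _ _ _) (fun i => norm_powFun_le _ _ _ _) hu0 hv0
  -- On finitely supported vectors `T` is a finite sum of operators.
  have hTsum : ∀ (K : Finset X) (G : Finset I), (∀ x ∈ (K : Set X), ∀ i, x ∈ S i → i ∈ G) →
      ∀ ξ : ellP X E p, (∀ x ∉ K, value ξ x = 0) →
        T ξ = ∑ i ∈ G, mulOp E p (u i) (b (mulOp E p (v i) ξ)) := by
    intro K G hG ξ hξ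
    refine ellP_ext fun x => ?_
    have hfin : {i | x ∈ S i}.Finite := Set.finite_of_encard_le_coe (hM x)
    rw [hT ξ x (G ∪ hfin.toFinset) (fun i hi => Finset.mem_union_right _ (by simpa using hi)),
      value_sum]
    refine (Finset.sum_subset Finset.subset_union_left fun i _ hi => ?_).symm
    have hz : mulOp E p (v i) ξ = 0 := by
      refine ellP_ext fun y => ?_
      rw [value_mulOp, value_zero]
      by_cases hy : y ∈ K
      · rw [hv0 i y fun h => hi (hG y hy i h), zero_smul]
      · rw [hξ y hy, smul_zero]
    rw [hz, map_zero, value_zero, smul_zero]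
  have hvanish : ∀ (K : Finset X) (ξ : ellP X E p), ∀ x ∉ K,
      value (cut E p (K : Set X) ξ) x = 0 := fun K ξ x hx =>
    value_cut_notMem (by simpa using hx) ξ
  have hTcorner : FarCornersLE T R δ := by
    intro A C hAC
    have hbAC := hb A C hAC
    refine norm_le_of_forall_finset_norm_apply_cut_le (ne_infty_of_exponent_ne_top hp) hδ
      fun K ξ => ?_
    obtain ⟨G, hG⟩ := hψ.exists_finset K.finite_toSet
    set ξ' := cut E p (K : Set X) ξ with hξ'
    have e : (cut E p A * T * cut E p C) ξ'
        = ∑ i ∈ G, mulOp E p (u i) ((cut E p A * b * cut E p C) (mulOp E p (v i) ξ')) := by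
      change cut E p A (T (cut E p C ξ')) = _
      rw [hTsum K G hG (cut E p C ξ') (fun x hx => by
        rw [cut, value_mulOp, hvanish K ξ x hx, smul_zero]), map_sum]
      refine Finset.sum_congr rfl fun i _ => ?_
      have c1 : mulOp E p (v i) (cut E p C ξ') = cut E p C (mulOp E p (v i) ξ') :=
        DFunLike.congr_fun (cut_mul_mulOp_comm C (v i)).symm ξ'
      rw [c1]
      exact DFunLike.congr_fun (cut_mul_mulOp_comm A (u i)) _
    rw [← Real.rpow_le_rpow_iff (norm_nonneg _) (by positivity) ht, e]
    refine (norm_sum_mulOp_rpow_le hp htt' G ψ hψ.nonneg (hsum1 G) u hnu _).trans ?_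
    refine (sum_norm_apply_rpow_le hp G _ _ hbAC).trans ?_
    rw [Real.mul_rpow hδ (norm_nonneg _)]
    refine mul_le_mul_of_nonneg_left ?_ (Real.rpow_nonneg hδ _)
    refine (sum_norm_mulOp_rpow_le hp G v zero_le_one ξ' fun x _ => by
      rw [Real.one_rpow]; exact hvpow G x).trans ?_
    rw [one_mul]
    exact Real.rpow_le_rpow (norm_nonneg _) (norm_cut_apply_le _ _) ht.le
  refine ⟨T, hTB, hTfin, hTcorner, fun K hK => ?_⟩
  rcases K.eq_empty_or_nonempty with rfl | ⟨x₀, hx₀⟩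
  · rw [Finset.coe_empty, cut_empty, mul_zero, norm_zero]
    positivity
  set N : Set X := {x | ∃ y ∈ (K : Set X), dist x y ≤ R} with hN
  have hNfin : N.Finite := hX.finite_nhd K.finite_toSet R
  have hKN : (K : Set X) ⊆ N := fun x hx => ⟨x, hx, by rw [dist_self]; exact hR⟩
  have hfar : ∀ x ∈ Nᶜ, ∀ y ∈ (K : Set X), R < dist x y := fun x hx y hy => by
    by_contra hle
    exact hx ⟨y, hy, not_lt.1 hle⟩
  have hNx₀ : ∀ x ∈ N, dist x x₀ ≤ s + R := by
    rintro x ⟨y, hy, hxy⟩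
    have h1 := hK y hy x₀ hx₀
    have h2 := dist_triangle x y x₀
    linarith
  obtain ⟨G, hG⟩ := hψ.exists_finset hNfin
  -- On `N` the function `v i` differs little from its value `v i x₀`, and constants commute with
  -- `b`: with `w i = v i - v i x₀`, the difference `b - T` is `∑ i, u i (w i b - b w i)`.
  have hnear : ‖cut E p N * (b - T) * cut E p (K : Set X)‖ ≤ 2 * (ε * ‖b‖) := by
    refine ContinuousLinearMap.opNorm_le_bound _ (by positivity) fun ξ => ?_
    set ξ' := cut E p (K : Set X) ξ with hξ'
    let c : I → ℂ := fun i => v i x₀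
    set w : I → X →ᵇ ℂ := fun i => v i - c i • (1 : X →ᵇ ℂ) with hw
    have hwx : ∀ i x, w i x = v i x - v i x₀ := fun i x => by
      change v i x - v i x₀ * 1 = _
      rw [mul_one]
    have hwpow : ∀ x ∈ N, ∑ i ∈ G, ‖w i x‖ ^ t ≤ ε ^ t := by
      intro x hx
      refine le_trans (Finset.sum_le_sum fun i _ => ?_) (hψ.variation x x₀ (hNx₀ x hx) G)
      have e : w i x = ((ψ i x ^ (1 / t) - ψ i x₀ ^ (1 / t) : ℝ) : ℂ) := by
        rw [hwx, Complex.ofReal_sub]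
        rfl
      rw [e, Complex.norm_real, Real.norm_eq_abs]
      exact abs_rpow_inv_sub_rpow_le (hψ.nonneg i x) (hψ.nonneg i x₀) ht1.le
    set ζ₁ := ∑ i ∈ G, mulOp E p (u i) (mulOp E p (w i) (cut E p N (b ξ'))) with hζ₁
    set ζ₂ := ∑ i ∈ G, mulOp E p (u i) (cut E p N (b (mulOp E p (w i) ξ'))) with hζ₂
    have hdec : (cut E p N * (b - T) * cut E p (K : Set X)) ξ = ζ₁ - ζ₂ := by
      refine ellP_ext fun x => ?_
      change value (cut E p N ((b - T) ξ')) x = _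
      rw [value_sub, hζ₁, hζ₂, value_sum, value_sum]
      by_cases hx : x ∈ N
      · have hone : ∑ i ∈ G, u i x * v i x = 1 := by
          have : ∑ i ∈ G, ψ i x = 1 := hψ.sum_eq_one (hG x hx)
          rw [← Complex.ofReal_one, ← this, Complex.ofReal_sum]
          refine Finset.sum_congr rfl fun i _ => ?_
          change ((ψ i x ^ (1 / t') : ℝ) : ℂ) * ((ψ i x ^ (1 / t) : ℝ) : ℂ) = _
          rw [← Complex.ofReal_mul, ← Real.rpow_add_of_nonneg (hψ.nonneg i x) (by positivity)
            (by positivity), one_div, one_div, add_comm, htt'.inv_add_inv_eq_one, Real.rpow_one]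
        have hwξ : ∀ i, mulOp E p (w i) ξ' = mulOp E p (v i) ξ' - c i • ξ' := fun i => by
          rw [hw, mulOp_sub, mulOp_smul, mulOp_one]
          rfl
        rw [value_cut_mem hx, sub_apply, value_sub, hTsum K G (fun y hy => hG y (hKN hy)) ξ'
          (hvanish K ξ), value_sum, ← Finset.sum_sub_distrib]
        conv_lhs => rw [← one_smul ℂ (value (b ξ') x), ← hone, Finset.sum_smul,
          ← Finset.sum_sub_distrib]
        refine Finset.sum_congr rfl fun i _ => ?_
        rw [value_mulOp, value_mulOp, value_mulOp, value_mulOp, value_cut_mem hx,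
          value_cut_mem hx, hwξ, map_sub, map_smul, value_sub, value_smul, hwx, smul_sub, sub_smul,
          smul_sub, mul_smul]
        change _ = _ - u i x • v i x₀ • value (b ξ') x
          - (_ - u i x • v i x₀ • value (b ξ') x)
        abel
      · rw [value_cut_notMem hx, Finset.sum_eq_zero, Finset.sum_eq_zero, sub_zero]
        · intro i _
          rw [value_mulOp, value_cut_notMem hx, smul_zero]
        · intro i _
          rw [value_mulOp, value_mulOp, value_cut_notMem hx, smul_zero, smul_zero]
    have hξ'le : ‖ξ'‖ ≤ ‖ξ‖ := norm_cut_apply_le _ _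
    have b1 : ‖ζ₁‖ ≤ ε * (‖b‖ * ‖ξ‖) := by
      rw [← Real.rpow_le_rpow_iff (norm_nonneg _) (by positivity) ht]
      refine (norm_sum_mulOp_rpow_le hp htt' G ψ hψ.nonneg (hsum1 G) u hnu _).trans ?_
      refine (sum_norm_mulOp_rpow_le hp G w hε (cut E p N (b ξ')) fun x hx => hwpow x ?_).trans ?_
      · by_contra hxN
        exact hx (value_cut_notMem hxN _)
      · refine Real.rpow_le_rpow (by positivity) (mul_le_mul_of_nonneg_left ?_ hε) ht.le
        refine (norm_cut_apply_le _ _).trans ((b.le_opNorm _).trans ?_)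
        exact mul_le_mul_of_nonneg_left hξ'le (norm_nonneg b)
    have b2 : ‖ζ₂‖ ≤ ε * (‖b‖ * ‖ξ‖) := by
      rw [← Real.rpow_le_rpow_iff (norm_nonneg _) (by positivity) ht]
      refine (norm_sum_mulOp_rpow_le hp htt' G ψ hψ.nonneg (hsum1 G) u hnu _).trans ?_
      refine (sum_norm_apply_rpow_le hp G (fun i => mulOp E p (w i) ξ') (cut E p N * b)
        (norm_mul_le_left_of_le_one (norm_cut_le N))).trans ?_
      have h1 := sum_norm_mulOp_rpow_le hp G w hε ξ' fun x hx => hwpow x (by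
        by_contra hxN
        exact hx (hvanish K ξ x fun h => hxN (hKN h)))
      refine (mul_le_mul_of_nonneg_left h1 (Real.rpow_nonneg (norm_nonneg b) _)).trans ?_
      rw [← Real.mul_rpow (norm_nonneg b) (by positivity)]
      refine Real.rpow_le_rpow (by positivity) ?_ ht.le
      nlinarith [mul_le_mul_of_nonneg_left hξ'le (mul_nonneg (norm_nonneg b) hε)]
    rw [hdec]
    refine (norm_sub_le _ _).trans ?_
    linarith
  have hfarT : ‖cut E p Nᶜ * (b - T) * cut E p (K : Set X)‖ ≤ 2 * δ := by
    rw [mul_sub, sub_mul]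
    refine (norm_sub_le _ _).trans ?_
    have h1 := hb _ _ hfar
    have h2 := hTcorner _ _ hfar
    linarith
  have e : (b - T) * cut E p (K : Set X) = cut E p Nᶜ * (b - T) * cut E p (K : Set X)
      + cut E p N * (b - T) * cut E p (K : Set X) := by
    rw [cut_compl]
    noncomm_ring
  rw [e]
  exact (norm_add_le _ _).trans (add_le_add hfarT hnear)

/-- Under Property A and for `1 < p < ∞`, a quasi-local operator is a limit of its averages: by norm
localisation, the difference is controlled by its values on vectors of bounded support. -/
theorem mem_roe_of_quasiLocal_of_propertyA (hX : BoundedGeometry X) (hA : PropertyA X)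
    (hp1 : 1 < p.exponent) (hp : p.exponent ≠ ∞)
    {B : NonUnitalSubalgebra ℂ (Op X E p)} (hBmod : cbMulCb B = (B : Set (Op X E p)))
    (hBcut : ClosedUnderBlockCutdowns B) {b : Op X E p} (hbB : b ∈ B) (hb : QuasiLocal b) :
    b ∈ Roe B := by
  rw [quasiLocal_iff_farCornersLE] at hb
  refine Metric.mem_closure_iff.2 fun ε₀ hε₀ => ?_
  have ht := exponent_toReal_pos hp
  -- Norm localisation bounds `κ ‖b - T‖` by `5 (2 δ) + (2 δ + 2 ε ‖b‖) = 12 δ + 2 ε ‖b‖`, of which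
  -- the terms are at most `κ ε₀ / 3` each.
  set κ : ℝ := 1 - (1 / 2 : ℝ) ^ (1 / p.exponent.toReal) with hκ
  have hκ0 : 0 < κ := sub_pos.2 (Real.rpow_lt_one (by norm_num) (by norm_num) (by positivity))
  set δ : ℝ := κ * ε₀ / 36 with hδ
  have hδ0 : 0 < δ := by positivity
  set ε : ℝ := κ * ε₀ / (6 * (‖b‖ + 1)) with hε
  have hε0 : 0 < ε := by positivity
  obtain ⟨R, hR, hbR⟩ := hb δ hδ0
  obtain ⟨s, hs⟩ := hA.exists_hasSparsification hX (r := 2 * R) (by positivity)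
  obtain ⟨I, ψ, S, hψ⟩ := hA.exists_isLocalPartition (r := |s| + R + 1)
    (ε := ε ^ p.exponent.toReal) (by positivity) (Real.rpow_pos_of_pos hε0 _)
  have hψ' : IsLocalPartition ψ S (s + R) (ε ^ p.exponent.toReal) :=
    { hψ with variation := fun x y hxy => hψ.variation x y (by linarith [le_abs_self s]) }
  obtain ⟨T, hTB, hTfin, hTcorner, hTloc⟩ :=
    exists_average hX hp1 hp hBmod hBcut hbB hR hbR hε0.le hψ'
  refine ⟨T, ⟨hTB, hTfin⟩, ?_⟩
  rw [dist_eq_norm]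
  have hcorner : FarCornersLE (b - T) R (2 * δ) := by
    intro A C hAC
    rw [mul_sub, sub_mul]
    refine (norm_sub_le _ _).trans ?_
    have h1 := hbR A C hAC
    have h2 := hTcorner A C hAC
    linarith
  have hmain := norm_le_of_hasSparsification hp hcorner hs hR
    (ν := 2 * δ + 2 * (ε * ‖b‖)) (by positivity) hTloc
  have h1 : 2 * (ε * ‖b‖) ≤ κ * ε₀ / 3 := by
    have : ε * ‖b‖ ≤ κ * ε₀ / 6 := by
      rw [hε, div_mul_eq_mul_div, div_le_div_iff₀ (by positivity) (by positivity)]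
      nlinarith [mul_pos hκ0 hε₀, norm_nonneg b]
    linarith
  have h2 : κ * ‖b - T‖ < κ * ε₀ := by
    have h3 : κ * ‖b - T‖ = ‖b - T‖ - (1 / 2 : ℝ) ^ (1 / p.exponent.toReal) * ‖b - T‖ := by
      rw [hκ]
      ring
    have h4 := mul_pos hκ0 hε₀
    rw [h3]
    linarith
  exact lt_of_mul_lt_mul_left h2 hκ0.le

/-- Quasi-locality, asymptotic commutation with very Lipschitz sequences, and the Higson commutator
condition are equivalent, for every `p`. -/
theorem tfae_quasiLocal (hX : BoundedGeometry X) {B : NonUnitalSubalgebra ℂ (Op X E p)}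
    (hBmod : cbMulCb B = (B : Set (Op X E p))) {b : Op X E p} (hbB : b ∈ B) :
    List.TFAE [CommutesWithVL b, QuasiLocal b, HigsonCommutatorsIn B b] := by
  tfae_have 1 → 2 := quasiLocal_of_commutesWithVL
  tfae_have 2 → 1 := commutesWithVL_of_quasiLocal
  tfae_have 2 → 3 := higsonCommutatorsIn_of_quasiLocal hX hBmod hbB
  tfae_have 3 → 2 := quasiLocal_of_higsonCommutatorsIn hX
  tfae_finish

theorem tfae_quasiLocal_roe (hX : BoundedGeometry X) {B : NonUnitalSubalgebra ℂ (Op X E p)}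
    (hBmod : cbMulCb B = (B : Set (Op X E p))) {b : Op X E p} (hbB : b ∈ B)
    (hroe : QuasiLocal b → b ∈ Roe B) :
    List.TFAE [CommutesWithVL b, QuasiLocal b, HigsonCommutatorsIn B b, b ∈ Roe B] := by
  have h := tfae_quasiLocal hX hBmod hbB
  tfae_have 1 ↔ 2 := h.out 0 1
  tfae_have 2 ↔ 3 := h.out 1 2
  tfae_have 2 → 4 := hroe
  tfae_have 4 → 2 := quasiLocal_of_mem_roe
  tfae_finish

end

end

end RoeLike

theorem theorem3p3 {X : Type u} [MetricSpace X] (hX : RoeLike.BoundedGeometry X)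
    {E : Type v} [NormedAddCommGroup E] [NormedSpace ℂ E] [CompleteSpace E]
    (p : RoeLike.LpIndex)
    (B : NonUnitalSubalgebra ℂ (RoeLike.Op X E p))
    (hBclosed : IsClosed (B : Set (RoeLike.Op X E p)))
    (hBmod : RoeLike.cbMulCb B = (B : Set (RoeLike.Op X E p)))
    (hBcut : RoeLike.ClosedUnderBlockCutdowns B)
    (b : RoeLike.Op X E p) (hb : b ∈ B) :
    ((p = .zero ∨ p = .one ∨ p = .infty) →
      List.TFAE [RoeLike.CommutesWithVL b, RoeLike.QuasiLocal b,
        RoeLike.HigsonCommutatorsIn B b, b ∈ RoeLike.Roe B]) ∧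
    ((1 < p.exponent ∧ p.exponent < ⊤) →
      List.TFAE [RoeLike.CommutesWithVL b, RoeLike.QuasiLocal b,
        RoeLike.HigsonCommutatorsIn B b] ∧
      (RoeLike.PropertyA X →
        List.TFAE [RoeLike.CommutesWithVL b, RoeLike.QuasiLocal b,
          RoeLike.HigsonCommutatorsIn B b, b ∈ RoeLike.Roe B])) := by
  have _ := hX.discreteTopology
  refine ⟨?_, fun hp => ⟨RoeLike.tfae_quasiLocal hX hBmod hb, fun hA => ?_⟩⟩
  · intro hp
    refine RoeLike.tfae_quasiLocal_roe hX hBmod hb fun hq => ?_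
    rcases hp with rfl | rfl | rfl
    · exact RoeLike.mem_roe_of_quasiLocal_of_exponent_eq_top hX rfl hBmod hBcut hb hq
    · exact RoeLike.mem_roe_of_quasiLocal_of_eq_one hX hBmod hBcut hb hq
    · exact RoeLike.mem_roe_of_quasiLocal_of_exponent_eq_top hX rfl hBmod hBcut hb hq
  · exact RoeLike.tfae_quasiLocal_roe hX hBmod hb
      (RoeLike.mem_roe_of_quasiLocal_of_propertyA hX hA hp.1 hp.2.ne hBmod hBcut hb)
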